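/- Let $d\ge 1$, let $2\le q_0<\infty$ and let $B$ be a (real or complex) Banach space of martingale cotype $q_0$: there is a constant $C$ such that for every probability space $\Omega$, every increasing sequence $(\mathcal E_n)_{n\ge 0}$ of conditional expectations on it and every $f\in L^{q_0}(\Omega;B)$, $$\mathbb E\|\mathcal E_0 f\|^{q_0}+\sum_{n\ge 1}\mathbb E\|\mathcal E_n f-\mathcal E_{n-1}f\|^{q_0}\le C\,\mathbb E\|f\|^{q_0}.$$ For a locally integrable $f:\mathbb R^d\to B$ let $A_tf(x)=\frac1{|B_t|}\int_{B_t}f(x+y)\,dy$, where $B_t$ is the open Euclidean ball of radius $t$ centred at $0$, let $\mathbb E_kf$ $(k\in\mathbb Z)$ be the conditional expectation of $f$ with respect to the $\sigma$-algebra generated by the half-open dyadic cubes $\prod_{i=1}^d[m_i2^k,(m_i+1)2^k)$, $m\in\mathbb Z^d$ (so $\mathbb E_kf(x)$ is the mean of $f$ over the cube that contains $x$), and let $$\mathcal{LV}_{q_0}f(x)=\Big(\sum_{k\in\mathbb Z}\|A_{2^k}f(x)-\mathbb E_kf(x)\|^{q_0}\Big)^{1/q_0}\in[0,\infty].$$ For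 locally integrable $g:\mathbb R^d\to\mathbb R$ let $\|g\|_{BMO_d}=\sup_Q\frac1{|Q|}\int_Q|g-g_Q|$, where $Q$ runs over all these dyadic cubes (of all side lengths $2^k$) and $g_Q=\frac1{|Q|}\int_Qg$. Then: (i) For every $1<p<\infty$ there is a constant $C_p$ (depending on $d,q_0,B$ and $p$) such that $\|\mathcal{LV}_{q_0}f\|_{L^p(\mathbb R^d)}\le C_p\|f\|_{L^p(\mathbb R^d;B)}$ for all $f\in L^p(\mathbb R^d;B)$. (ii) There is a constant $C$ (depending on $d,q_0,B$) such that $|\{x:\mathcal{LV}_{q_0}f(x)>\lambda\}|\le\frac C\lambda\|f\|_{L^1(\mathbb R^d;B)}$ for all $f\in L^1(\mathbb R^d;B)$ and all $\lambda>0$. (iii) There is a constant $C$ (depending on $d,q_0,B$) such that for every compactly supported $f\in L^\infty(\mathbb R^d;B)$, and more generally for every $f\in L^\infty(\mathbb R^d;B)$ with $\mathcal{LV}_{q_0}f<\infty$ almost everywhere, the function $\mathcal{LV}_{q_0}f$ is locally integrable and $\|\mathcal{LV}_{q_0}f\|_{BMO_d}\le C\|f\|_{L^\infty(\mathbb R^d;B)}$.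 For compactly supported $f\in L^\infty(\mathbb R^d;B)$ one always has $\mathcal{LV}_{q_0}f<\infty$ almost everywhere. -/

import Mathlib

open MeasureTheory
open scoped ENNReal NNReal

noncomputable section

/-- A real Banach space `B` has martingale cotype `q` if there is a constant `C` such that, for every
probability space, every filtration `(F n)` with conditional expectations `𝓔 n`, and every
`f ∈ L^q(Ω; B)`, `𝔼 ‖𝓔 0 f‖ ^ q + ∑_{n ≥ 1} 𝔼 ‖𝓔 n f - 𝓔 (n - 1) f‖ ^ q ≤ C * 𝔼 ‖f‖ ^ q`. -/
def HasMartingaleCotype (B : Type*) [NormedAddCommGroup B] [NormedSpace ℝ B] [CompleteSpace B]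
    (q : ℝ) : Prop :=
  ∃ C : ℝ≥0, ∀ (Ω : Type) [mΩ : MeasurableSpace Ω] (P : Measure Ω) [IsProbabilityMeasure P]
    (F : Filtration ℕ mΩ) (f : Ω → B), MemLp f (ENNReal.ofReal q) P →
      (∫⁻ ω, ‖(P[f | F 0]) ω‖ₑ ^ q ∂P)
        + ∑' n : ℕ, ∫⁻ ω, ‖(P[f | F (n + 1)]) ω - (P[f | F n]) ω‖ₑ ^ q ∂P
      ≤ C * ∫⁻ ω, ‖f ω‖ₑ ^ q ∂P

/-- The half-open dyadic cube `∏ i, [m i * 2 ^ k, (m i + 1) * 2 ^ k)`, `m ∈ ℤ ^ d`, of side length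
`2 ^ k` that contains `x`. -/
def dyadicCube {d : ℕ} (k : ℤ) (x : EuclideanSpace ℝ (Fin d)) : Set (EuclideanSpace ℝ (Fin d)) :=
  {y | ∀ i, ⌊y i / (2 : ℝ) ^ k⌋ = ⌊x i / (2 : ℝ) ^ k⌋}

/-- The conditional expectation of a locally integrable function on `ℝ ^ d` with respect to the
`σ`-algebra generated by the (countably many, pairwise disjoint) dyadic cubes of side length
`2 ^ k`: its value at `x` is the mean of `f` over the atom that contains `x`. -/
def dyadicCondExp {d : ℕ} {B : Type*} [NormedAddCommGroup B] [NormedSpace ℝ B]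
    (k : ℤ) (f : EuclideanSpace ℝ (Fin d) → B) (x : EuclideanSpace ℝ (Fin d)) : B :=
  ⨍ y in dyadicCube k x, f y

/-- The central average `A_t f (x) = |B_t|⁻¹ ∫_{B_t} f (x + y) dy` over the open Euclidean ball
`B_t` with centre `0` and radius `t`. -/
def ballAverage {d : ℕ} {B : Type*} [NormedAddCommGroup B] [NormedSpace ℝ B]
    (t : ℝ) (f : EuclideanSpace ℝ (Fin d) → B) (x : EuclideanSpace ℝ (Fin d)) : B :=
  ⨍ y in Metric.ball (0 : EuclideanSpace ℝ (Fin d)) t, f (x + y)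

/-- The long variation operator `(∑_{k ∈ ℤ} ‖A_{2 ^ k} f (x) - 𝔼_k f (x)‖ ^ q) ^ (1 / q)`, with
values in `[0, ∞]`. -/
def longVariation {d : ℕ} {B : Type*} [NormedAddCommGroup B] [NormedSpace ℝ B]
    (q : ℝ) (f : EuclideanSpace ℝ (Fin d) → B) (x : EuclideanSpace ℝ (Fin d)) : ℝ≥0∞ :=
  (∑' k : ℤ, ‖ballAverage ((2 : ℝ) ^ k) f x - dyadicCondExp k f x‖ₑ ^ q) ^ (1 / q)

/-- The dyadic BMO norm `sup_Q |Q|⁻¹ ∫_Q |g - g_Q|`, where `Q` runs over all dyadic cubes and `g_Q`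
is the mean of `g` over `Q`; it is meant for locally integrable `g`. -/
def dyadicBMONorm {d : ℕ} (g : EuclideanSpace ℝ (Fin d) → ℝ) : ℝ≥0∞ :=
  ⨆ (k : ℤ) (x : EuclideanSpace ℝ (Fin d)),
    (volume (dyadicCube k x))⁻¹ *
      ∫⁻ y in dyadicCube k x, ‖g y - (⨍ z in dyadicCube k x, g z)‖ₑ

end

/-!
The proof compares the averages over balls with the dyadic martingale, and then runs
Calderón–Zygmund theory for the resulting `ℓ^q`-valued operator `f ↦ (A_{2^k} f - 𝔼_k f)_k`, whose
`k`-th component is `avgDiff k f`.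

*The exponent `q`.* Write `d_j = 𝔼_{j-1} f - 𝔼_j f` for the martingale differences (`martDiff`).
For bounded integrable `f` the component `avgDiff k f` is at most `∑_j ‖avgDiff k d_j‖`. There is
almost orthogonality: if `j ≤ k`, then `d_j` has mean zero over the cubes of side `2^j`, so that
an average over a ball of radius `2^k` only sees the cubes that meet its boundary, which are
contained in a thin shell; if `j > k`, then `d_j` is constant on cubes of side `2^(j-1)` and
averaging over the ball changes it only near the boundaries of these cubes. In both cases
`‖avgDiff k d_j‖_q^q` is at most `C 2^(-|j-k|) ‖d_j‖_q^q`
(`exists_lintegral_avgDiff_martDiff_le`). Martingale cotype, applied on each large cube with its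
normalized measure, gives `∑_j ‖d_j‖_q^q ≤ C ‖f‖_q^q` (`exists_tsum_martDiff_le`), and the `L^q`
estimate follows (`exists_lintegral_longVariation_rpow_le`).

*Weak type `(1, 1)`.* In the Calderón–Zygmund decomposition at height `t`, made with the dyadic
cubes themselves, the dyadic means of the bad function vanish off the selected cubes, and off
their enlargements its averages over balls of radius `2^k` only see the selected cubes of side at
most `2^k`. The mean zero gain above is then summable. The good function is bounded by `2^d t` and
is handled by the `L^q` estimate (`exists_volume_lt_longVariation_le`).

*Coarse scales.* The kernels are not smooth, but balls of radius `2^k` about two points of one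
dyadic cube of side `2^m ≤ 2^k` differ by a subset of a thin shell, and the dyadic means agree for
`k ≥ m`. By Hölder's inequality the scales coarser than `2^m` vary over that cube by at most a
constant times the maximal function of `L^r` means, for each `r > 1`
(`exists_partialVariation_Ioi_le`). The remaining scales only see `f` near the cube
(`partialVariation_Iic_le`).

*Strong type `(p, p)`.* These two facts and the weak type inequality, applied to the restriction
of `f` to a neighbourhood of each maximal cube of a dyadic enlargement of the level set, give a
good-`λ` inequality with the maximal function of `L^r` means (`exists_good_lambda`).
With `1 < r < p` it covers all `1 < p < ∞` at once, without interpolation or duality; the sum over the heights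
`3^n` replaces the integral in `λ`. Fatou's lemma extends the inequality from integrable functions
to `L^p` (`longVariation_rpow_le_liminf`).

*Bounded functions.* On a dyadic cube the coarse scales are constant up to `C ‖f‖_∞`, and the fine
scales are handled by the `L^q` estimate for the restriction of `f` to a neighbourhood of the cube
(`exists_lintegral_enorm_longVariation_sub_le`).
-/

noncomputable section

namespace LongVariation

variable {d : ℕ}

local notation "𝓔" => EuclideanSpace ℝ (Fin d)

/-! ### Dyadic cubes and saturated sets -/

/-- The index `m ∈ ℤ ^ d` of the dyadic cube of side length `2 ^ k` that contains `x`. -/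
def gridIndex (k : ℤ) (x : 𝓔) : Fin d → ℤ := fun i => ⌊x i / (2 : ℝ) ^ k⌋

lemma dyadicCube_eq_preimage (k : ℤ) (x : 𝓔) :
    dyadicCube k x = gridIndex k ⁻¹' {gridIndex k x} := by
  ext y; simp [dyadicCube, gridIndex, funext_iff]

lemma measurable_gridIndex (k : ℤ) : Measurable (gridIndex (d := d) k) := by
  refine measurable_pi_lambda _ fun i => Int.measurable_floor.comp ?_
  exact (EuclideanSpace.proj (𝕜 := ℝ) i).continuous.measurable.div_const _

lemma mem_dyadicCube_iff {k : ℤ} {x y : 𝓔} :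
    y ∈ dyadicCube k x ↔ gridIndex k y = gridIndex k x := by
  simp [dyadicCube_eq_preimage]

lemma mem_dyadicCube_self (k : ℤ) (x : 𝓔) : x ∈ dyadicCube k x := fun _ => rfl

lemma dyadicCube_eq_of_mem {k : ℤ} {x y : 𝓔} (h : y ∈ dyadicCube k x) :
    dyadicCube k y = dyadicCube k x := by
  rw [dyadicCube_eq_preimage, dyadicCube_eq_preimage, mem_dyadicCube_iff.1 h]

lemma mem_dyadicCube_comm {k : ℤ} {x y : 𝓔} :
    y ∈ dyadicCube k x ↔ x ∈ dyadicCube k y := by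
  rw [mem_dyadicCube_iff, mem_dyadicCube_iff, eq_comm]

lemma measurableSet_dyadicCube (k : ℤ) (x : 𝓔) : MeasurableSet (dyadicCube k x) := by
  rw [dyadicCube_eq_preimage]
  exact measurable_gridIndex k (measurableSet_singleton _)

lemma floor_div_zpow_add (t : ℝ) (k : ℤ) (n : ℕ) :
    ⌊t / (2 : ℝ) ^ (k + n)⌋ = ⌊t / (2 : ℝ) ^ k⌋ / (2 ^ n : ℕ) := by
  rw [← Int.floor_div_natCast, div_div, zpow_add₀ two_ne_zero, zpow_natCast]
  norm_cast

lemma gridIndex_eq_of_le {j k : ℤ} (hjk : j ≤ k) :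
    gridIndex (d := d) k = (fun m i => m i / ((2 ^ (k - j).toNat : ℕ) : ℤ)) ∘ gridIndex j := by
  funext x i
  have h := floor_div_zpow_add (x i) j (k - j).toNat
  rw [Int.toNat_of_nonneg (by omega), add_sub_cancel] at h
  exact h

lemma dyadicCube_subset {j k : ℤ} (hjk : j ≤ k) (x : 𝓔) : dyadicCube j x ⊆ dyadicCube k x := by
  intro y hy
  rw [mem_dyadicCube_iff] at hy ⊢
  rw [gridIndex_eq_of_le hjk, Function.comp, Function.comp, hy]

lemma zpow_two_pos (k : ℤ) : (0 : ℝ) < 2 ^ k := zpow_pos two_pos k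

lemma mem_dyadicCube_iff_Ico {k : ℤ} {x y : 𝓔} :
    y ∈ dyadicCube k x ↔ ∀ i, y i ∈ Set.Ico ((gridIndex k x i : ℝ) * 2 ^ k)
      ((gridIndex k x i + 1 : ℝ) * 2 ^ k) := by
  refine forall_congr' fun i => ?_
  rw [Int.floor_eq_iff, le_div_iff₀ (zpow_two_pos k), div_lt_iff₀ (zpow_two_pos k)]
  rfl

/-- The volume of a product of intervals in `ℝ ^ d`. -/
lemma volume_box (a b : Fin d → ℝ) :
    volume {x : 𝓔 | ∀ i, x i ∈ Set.Ico (a i) (b i)} = ∏ i, ENNReal.ofReal (b i - a i) := by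
  rw [← Real.volume_pi_Ico, ← (PiLp.volume_preserving_ofLp (Fin d)).measure_preimage
    (measurableSet_Ico_pi a b).nullMeasurableSet]
  · congr 1; ext x; simp [Set.mem_pi]
where measurableSet_Ico_pi (a b : Fin d → ℝ) :
    MeasurableSet (Set.pi Set.univ fun i => Set.Ico (a i) (b i)) :=
  MeasurableSet.univ_pi fun _ => measurableSet_Ico

lemma volume_dyadicCube (k : ℤ) (x : 𝓔) :
    volume (dyadicCube k x) = ENNReal.ofReal (((2 : ℝ) ^ k) ^ d) := by
  have : dyadicCube k x = {y : 𝓔 | ∀ i, y i ∈ Set.Ico ((gridIndex k x i : ℝ) * 2 ^ k)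
      ((gridIndex k x i + 1 : ℝ) * 2 ^ k)} := by
    ext y; exact mem_dyadicCube_iff_Ico
  rw [this, volume_box]
  have : ∀ i, ((gridIndex k x i + 1 : ℝ) * 2 ^ k) - (gridIndex k x i : ℝ) * 2 ^ k = 2 ^ k :=
    fun i => by ring
  simp only [this, Finset.prod_const, Finset.card_univ, Fintype.card_fin]
  rw [ENNReal.ofReal_pow (zpow_two_pos k).le]

lemma volume_dyadicCube_pos (k : ℤ) (x : 𝓔) : volume (dyadicCube k x) ≠ 0 := by
  rw [volume_dyadicCube]
  simpa using pow_pos (zpow_two_pos k) d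

lemma volume_dyadicCube_ne_top (k : ℤ) (x : 𝓔) : volume (dyadicCube k x) ≠ ∞ := by
  rw [volume_dyadicCube]; exact ENNReal.ofReal_ne_top

lemma norm_sub_le_of_mem_dyadicCube {k : ℤ} {x y : 𝓔} (h : y ∈ dyadicCube k x) :
    ‖y - x‖ ≤ d * 2 ^ k := by
  have h1 := mem_dyadicCube_iff_Ico.1 h
  have h2 := mem_dyadicCube_iff_Ico.1 (mem_dyadicCube_self k x)
  have h3 : ∀ i, ‖(y - x) i‖ ≤ 2 ^ k := fun i => by
    obtain ⟨a, b⟩ := h1 i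
    obtain ⟨a', b'⟩ := h2 i
    have : (y - x) i = y i - x i := rfl
    rw [this, Real.norm_eq_abs, abs_le]
    constructor <;> nlinarith
  calc ‖y - x‖ ≤ ∑ i, ‖(y - x) i‖ := by
        rw [EuclideanSpace.norm_eq]
        refine Real.sqrt_le_iff.2 ⟨Finset.sum_nonneg fun i _ => norm_nonneg _, ?_⟩
        exact Finset.sum_sq_le_sq_sum_of_nonneg fun i _ => norm_nonneg _
    _ ≤ ∑ _i : Fin d, (2 : ℝ) ^ k := Finset.sum_le_sum fun i _ => h3 i
    _ = d * 2 ^ k := by simp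

/-- The layer of points of a dyadic cube of level `i` that leave the cube under the translation by
a vector shorter than `2 ^ k` fills at most the fraction `d * 2 ^ (k - i)` of the cube. -/
lemma volume_dyadicCube_escape {k i : ℤ} (x y : 𝓔) (hy : ‖y‖ < 2 ^ k) :
    volume {z ∈ dyadicCube i x | z + y ∉ dyadicCube i x}
      ≤ ENNReal.ofReal (d * 2 ^ (k - i)) * volume (dyadicCube i x) := by
  have hk := zpow_two_pos k
  have hi := zpow_two_pos i
  set s : ℝ := 2 ^ i with hs
  set a : Fin d → ℝ := fun l => gridIndex i x l * s with ha
  set b : Fin d → ℝ := fun l => (gridIndex i x l + 1) * s with hb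
  have hba : ∀ l, b l - a l = s := fun l => by simp only [ha, hb]; ring
  have hQ : ∀ z : 𝓔, z ∈ dyadicCube i x ↔ ∀ l, z l ∈ Set.Ico (a l) (b l) :=
    fun z => mem_dyadicCube_iff_Ico
  -- A point that leaves through the face with normal direction `l` lies in a thin box.
  set a' : Fin d → Fin d → ℝ :=
    fun l => Function.update a l (if 0 ≤ y l then b l - |y l| else a l) with ha'
  set b' : Fin d → Fin d → ℝ :=
    fun l => Function.update b l (if 0 ≤ y l then b l else a l + |y l|) with hb'
  have hsub : {z ∈ dyadicCube i x | z + y ∉ dyadicCube i x}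
      ⊆ ⋃ l, {z : 𝓔 | ∀ n, z n ∈ Set.Ico (a' l n) (b' l n)} := by
    rintro z ⟨hz, hzy⟩
    rw [hQ] at hz hzy
    push Not at hzy
    obtain ⟨l, hl⟩ := hzy
    refine Set.mem_iUnion.2 ⟨l, fun n => ?_⟩
    by_cases hn : n = l
    · subst hn
      have hzn := hz n
      have e : (z + y) n = z n + y n := rfl
      rw [e] at hl
      simp only [ha', hb', Function.update_self]
      simp only [Set.mem_Ico, not_and_or, not_le, not_lt] at hl hzn ⊢
      split_ifs with h0
      · rw [abs_of_nonneg h0]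
        rcases hl with hl | hl <;> constructor <;> linarith
      · rw [abs_of_neg (not_le.1 h0)]
        rcases hl with hl | hl <;> constructor <;> linarith
    · simp only [ha', hb', Function.update_of_ne hn]
      exact hz n
  have hvol : ∀ l, volume {z : 𝓔 | ∀ n, z n ∈ Set.Ico (a' l n) (b' l n)}
      ≤ ENNReal.ofReal (2 ^ (k - i)) * volume (dyadicCube i x) := by
    intro l
    have hdiff : (fun n => ENNReal.ofReal (b' l n - a' l n))
        = Function.update (fun _ => ENNReal.ofReal s) l (ENNReal.ofReal |y l|) := by
      funext n
      by_cases hn : n = l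
      · subst hn
        simp only [ha', hb', Function.update_self]
        congr 1
        split_ifs <;> ring
      · simp only [ha', hb', Function.update_of_ne hn, hba]
    have hyl : |y l| ≤ 2 ^ k := by
      have := PiLp.norm_apply_le y l
      rw [Real.norm_eq_abs] at this
      exact this.trans hy.le
    rw [volume_box, hdiff, Finset.prod_update_of_mem (Finset.mem_univ l), volume_dyadicCube,
      Finset.prod_const, ← Finset.compl_eq_univ_sdiff, Finset.card_compl, Finset.card_singleton,
      Fintype.card_fin, ← ENNReal.ofReal_pow hi.le, ← ENNReal.ofReal_mul (abs_nonneg _),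
      ← ENNReal.ofReal_mul (by positivity)]
    refine ENNReal.ofReal_le_ofReal ?_
    have hd : s ^ d = s ^ (d - 1) * s := by
      rw [← pow_succ, Nat.sub_add_cancel (Fin.pos l)]
    rw [hd, zpow_sub₀ two_ne_zero]
    have : (2 : ℝ) ^ k / s * (s ^ (d - 1) * s) = 2 ^ k * s ^ (d - 1) := by
      field_simp
    rw [← hs, this]
    gcongr
  calc _ ≤ ∑' l : Fin d, volume {z : 𝓔 | ∀ n, z n ∈ Set.Ico (a' l n) (b' l n)} :=
        (measure_mono hsub).trans (measure_iUnion_le _)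
    _ ≤ ∑' _l : Fin d, ENNReal.ofReal (2 ^ (k - i)) * volume (dyadicCube i x) :=
        ENNReal.tsum_le_tsum hvol
    _ = _ := by
        rw [tsum_fintype, Finset.sum_const, Finset.card_univ, Fintype.card_fin, nsmul_eq_mul,
          ENNReal.ofReal_mul (Nat.cast_nonneg _), ENNReal.ofReal_natCast, mul_assoc]

/-- A set is dyadically saturated of level `k` if it is a union of dyadic cubes of side length
`2 ^ k`. -/
def DyadicSaturated (k : ℤ) (U : Set 𝓔) : Prop := ∀ x ∈ U, dyadicCube k x ⊆ U

lemma DyadicSaturated.eq_preimage {k : ℤ} {U : Set 𝓔} (hU : DyadicSaturated k U) :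
    U = gridIndex k ⁻¹' (gridIndex k '' U) := by
  ext x
  refine ⟨fun hx => ⟨x, hx, rfl⟩, fun ⟨y, hy, hyx⟩ => hU y hy (mem_dyadicCube_iff.2 hyx.symm)⟩

lemma DyadicSaturated.measurableSet {k : ℤ} {U : Set 𝓔} (hU : DyadicSaturated k U) :
    MeasurableSet U := by
  rw [hU.eq_preimage]
  exact measurable_gridIndex k (Set.to_countable _).measurableSet

lemma DyadicSaturated.compl {k : ℤ} {U : Set 𝓔} (hU : DyadicSaturated k U) :
    DyadicSaturated k Uᶜ := fun _ hx y hy hyU => hx (hU y hyU (mem_dyadicCube_comm.1 hy))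

lemma DyadicSaturated.inter {k : ℤ} {U V : Set 𝓔} (hU : DyadicSaturated k U)
    (hV : DyadicSaturated k V) : DyadicSaturated k (U ∩ V) :=
  fun x hx => Set.subset_inter (hU x hx.1) (hV x hx.2)

lemma DyadicSaturated.mono {j k : ℤ} (hjk : j ≤ k) {U : Set 𝓔} (hU : DyadicSaturated k U) :
    DyadicSaturated j U := fun x hx => (dyadicCube_subset hjk x).trans (hU x hx)

lemma DyadicSaturated.iUnion {ι : Sort*} {k : ℤ} {U : ι → Set 𝓔}
    (hU : ∀ i, DyadicSaturated k (U i)) : DyadicSaturated k (⋃ i, U i) := by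
  intro x hx
  obtain ⟨i, hi⟩ := Set.mem_iUnion.1 hx
  exact (hU i x hi).trans (Set.subset_iUnion U i)

lemma dyadicSaturated_dyadicCube (k : ℤ) (x : 𝓔) : DyadicSaturated k (dyadicCube k x) :=
  fun _ hy => (dyadicCube_eq_of_mem hy).subset

/-- The points of `V m` that lie in no `V j` with `j > m`. For dyadically saturated sets these are
the points whose maximal cube in the family has level `m`. -/
def lastLayer (V : ℤ → Set 𝓔) (m : ℤ) : Set 𝓔 := V m \ ⋃ j > m, V j

lemma dyadicSaturated_lastLayer {V : ℤ → Set 𝓔} (hV : ∀ m, DyadicSaturated m (V m)) (m : ℤ) :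
    DyadicSaturated m (lastLayer V m) := by
  refine (hV m).inter (DyadicSaturated.compl ?_)
  exact .iUnion fun j => .iUnion fun hj => (hV j).mono (le_of_lt hj)

lemma pairwise_disjoint_lastLayer (V : ℤ → Set 𝓔) :
    Pairwise (Function.onFun Disjoint (lastLayer V)) := by
  have key : ∀ i j, i < j → Disjoint (lastLayer V i) (lastLayer V j) := fun i j hij =>
    Set.disjoint_left.2 fun x hx hx' => hx.2 (Set.mem_biUnion (show j > i from hij) hx'.1)
  intro i j hij
  rcases lt_or_gt_of_ne hij with h | h
  · exact key i j h
  · exact (key j i h).symm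

lemma iUnion_lastLayer {V : ℤ → Set 𝓔} (hb : ∀ x, BddAbove {m | x ∈ V m}) :
    ⋃ m, lastLayer V m = ⋃ m, V m := by
  refine Set.Subset.antisymm (Set.iUnion_mono fun m => Set.sdiff_subset) fun x hx => ?_
  obtain ⟨m, hm⟩ := Set.mem_iUnion.1 hx
  obtain ⟨b, hb⟩ := hb x
  obtain ⟨M, hM, hmax⟩ := Int.exists_greatest_of_bdd (P := fun m => x ∈ V m) ⟨b, fun z hz => hb hz⟩
    ⟨m, hm⟩
  refine Set.mem_iUnion.2 ⟨M, hM, fun h => ?_⟩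
  simp only [Set.mem_iUnion] at h
  obtain ⟨j, hj, hxj⟩ := h
  exact absurd (hmax j hxj) (not_le.2 hj)

lemma pairwise_disjoint_gridIndex (k : ℤ) :
    Pairwise (Function.onFun Disjoint fun c : Fin d → ℤ => gridIndex (d := d) k ⁻¹' {c}) :=
  fun _ _ hab => Set.disjoint_left.2 fun _ (hx : _ = _) (hx' : _ = _) => hab (hx.symm.trans hx')

lemma iUnion_gridIndex (k : ℤ) : ⋃ c : Fin d → ℤ, gridIndex (d := d) k ⁻¹' {c} = Set.univ := by
  ext x; simp

lemma gridIndex_fiber_eq {k : ℤ} {c : Fin d → ℤ} {x : 𝓔} (hx : x ∈ gridIndex k ⁻¹' {c}) :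
    gridIndex k ⁻¹' {c} = dyadicCube k x := by
  rw [dyadicCube_eq_preimage, show gridIndex k x = c from hx]

lemma lintegral_eq_tsum_cubes (μ : Measure 𝓔) (k : ℤ) (h : 𝓔 → ℝ≥0∞) :
    ∫⁻ x, h x ∂μ = ∑' c : Fin d → ℤ, ∫⁻ x in gridIndex k ⁻¹' {c}, h x ∂μ := by
  rw [← lintegral_iUnion (fun c => measurable_gridIndex k (measurableSet_singleton c))
    (pairwise_disjoint_gridIndex k), iUnion_gridIndex, Measure.restrict_univ]

/-- An inequality between integrals over each dyadic cube of a fixed level holds for the integrals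
over the whole space. -/
lemma lintegral_le_of_forall_cube (k : ℤ) {μ ν : Measure 𝓔} {g h : 𝓔 → ℝ≥0∞}
    (H : ∀ x, ∫⁻ y in dyadicCube k x, g y ∂μ ≤ ∫⁻ y in dyadicCube k x, h y ∂ν) :
    ∫⁻ y, g y ∂μ ≤ ∫⁻ y, h y ∂ν := by
  rw [lintegral_eq_tsum_cubes μ k, lintegral_eq_tsum_cubes ν k]
  refine ENNReal.tsum_le_tsum fun c => ?_
  rcases Set.eq_empty_or_nonempty (gridIndex (d := d) k ⁻¹' {c}) with h0 | ⟨x, hx⟩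
  · simp [h0]
  · rw [gridIndex_fiber_eq hx]; exact H x

/-- A density estimate on each dyadic cube inside a saturated set gives it on the set. The set `S`
need not be measurable. -/
lemma measure_inter_le_of_forall_cube {k : ℤ} {U : Set 𝓔} (hU : DyadicSaturated k U) {S : Set 𝓔}
    {a : ℝ≥0∞} (H : ∀ x ∈ U, volume (S ∩ dyadicCube k x) ≤ a * volume (dyadicCube k x)) :
    volume (S ∩ U) ≤ a * volume U := by
  have h1 : volume U = ∑' c : Fin d → ℤ, volume (U ∩ gridIndex k ⁻¹' {c}) := by
    rw [← measure_iUnion, ← Set.inter_iUnion, iUnion_gridIndex, Set.inter_univ]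
    · exact fun a b hab => (pairwise_disjoint_gridIndex k hab).mono Set.inter_subset_right
        Set.inter_subset_right
    · exact fun c => hU.measurableSet.inter (measurable_gridIndex k (measurableSet_singleton c))
  rw [h1, ← ENNReal.tsum_mul_left]
  calc volume (S ∩ U) ≤ volume (⋃ c : Fin d → ℤ, S ∩ U ∩ gridIndex k ⁻¹' {c}) := by
        rw [← Set.inter_iUnion, iUnion_gridIndex, Set.inter_univ]
    _ ≤ ∑' c : Fin d → ℤ, volume (S ∩ U ∩ gridIndex k ⁻¹' {c}) := measure_iUnion_le _
    _ ≤ _ := by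
        refine ENNReal.tsum_le_tsum fun c => ?_
        rcases Set.eq_empty_or_nonempty (U ∩ gridIndex (d := d) k ⁻¹' {c}) with h0 | ⟨x, hxU, hx⟩
        · rw [Set.inter_assoc, h0]; simp
        · rw [gridIndex_fiber_eq hx, Set.inter_assoc,
            Set.inter_eq_right.2 (hU x hxU)]
          exact H x hxU

/-! ### Sequence norms, layer cakes and averages over balls -/

/-- Jensen's inequality for the power `q ≥ 1`, for a measure that need not be normalized. -/
lemma lintegral_rpow_le {α : Type*} [MeasurableSpace α] (μ : Measure α) {q : ℝ} (hq : 1 ≤ q)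
    {f : α → ℝ≥0∞} (hf : AEMeasurable f μ) :
    (∫⁻ x, f x ∂μ) ^ q ≤ μ Set.univ ^ (q - 1) * ∫⁻ x, f x ^ q ∂μ := by
  rcases hq.eq_or_lt with rfl | hq1
  · simp
  have hc := Real.HolderConjugate.conjExponent hq1
  have h := ENNReal.lintegral_mul_le_Lp_mul_Lq μ hc hf (aemeasurable_const (b := (1 : ℝ≥0∞)))
  simp only [Pi.mul_apply, mul_one, ENNReal.one_rpow, lintegral_const, one_mul] at h
  calc (∫⁻ x, f x ∂μ) ^ q
      ≤ ((∫⁻ x, f x ^ q ∂μ) ^ (1 / q) * μ Set.univ ^ (1 / q.conjExponent)) ^ q := by gcongr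
    _ = _ := by
      rw [ENNReal.mul_rpow_of_nonneg _ _ (by linarith), ← ENNReal.rpow_mul, ← ENNReal.rpow_mul,
        one_div_mul_cancel (by linarith), ENNReal.rpow_one, mul_comm]
      congr 2
      rw [Real.conjExponent]
      field_simp

/-- The `ℓ^q` norm of a sequence with values in `[0, ∞]`. -/
def seqNorm {ι : Type*} (q : ℝ) (a : ι → ℝ≥0∞) : ℝ≥0∞ := (∑' k, a k ^ q) ^ (1 / q)

lemma seqNorm_mono {ι : Type*} {q : ℝ} (hq : 0 < q) {a b : ι → ℝ≥0∞} (h : ∀ k, a k ≤ b k) :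
    seqNorm q a ≤ seqNorm q b := by
  unfold seqNorm
  gcongr with k
  exact h k

lemma seqNorm_add_le {q : ℝ} (hq : 1 ≤ q) (a b : ℤ → ℝ≥0∞) :
    seqNorm q (fun k => a k + b k) ≤ seqNorm q a + seqNorm q b := by
  have := ENNReal.lintegral_Lp_add_le (μ := Measure.count) (p := q)
    (measurable_of_countable a).aemeasurable (measurable_of_countable b).aemeasurable hq
  simpa only [lintegral_count, Pi.add_apply, seqNorm] using this

lemma seqNorm_rpow {ι : Type*} {q : ℝ} (hq : 0 < q) (a : ι → ℝ≥0∞) :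
    seqNorm q a ^ q = ∑' k, a k ^ q := by
  rw [seqNorm, ← ENNReal.rpow_mul, one_div_mul_cancel hq.ne', ENNReal.rpow_one]

lemma seqNorm_le_tsum {ι : Type*} {q : ℝ} (hq : 1 ≤ q) (a : ι → ℝ≥0∞) :
    seqNorm q a ≤ ∑' k, a k := by
  have hq0 : 0 < q := by linarith
  rw [← ENNReal.rpow_le_rpow_iff hq0, seqNorm_rpow hq0]
  have h1 : ∀ t : ℝ≥0∞, t ^ q = t ^ (q - 1) * t := fun t => by
    conv_lhs => rw [show q = (q - 1) + 1 by ring]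
    rw [ENNReal.rpow_add_of_nonneg _ _ (by linarith) zero_le_one, ENNReal.rpow_one]
  calc ∑' k, a k ^ q ≤ ∑' k, (∑' k, a k) ^ (q - 1) * a k := by
        refine ENNReal.tsum_le_tsum fun k => ?_
        rw [h1]
        gcongr
        exact ENNReal.le_tsum k
    _ = _ := by rw [ENNReal.tsum_mul_left, ← h1]

lemma tsum_indicator_Iic (N : ℤ) (g : ℤ → ℝ≥0∞) :
    ∑' n, (Set.Iic N).indicator g n = ∑' i : ℕ, g (N - i) := by
  have hinj : Function.Injective fun i : ℕ => N - (i : ℤ) := fun i j h => by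
    simp only [sub_right_inj] at h; exact_mod_cast h
  rw [← hinj.tsum_eq]
  · refine tsum_congr fun i => Set.indicator_of_mem (by simp) _
  · intro n hn
    have : n ≤ N := by
      by_contra h
      exact hn (Set.indicator_of_notMem (by simpa using h) _)
    exact ⟨(N - n).toNat, by simp only; omega⟩

lemma tsum_indicator_Ioi (N : ℤ) (g : ℤ → ℝ≥0∞) :
    ∑' n, (Set.Ioi N).indicator g n = ∑' i : ℕ, g (N + 1 + i) := by
  have hinj : Function.Injective fun i : ℕ => N + 1 + (i : ℤ) := fun i j h => by
    simp only [add_right_inj] at h; exact_mod_cast h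
  rw [← hinj.tsum_eq]
  · refine tsum_congr fun i => Set.indicator_of_mem (by simp only [Set.mem_Ioi]; omega) _
  · intro n hn
    have : N < n := by
      by_contra h
      exact hn (Set.indicator_of_notMem (by simpa using h) _)
    exact ⟨(n - (N + 1)).toNat, by simp only; omega⟩

lemma tsum_int_le (g : ℤ → ℝ≥0∞) :
    ∑' n, g n ≤ ∑' i : ℕ, g (-i) + ∑' i : ℕ, g (1 + i) := by
  have h0 := tsum_indicator_Iic 0 g
  have h1 := tsum_indicator_Ioi 0 g
  simp only [zero_sub, zero_add] at h0 h1
  rw [← h0, ← h1, ← ENNReal.tsum_add]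
  refine ENNReal.tsum_le_tsum fun n => ?_
  rcases le_or_gt n 0 with h | h
  · rw [Set.indicator_of_mem (show n ∈ Set.Iic (0 : ℤ) from h)]; exact le_self_add
  · rw [Set.indicator_of_mem (show n ∈ Set.Ioi (0 : ℤ) from h)]; exact le_add_self

lemma tsum_rpow_geometric_ne_top {x : ℝ} (hx0 : 0 ≤ x) (hx1 : x < 1) :
    ∑' i : ℕ, ENNReal.ofReal (x ^ i) ≠ ∞ := by
  rw [← ENNReal.ofReal_tsum_of_nonneg (fun i => pow_nonneg hx0 i)
    (summable_geometric_of_lt_one hx0 hx1)]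
  exact ENNReal.ofReal_ne_top

/-- The geometric series of ratio `3 ^ a` is dominated by its last term. -/
lemma exists_tsum_three_zpow_lt_le {a : ℝ} (ha : 0 < a) :
    ∃ C : ℝ≥0∞, C ≠ ∞ ∧ ∀ t : ℝ≥0∞,
      ∑' n : ℤ, {n : ℤ | (3 : ℝ≥0∞) ^ n < t}.indicator (fun n => ((3 : ℝ≥0∞) ^ n) ^ a) n
        ≤ C * t ^ a := by
  have h3 : (3 : ℝ≥0∞) ≠ 0 := by norm_num
  have h3' : (3 : ℝ≥0∞) ≠ ∞ := by norm_num
  have hx1 : ((3 : ℝ) ^ (-a)) < 1 := Real.rpow_lt_one_of_one_lt_of_neg (by norm_num) (by linarith)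
  have hx0 : 0 ≤ ((3 : ℝ) ^ (-a)) := by positivity
  refine ⟨1 + ∑' i : ℕ, ENNReal.ofReal (((3 : ℝ) ^ (-a)) ^ i),
    ENNReal.add_ne_top.2 ⟨ENNReal.one_ne_top, tsum_rpow_geometric_ne_top hx0 hx1⟩, fun t => ?_⟩
  rcases eq_or_ne t 0 with rfl | ht0
  · simp
  rcases eq_or_ne t ∞ with rfl | ht
  · rw [ENNReal.top_rpow_of_pos ha, ENNReal.mul_top (by simp)]
    exact le_top
  obtain ⟨N, hN1, hN2⟩ := ENNReal.exists_mem_Ioc_zpow ht0 ht (by norm_num : (1 : ℝ≥0∞) < 3) h3'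
  calc ∑' n : ℤ, {n : ℤ | (3 : ℝ≥0∞) ^ n < t}.indicator (fun n => ((3 : ℝ≥0∞) ^ n) ^ a) n
      ≤ ∑' n : ℤ, (Set.Iic N).indicator (fun n => ((3 : ℝ≥0∞) ^ n) ^ a) n := by
        refine ENNReal.tsum_le_tsum fun n => ?_
        refine Set.indicator_le_indicator_of_subset ?_ (fun _ => zero_le) n
        intro n (hn : (3 : ℝ≥0∞) ^ n < t)
        by_contra h
        have : N + 1 ≤ n := by simpa using h
        exact absurd (hn.trans_le hN2)
          (not_lt.2 (ENNReal.zpow_le_of_le (by norm_num) this))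
    _ = ∑' i : ℕ, ((3 : ℝ≥0∞) ^ N) ^ a * ENNReal.ofReal (((3 : ℝ) ^ (-a)) ^ i) := by
        rw [tsum_indicator_Iic]
        refine tsum_congr fun i => ?_
        rw [ENNReal.zpow_sub h3 h3', zpow_natCast, ENNReal.mul_rpow_of_nonneg _ _ ha.le]
        congr 1
        rw [ENNReal.ofReal_pow hx0, ← ENNReal.ofReal_rpow_of_pos (by norm_num), ENNReal.rpow_neg,
          ENNReal.inv_rpow, ← ENNReal.rpow_natCast_mul, mul_comm, ENNReal.rpow_mul_natCast,
          ENNReal.inv_pow]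
        norm_num
    _ ≤ (1 + ∑' i : ℕ, ENNReal.ofReal (((3 : ℝ) ^ (-a)) ^ i)) * t ^ a := by
        rw [ENNReal.tsum_mul_left, mul_comm]
        gcongr
        exact le_add_self

/-- The layer-cake formula, discretized at the powers of three. -/
lemma lintegral_rpow_le_tsum_measure {α : Type*} [MeasurableSpace α] (μ : Measure α) {p : ℝ}
    (hp : 0 < p) {F : α → ℝ≥0∞} (hF : Measurable F) :
    ∫⁻ x, F x ^ p ∂μ ≤ ∑' n : ℤ, ((3 : ℝ≥0∞) ^ (n + 1)) ^ p * μ {x | (3 : ℝ≥0∞) ^ n < F x} := by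
  have h3' : (3 : ℝ≥0∞) ≠ ∞ := by norm_num
  have hpt : ∀ t : ℝ≥0∞, t ^ p ≤ ∑' n : ℤ,
      (if (3 : ℝ≥0∞) ^ n < t then ((3 : ℝ≥0∞) ^ (n + 1)) ^ p else 0) := by
    intro t
    rcases eq_or_ne t 0 with rfl | ht0
    · simp [hp]
    rcases eq_or_ne t ∞ with rfl | ht
    · refine le_of_eq ?_
      rw [ENNReal.top_rpow_of_pos hp, eq_comm, eq_top_iff]
      have h1 : ∀ n : ℤ, (3 : ℝ≥0∞) ^ n < ∞ := fun n =>
        ENNReal.zpow_lt_top (by norm_num) h3' n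
      simp only [h1, if_true]
      calc (∞ : ℝ≥0∞) = ∑' _i : ℕ, (1 : ℝ≥0∞) := by simp
        _ ≤ ∑' i : ℕ, ((3 : ℝ≥0∞) ^ ((i : ℤ) + 1)) ^ p := by
            refine ENNReal.tsum_le_tsum fun i => ENNReal.one_le_rpow ?_ hp
            have : (3 : ℝ≥0∞) ^ (0 : ℤ) ≤ (3 : ℝ≥0∞) ^ ((i : ℤ) + 1) :=
              ENNReal.zpow_le_of_le (by norm_num) (by omega)
            simpa using this
        _ ≤ _ := ENNReal.tsum_comp_le_tsum_of_injective
            (f := fun i : ℕ => (i : ℤ)) Nat.cast_injective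
            (fun n : ℤ => ((3 : ℝ≥0∞) ^ (n + 1)) ^ p)
    obtain ⟨N, hN1, hN2⟩ := ENNReal.exists_mem_Ioc_zpow ht0 ht (by norm_num : (1 : ℝ≥0∞) < 3) h3'
    calc t ^ p ≤ ((3 : ℝ≥0∞) ^ (N + 1)) ^ p := by gcongr
      _ = (if (3 : ℝ≥0∞) ^ N < t then ((3 : ℝ≥0∞) ^ (N + 1)) ^ p else 0) := by rw [if_pos hN1]
      _ ≤ _ := ENNReal.le_tsum (f := fun n : ℤ =>
          (if (3 : ℝ≥0∞) ^ n < t then ((3 : ℝ≥0∞) ^ (n + 1)) ^ p else 0)) N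
  have hm : ∀ n : ℤ, MeasurableSet {x | (3 : ℝ≥0∞) ^ n < F x} := fun n =>
    measurableSet_lt measurable_const hF
  calc ∫⁻ x, F x ^ p ∂μ ≤ ∫⁻ x, ∑' n : ℤ,
      {x | (3 : ℝ≥0∞) ^ n < F x}.indicator (fun _ => ((3 : ℝ≥0∞) ^ (n + 1)) ^ p) x ∂μ := by
        refine lintegral_mono fun x => (hpt (F x)).trans (le_of_eq ?_)
        exact tsum_congr fun n => by simp [Set.indicator_apply]
    _ = _ := by
        rw [lintegral_tsum fun n => (measurable_const.indicator (hm n)).aemeasurable]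
        exact tsum_congr fun n => lintegral_indicator_const (hm n) _

/-- The converse of `lintegral_rpow_le_tsum_measure`, with a weight: the level sets of `F` cut at
the powers of three. -/
lemma exists_tsum_lintegral_le {α : Type*} [MeasurableSpace α] (μ : Measure α) {a : ℝ}
    (ha : 0 < a) : ∃ C : ℝ≥0∞, C ≠ ∞ ∧ ∀ F G : α → ℝ≥0∞, Measurable F → Measurable G →
      ∑' n : ℤ, ((3 : ℝ≥0∞) ^ n) ^ a * ∫⁻ x in {x | (3 : ℝ≥0∞) ^ n < F x}, G x ∂μ
        ≤ C * ∫⁻ x, F x ^ a * G x ∂μ := by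
  obtain ⟨C, hC, h⟩ := exists_tsum_three_zpow_lt_le ha
  refine ⟨C, hC, fun F G hF hG => ?_⟩
  have hm : ∀ n : ℤ, MeasurableSet {x | (3 : ℝ≥0∞) ^ n < F x} := fun n =>
    measurableSet_lt measurable_const hF
  calc ∑' n : ℤ, ((3 : ℝ≥0∞) ^ n) ^ a * ∫⁻ x in {x | (3 : ℝ≥0∞) ^ n < F x}, G x ∂μ
      = ∑' n : ℤ, ∫⁻ x, {x | (3 : ℝ≥0∞) ^ n < F x}.indicator
          (fun x => ((3 : ℝ≥0∞) ^ n) ^ a * G x) x ∂μ := by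
        refine tsum_congr fun n => ?_
        rw [lintegral_indicator (hm n), lintegral_const_mul _ hG]
    _ = ∫⁻ x, ∑' n : ℤ, {x | (3 : ℝ≥0∞) ^ n < F x}.indicator
          (fun x => ((3 : ℝ≥0∞) ^ n) ^ a * G x) x ∂μ :=
        (lintegral_tsum fun n => ((hG.const_mul _).indicator (hm n)).aemeasurable).symm
    _ ≤ ∫⁻ x, C * (F x ^ a * G x) ∂μ := by
        refine lintegral_mono fun x => ?_
        have h1 : ∀ n : ℤ, {x | (3 : ℝ≥0∞) ^ n < F x}.indicator
            (fun x => ((3 : ℝ≥0∞) ^ n) ^ a * G x) x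
            = {n : ℤ | (3 : ℝ≥0∞) ^ n < F x}.indicator (fun n => ((3 : ℝ≥0∞) ^ n) ^ a) n * G x :=
          fun n => by simp [Set.indicator_apply]
        simp only [h1]
        rw [ENNReal.tsum_mul_right, ← mul_assoc]
        gcongr
        exact h (F x)
    _ = _ := lintegral_const_mul _ ((hF.pow_const a).mul hG)

lemma setLIntegral_ball_eq_translate (x : 𝓔) (R : ℝ) (h : 𝓔 → ℝ≥0∞) :
    ∫⁻ z in Metric.ball x R, h z = ∫⁻ y in Metric.ball 0 R, h (x + y) := by
  rw [← (measurePreserving_add_left volume x).setLIntegral_comp_preimage_emb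
    (MeasurableEquiv.addLeft x).measurableEmbedding]
  simp [preimage_add_ball]

lemma setIntegral_ball_eq_translate {B : Type*} [NormedAddCommGroup B] [NormedSpace ℝ B]
    (x : 𝓔) (R : ℝ) (h : 𝓔 → B) :
    ∫ z in Metric.ball x R, h z = ∫ y in Metric.ball 0 R, h (x + y) := by
  rw [← (measurePreserving_add_left volume x).setIntegral_preimage_emb
    (MeasurableEquiv.addLeft x).measurableEmbedding]
  simp [preimage_add_ball]

/-- Averaging a function over all translates of a fixed set `S`. -/
lemma lintegral_lintegral_translate {S : Set 𝓔} {h : 𝓔 → ℝ≥0∞} (hh : Measurable h) :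
    ∫⁻ x, ∫⁻ y in S, h (x + y) = volume S * ∫⁻ z, h z := by
  rw [lintegral_lintegral_swap (f := fun x y => h (x + y))
    (hh.comp (measurable_fst.add measurable_snd)).aemeasurable]
  simp only [lintegral_add_right_eq_self]
  rw [setLIntegral_const, mul_comm]

lemma volume_ball_zero_pos {R : ℝ} (hR : 0 < R) : volume (Metric.ball (0 : 𝓔) R) ≠ 0 :=
  (Metric.measure_ball_pos volume _ hR).ne'

lemma volume_ball_zero_ne_top (R : ℝ) : volume (Metric.ball (0 : 𝓔) R) ≠ ∞ :=
  measure_ball_lt_top.ne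

lemma volume_ball_mul {R c : ℝ} (hc : 0 < c) :
    volume (Metric.ball (0 : 𝓔) (c * R))
      = ENNReal.ofReal (c ^ d) * volume (Metric.ball (0 : 𝓔) R) := by
  have := Measure.addHaar_ball_mul_of_pos (volume : Measure 𝓔) 0 hc R
  simpa using this

/-- The shell of width `h` inside the sphere of radius `R`. -/
def shell (d : ℕ) (R h : ℝ) : Set (EuclideanSpace ℝ (Fin d)) :=
  Metric.ball 0 R \ Metric.ball 0 (R - h)

lemma volume_shell_le (hd : 1 ≤ d) {R h : ℝ} (hR : 0 < R) (hh : 0 ≤ h) :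
    volume (shell d R h) ≤ ENNReal.ofReal (d * (h / R)) * volume (Metric.ball (0 : 𝓔) R) := by
  have hd1 : (1 : ℝ) ≤ d := by exact_mod_cast hd
  rcases lt_or_ge h R with hlt | hge
  · have h1 : 0 < (R - h) / R := div_pos (by linarith) hR
    have e : R - h = ((R - h) / R) * R := by field_simp
    rw [shell, measure_sdiff (Metric.ball_subset_ball (by linarith))
      measurableSet_ball.nullMeasurableSet (volume_ball_zero_ne_top _)]
    have hv : volume (Metric.ball (0 : 𝓔) (R - h))
        = ENNReal.ofReal (((R - h) / R) ^ d) * volume (Metric.ball (0 : 𝓔) R) := by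
      conv_lhs => rw [e]
      exact volume_ball_mul h1
    rw [hv, tsub_le_iff_left, ← add_mul, ← ENNReal.ofReal_add (by positivity) (by positivity)]
    refine le_mul_of_one_le_left (zero_le) ?_
    rw [ENNReal.one_le_ofReal]
    -- Bernoulli's inequality for `(1 - h / R) ^ d`.
    have hb := one_add_mul_le_pow (a := -(h / R)) (by
      have : h / R ≤ 1 := (div_le_one hR).2 hlt.le
      linarith) d
    have e2 : (R - h) / R = 1 + -(h / R) := by field_simp; ring
    rw [e2]
    linarith
  · refine (measure_mono Set.sdiff_subset).trans (le_mul_of_one_le_left (zero_le) ?_)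
    rw [ENNReal.one_le_ofReal]
    have : 1 ≤ h / R := (one_le_div hR).2 hge
    nlinarith

section average

variable {B : Type*} [NormedAddCommGroup B] [NormedSpace ℝ B]

lemma ballAverage_eq (t : ℝ) (f : 𝓔 → B) (x : 𝓔) :
    ballAverage t f x
      = (volume (Metric.ball (0 : 𝓔) t)).toReal⁻¹ • ∫ z in Metric.ball x t, f z := by
  rw [ballAverage, setAverage_eq, setIntegral_ball_eq_translate x]
  rfl

lemma enorm_toReal_inv_smul {v : ℝ≥0∞} (h0 : v ≠ 0) (h : v ≠ ∞) (b : B) :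
    ‖v.toReal⁻¹ • b‖ₑ = v⁻¹ * ‖b‖ₑ := by
  rw [enorm_smul, Real.enorm_eq_ofReal (by positivity), ENNReal.ofReal_inv_of_pos
    (ENNReal.toReal_pos h0 h), ENNReal.ofReal_toReal h]

lemma enorm_ballAverage {t : ℝ} (ht : 0 < t) (f : 𝓔 → B) (x : 𝓔) :
    ‖ballAverage t f x‖ₑ
      = (volume (Metric.ball (0 : 𝓔) t))⁻¹ * ‖∫ z in Metric.ball x t, f z‖ₑ := by
  rw [ballAverage_eq, enorm_toReal_inv_smul (volume_ball_zero_pos ht) (volume_ball_zero_ne_top t)]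

lemma enorm_ballAverage_le {t : ℝ} (ht : 0 < t) (f : 𝓔 → B) (x : 𝓔) :
    ‖ballAverage t f x‖ₑ
      ≤ (volume (Metric.ball (0 : 𝓔) t))⁻¹ * ∫⁻ z in Metric.ball x t, ‖f z‖ₑ := by
  rw [enorm_ballAverage ht]
  gcongr
  exact enorm_integral_le_lintegral_enorm _

lemma stronglyMeasurable_ballAverage (t : ℝ) {f : 𝓔 → B} (hf : StronglyMeasurable f) :
    StronglyMeasurable (ballAverage t f) := by
  have : ballAverage t f = fun x => (volume (Metric.ball (0 : 𝓔) t)).toReal⁻¹ •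
      ∫ y in Metric.ball (0 : 𝓔) t, f (x + y) := by
    funext x; rw [ballAverage_eq, setIntegral_ball_eq_translate]
  rw [this]
  refine StronglyMeasurable.const_smul ?_ _
  exact (hf.comp_measurable (measurable_fst.add measurable_snd)).integral_prod_right'

end average

/-! ### Dyadic means and martingale differences -/

variable {B : Type*} [NormedAddCommGroup B] [NormedSpace ℝ B]

lemma dyadicCondExp_eq (k : ℤ) (f : 𝓔 → B) (x : 𝓔) :
    dyadicCondExp k f x
      = (volume (dyadicCube k x)).toReal⁻¹ • ∫ y in dyadicCube k x, f y := by
  rw [dyadicCondExp, setAverage_eq]; rfl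

lemma enorm_dyadicCondExp_le (k : ℤ) (f : 𝓔 → B) (x : 𝓔) :
    ‖dyadicCondExp k f x‖ₑ
      ≤ (volume (dyadicCube k x))⁻¹ * ∫⁻ y in dyadicCube k x, ‖f y‖ₑ := by
  rw [dyadicCondExp_eq, enorm_toReal_inv_smul (volume_dyadicCube_pos k x)
    (volume_dyadicCube_ne_top k x)]
  gcongr
  exact enorm_integral_le_lintegral_enorm _

lemma dyadicCondExp_eq_of_mem {k : ℤ} (f : 𝓔 → B) {x y : 𝓔} (h : y ∈ dyadicCube k x) :
    dyadicCondExp k f y = dyadicCondExp k f x := by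
  rw [dyadicCondExp, dyadicCondExp, dyadicCube_eq_of_mem h]

lemma stronglyMeasurable_comap_dyadicCondExp (k : ℤ) (f : 𝓔 → B) :
    StronglyMeasurable[MeasurableSpace.comap (gridIndex (d := d) k) inferInstance]
      (dyadicCondExp k f) := by
  have h : dyadicCondExp k f
      = (fun c : Fin d → ℤ => ⨍ y in gridIndex k ⁻¹' {c}, f y) ∘ gridIndex k := by
    funext x
    rw [dyadicCondExp, dyadicCube_eq_preimage]
    rfl
  rw [h]
  exact StronglyMeasurable.of_discrete.comp_measurable (comap_measurable _)

lemma stronglyMeasurable_dyadicCondExp (k : ℤ) (f : 𝓔 → B) :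
    StronglyMeasurable (dyadicCondExp (d := d) k f) :=
  (stronglyMeasurable_comap_dyadicCondExp k f).mono (measurable_gridIndex k).comap_le

lemma setIntegral_dyadicCube_condExp [CompleteSpace B] (k : ℤ) (f : 𝓔 → B) (x : 𝓔) :
    ∫ y in dyadicCube k x, dyadicCondExp k f y = ∫ y in dyadicCube k x, f y := by
  rw [setIntegral_congr_fun (measurableSet_dyadicCube k x)
    (fun y hy => dyadicCondExp_eq_of_mem f hy), setIntegral_const, dyadicCondExp_eq, smul_smul,
    measureReal_def, mul_inv_cancel₀, one_smul]
  exact (ENNReal.toReal_pos (volume_dyadicCube_pos k x) (volume_dyadicCube_ne_top k x)).ne'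

lemma setLIntegral_dyadicCube_condExp_rpow_le {s : ℝ} (hs : 1 ≤ s) (k : ℤ) {f : 𝓔 → B}
    (hf : StronglyMeasurable f) (x : 𝓔) :
    ∫⁻ y in dyadicCube k x, ‖dyadicCondExp k f y‖ₑ ^ s ≤ ∫⁻ y in dyadicCube k x, ‖f y‖ₑ ^ s := by
  have h0 := volume_dyadicCube_pos k x
  have h1 := volume_dyadicCube_ne_top k x
  set v := volume (dyadicCube k x) with hv
  calc ∫⁻ y in dyadicCube k x, ‖dyadicCondExp k f y‖ₑ ^ s
      = ∫⁻ _y in dyadicCube k x, ‖dyadicCondExp k f x‖ₑ ^ s :=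
        setLIntegral_congr_fun (measurableSet_dyadicCube k x)
          (fun y hy => by simp only [dyadicCondExp_eq_of_mem f hy])
    _ = ‖dyadicCondExp k f x‖ₑ ^ s * v := setLIntegral_const _ _
    _ ≤ (v⁻¹ * ∫⁻ y in dyadicCube k x, ‖f y‖ₑ) ^ s * v := by
        gcongr; exact enorm_dyadicCondExp_le k f x
    _ ≤ (v⁻¹ ^ s * (v ^ (s - 1) * ∫⁻ y in dyadicCube k x, ‖f y‖ₑ ^ s)) * v := by
        rw [ENNReal.mul_rpow_of_nonneg _ _ (by linarith)]
        gcongr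
        have := lintegral_rpow_le (volume.restrict (dyadicCube k x)) hs
          (f := fun y => ‖f y‖ₑ) hf.enorm.aemeasurable
        rwa [Measure.restrict_apply_univ] at this
    _ = ∫⁻ y in dyadicCube k x, ‖f y‖ₑ ^ s := by
        have e : v⁻¹ ^ s * v ^ (s - 1) * v = 1 := by
          rw [mul_assoc]
          nth_rewrite 3 [← ENNReal.rpow_one v]
          rw [← ENNReal.rpow_add _ _ h0 h1, sub_add_cancel, ENNReal.inv_rpow,
            ENNReal.inv_mul_cancel]
          · simp [h0, h1]
          · exact ENNReal.rpow_ne_top_of_nonneg (by linarith) h1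
        calc _ = (v⁻¹ ^ s * v ^ (s - 1) * v) * ∫⁻ y in dyadicCube k x, ‖f y‖ₑ ^ s := by ring
          _ = _ := by rw [e, one_mul]

/-- The conditional expectation contracts the `L^s` norm over every union of atoms. -/
lemma setLIntegral_condExp_rpow_le {s : ℝ} (hs : 1 ≤ s) {k : ℤ} {f : 𝓔 → B}
    (hf : StronglyMeasurable f) {U : Set 𝓔} (hU : DyadicSaturated k U) :
    ∫⁻ y in U, ‖dyadicCondExp k f y‖ₑ ^ s ≤ ∫⁻ y in U, ‖f y‖ₑ ^ s := by
  refine lintegral_le_of_forall_cube k fun x => ?_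
  rw [Measure.restrict_restrict (measurableSet_dyadicCube k x)]
  by_cases hx : x ∈ U
  · rw [Set.inter_eq_left.2 (hU x hx)]
    exact setLIntegral_dyadicCube_condExp_rpow_le hs k hf x
  · rw [Set.disjoint_iff_inter_eq_empty.1 (Set.disjoint_left.2 (hU.compl x hx))]
    simp

lemma setLIntegral_condExp_le {k : ℤ} {f : 𝓔 → B}
    (hf : StronglyMeasurable f) {U : Set 𝓔} (hU : DyadicSaturated k U) :
    ∫⁻ y in U, ‖dyadicCondExp k f y‖ₑ ≤ ∫⁻ y in U, ‖f y‖ₑ := by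
  simpa using setLIntegral_condExp_rpow_le le_rfl hf hU

lemma integrableOn_condExp {k : ℤ} {f : 𝓔 → B}
    (hf : StronglyMeasurable f) {U : Set 𝓔} (hU : DyadicSaturated k U) (hfU : IntegrableOn f U) :
    IntegrableOn (dyadicCondExp k f) U :=
  ⟨(stronglyMeasurable_dyadicCondExp k f).aestronglyMeasurable,
    (setLIntegral_condExp_le hf hU).trans_lt hfU.2⟩

/-- A function with mean zero over each cube of a level has mean zero over each union of such
cubes. -/
lemma setIntegral_eq_zero_of_forall_cube {k : ℤ} {g : 𝓔 → B} {U : Set 𝓔}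
    (hU : DyadicSaturated k U) (hg : IntegrableOn g U)
    (h : ∀ x ∈ U, ∫ y in dyadicCube k x, g y = 0) : ∫ y in U, g y = 0 := by
  have hUeq : U = ⋃ c : Fin d → ℤ, U ∩ gridIndex k ⁻¹' {c} := by
    rw [← Set.inter_iUnion, iUnion_gridIndex, Set.inter_univ]
  rw [hUeq] at hg ⊢
  rw [integral_iUnion (fun c => hU.measurableSet.inter
    (measurable_gridIndex k (measurableSet_singleton c)))
    (fun a b hab => (pairwise_disjoint_gridIndex k hab).mono Set.inter_subset_right
        Set.inter_subset_right) hg]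
  refine (tsum_congr fun c => ?_).trans tsum_zero
  rcases Set.eq_empty_or_nonempty (U ∩ gridIndex (d := d) k ⁻¹' {c}) with h0 | ⟨x, hxU, hx⟩
  · simp [h0]
  · rw [gridIndex_fiber_eq hx, Set.inter_eq_right.2 (hU x hxU)]
    exact h x hxU

lemma setIntegral_sub_condExp [CompleteSpace B] {k : ℤ} {f : 𝓔 → B} (hf : StronglyMeasurable f)
    {U : Set 𝓔} (hU : DyadicSaturated k U) (hfU : IntegrableOn f U) :
    ∫ y in U, (f y - dyadicCondExp k f y) = 0 := by
  refine setIntegral_eq_zero_of_forall_cube hU (hfU.sub (integrableOn_condExp hf hU hfU))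
    fun x hx => ?_
  have h1 := hfU.mono_set (hU x hx)
  rw [integral_sub h1 (integrableOn_condExp hf (dyadicSaturated_dyadicCube k x) h1),
    setIntegral_dyadicCube_condExp, sub_self]

lemma setIntegral_condExp_eq [CompleteSpace B] {k : ℤ} {f : 𝓔 → B} (hf : StronglyMeasurable f)
    {U : Set 𝓔} (hU : DyadicSaturated k U) (hfU : IntegrableOn f U) :
    ∫ y in U, dyadicCondExp k f y = ∫ y in U, f y := by
  have h := setIntegral_sub_condExp hf hU hfU
  rw [integral_sub hfU (integrableOn_condExp hf hU hfU), sub_eq_zero] at h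
  exact h.symm

/-- The normalized Lebesgue measure of a dyadic cube. -/
def cubeMeasure (N : ℤ) (x : 𝓔) : Measure 𝓔 :=
  (volume (dyadicCube N x))⁻¹ • volume.restrict (dyadicCube N x)

instance isProbabilityMeasure_cubeMeasure (N : ℤ) (x : 𝓔) :
    IsProbabilityMeasure (cubeMeasure N x) := by
  constructor
  simp only [cubeMeasure, Measure.smul_apply, Measure.restrict_apply_univ, smul_eq_mul]
  exact ENNReal.inv_mul_cancel (volume_dyadicCube_pos N x) (volume_dyadicCube_ne_top N x)

lemma lintegral_cubeMeasure (N : ℤ) (x : 𝓔) (h : 𝓔 → ℝ≥0∞) :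
    ∫⁻ y, h y ∂(cubeMeasure N x)
      = (volume (dyadicCube N x))⁻¹ * ∫⁻ y in dyadicCube N x, h y := by
  rw [cubeMeasure, lintegral_smul_measure, smul_eq_mul]

lemma integrableOn_cubeMeasure_iff {G : Type*} [NormedAddCommGroup G] {N : ℤ} {x : 𝓔} {s : Set 𝓔}
    (hs : MeasurableSet s) {g : 𝓔 → G} :
    IntegrableOn g s (cubeMeasure N x) ↔ IntegrableOn g (s ∩ dyadicCube N x) := by
  rw [IntegrableOn, cubeMeasure, Measure.restrict_smul, Measure.restrict_restrict hs,
    integrable_smul_measure]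
  · rfl
  · simpa using volume_dyadicCube_ne_top N x
  · simpa using volume_dyadicCube_pos N x

lemma integrable_cubeMeasure_iff {G : Type*} [NormedAddCommGroup G] {N : ℤ} {x : 𝓔} {g : 𝓔 → G} :
    Integrable g (cubeMeasure N x) ↔ IntegrableOn g (dyadicCube N x) := by
  rw [← integrableOn_univ, integrableOn_cubeMeasure_iff MeasurableSet.univ, Set.univ_inter]

/-- The σ-algebra generated by the dyadic cubes of side length `2 ^ k`. -/
abbrev gridSigma (d : ℕ) (k : ℤ) : MeasurableSpace (EuclideanSpace ℝ (Fin d)) :=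
  MeasurableSpace.comap (gridIndex (d := d) k) inferInstance

/-- Averaging over the cubes of level `k ≤ N` is the conditional expectation on each cube of
level `N`. -/
lemma condExp_cubeMeasure_ae_eq [CompleteSpace B] {k N : ℤ} (hk : k ≤ N) (x : 𝓔) {f : 𝓔 → B}
    (hf : StronglyMeasurable f) (hfi : IntegrableOn f (dyadicCube N x)) :
    dyadicCondExp k f =ᵐ[cubeMeasure N x] (cubeMeasure N x)[f | gridSigma d k] := by
  have hsat : ∀ s, MeasurableSet[gridSigma d k] s → DyadicSaturated k s := by
    rintro s ⟨T, -, rfl⟩ y hy z hz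
    rw [mem_dyadicCube_iff] at hz
    rw [Set.mem_preimage, hz]
    exact hy
  refine ae_eq_condExp_of_forall_setIntegral_eq (measurable_gridIndex k).comap_le
    (integrable_cubeMeasure_iff.2 hfi) (fun s hs _ => ?_) (fun s hs _ => ?_)
    (stronglyMeasurable_comap_dyadicCondExp k f).aestronglyMeasurable
  all_goals
    have hU := (hsat s hs).inter ((dyadicSaturated_dyadicCube N x).mono hk)
    have hfU := hfi.mono_set (Set.inter_subset_right (s := s))
  · exact (integrableOn_cubeMeasure_iff (hsat s hs).measurableSet).2
      (integrableOn_condExp hf hU hfU)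
  · rw [cubeMeasure, Measure.restrict_smul, Measure.restrict_restrict (hsat s hs).measurableSet,
      integral_smul_measure, integral_smul_measure, setIntegral_condExp_eq hf hU hfU]

/-- The reverse dyadic filtration that starts at level `N`. -/
def gridFiltration (d : ℕ) (N : ℤ) :
    Filtration ℕ (inferInstance : MeasurableSpace (EuclideanSpace ℝ (Fin d))) where
  seq n := gridSigma d (N - n)
  mono' := by
    intro m n hmn
    have h := gridIndex_eq_of_le (d := d) (show N - (n : ℤ) ≤ N - m by omega)
    simp only [gridSigma]
    rw [h, ← MeasurableSpace.comap_comp]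
    exact MeasurableSpace.comap_mono (measurable_of_countable _).comap_le
  le' n := (measurable_gridIndex _).comap_le

/-- The martingale difference of the dyadic filtration between the levels `j` and `j - 1`. -/
def martDiff (j : ℤ) (f : 𝓔 → B) (x : 𝓔) : B := dyadicCondExp (j - 1) f x - dyadicCondExp j f x

lemma stronglyMeasurable_martDiff (j : ℤ) (f : 𝓔 → B) :
    StronglyMeasurable (martDiff (d := d) j f) :=
  (stronglyMeasurable_dyadicCondExp _ f).sub (stronglyMeasurable_dyadicCondExp _ f)

/-- Martingale cotype for the dyadic filtration of `ℝ ^ d`. -/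
lemma exists_tsum_martDiff_le [CompleteSpace B] {q : ℝ} (hq : 1 ≤ q)
    (hB : HasMartingaleCotype B q) : ∃ C : ℝ≥0, ∀ f : 𝓔 → B, StronglyMeasurable f →
      ∫⁻ x, ‖f x‖ₑ ^ q < ∞ →
      ∑' j : ℤ, ∫⁻ x, ‖martDiff j f x‖ₑ ^ q ≤ C * ∫⁻ x, ‖f x‖ₑ ^ q := by
  obtain ⟨C, hC⟩ := hB
  refine ⟨C, fun f hf hfq => ?_⟩
  have hq0 : 0 < q := by linarith
  -- On the cubes of level `N`, cotype controls the differences of the levels at most `N`.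
  have key : ∀ (N : ℤ) (x : 𝓔),
      ∑' n : ℕ, ∫⁻ y in dyadicCube N x, ‖martDiff (N - n) f y‖ₑ ^ q
        ≤ C * ∫⁻ y in dyadicCube N x, ‖f y‖ₑ ^ q := by
    intro N x
    have hv0 := volume_dyadicCube_pos N x
    have hv1 := volume_dyadicCube_ne_top N x
    have hmem : MemLp f (ENNReal.ofReal q) (cubeMeasure N x) := by
      refine ⟨hf.aestronglyMeasurable, ?_⟩
      rw [eLpNorm_lt_top_iff_lintegral_rpow_enorm_lt_top (by simpa using hq0)
        ENNReal.ofReal_ne_top, ENNReal.toReal_ofReal hq0.le, lintegral_cubeMeasure]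
      refine ENNReal.mul_lt_top (by simpa using hv0.bot_lt) ?_
      exact (setLIntegral_le_lintegral _ _).trans_lt hfq
    have hfi : IntegrableOn f (dyadicCube N x) := integrable_cubeMeasure_iff.1
      (hmem.integrable (by simpa using hq))
    have h := hC 𝓔 (cubeMeasure N x) (gridFiltration d N) f hmem
    have h2 : ∀ n : ℕ, ∫⁻ ω, ‖((cubeMeasure N x)[f | gridFiltration d N (n + 1)]) ω
        - ((cubeMeasure N x)[f | gridFiltration d N n]) ω‖ₑ ^ q ∂(cubeMeasure N x)
        = (volume (dyadicCube N x))⁻¹ * ∫⁻ y in dyadicCube N x, ‖martDiff (N - n) f y‖ₑ ^ q := by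
      intro n
      rw [← lintegral_cubeMeasure]
      refine lintegral_congr_ae ?_
      filter_upwards [condExp_cubeMeasure_ae_eq (show N - (n : ℤ) ≤ N by omega) x hf hfi,
        condExp_cubeMeasure_ae_eq (show N - ((n + 1 : ℕ) : ℤ) ≤ N by omega) x hf hfi] with ω h1 h2
      have e : N - (n : ℤ) - 1 = N - ((n + 1 : ℕ) : ℤ) := by push_cast; ring
      rw [martDiff, e, h1, h2]
      rfl
    simp only [h2] at h
    replace h := le_add_self.trans h
    rw [ENNReal.tsum_mul_left, lintegral_cubeMeasure, mul_left_comm] at h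
    rwa [ENNReal.mul_le_mul_iff_right (by simpa using hv1) (by simpa using hv0)] at h
  have key2 : ∀ N : ℤ, ∑' n : ℕ, ∫⁻ y, ‖martDiff (N - n) f y‖ₑ ^ q
        ≤ C * ∫⁻ y, ‖f y‖ₑ ^ q := by
    intro N
    have hm : ∀ n : ℕ, Measurable fun y : 𝓔 => ‖martDiff (N - n) f y‖ₑ ^ q := fun n =>
      (stronglyMeasurable_martDiff _ f).enorm.pow_const q
    rw [← lintegral_tsum fun n => (hm n).aemeasurable, ← lintegral_const_mul' _ _ (by simp)]
    refine lintegral_le_of_forall_cube N fun x => ?_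
    rw [lintegral_tsum fun n => (hm n).aemeasurable, lintegral_const_mul' _ _ (by simp)]
    exact key N x
  rw [ENNReal.tsum_eq_iSup_sum]
  refine iSup_le fun S => ?_
  obtain ⟨N, hN⟩ := S.bddAbove
  refine le_trans ?_ (key2 N)
  rw [← tsum_indicator_Iic N fun j => ∫⁻ y, ‖martDiff j f y‖ₑ ^ q]
  refine le_trans (le_of_eq (Finset.sum_congr rfl fun j hj => ?_)) (ENNReal.sum_le_tsum S)
  rw [Set.indicator_of_mem (show j ∈ Set.Iic N from hN hj)]

/-! ### Averages over balls of functions adapted to a dyadic level -/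

lemma setLIntegral_preimage_sub (x : 𝓔) (S : Set 𝓔) (h : 𝓔 → ℝ≥0∞) :
    ∫⁻ z in (fun z => z - x) ⁻¹' S, h z = ∫⁻ y in S, h (x + y) := by
  have h1 := (measurePreserving_add_left volume x).setLIntegral_comp_preimage_emb
    (MeasurableEquiv.addLeft x).measurableEmbedding h ((fun z => z - x) ⁻¹' S)
  rw [← h1, ← Set.preimage_comp]
  congr 2
  ext y
  simp

/-- If `g` has mean zero over the cubes of level `j`, then its integral over a ball only sees the
cubes that meet the boundary of the ball. -/
lemma enorm_setIntegral_ball_le_of_mean_zero {j : ℤ} {g : 𝓔 → B} {x : 𝓔} {R : ℝ}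
    (hg : IntegrableOn g (Metric.ball x R)) (h0 : ∀ z, ∫ y in dyadicCube j z, g y = 0) :
    ‖∫ z in Metric.ball x R, g z‖ₑ ≤ ∫⁻ y in shell d R (d * 2 ^ j), ‖g (x + y)‖ₑ := by
  set U : Set 𝓔 := {z | dyadicCube j z ⊆ Metric.ball x R} with hU
  have hsat : DyadicSaturated j U := fun z hz w hw => by
    rw [hU, Set.mem_ofPred_eq, dyadicCube_eq_of_mem hw]; exact hz
  have hUB : U ⊆ Metric.ball x R := fun z hz => hz (mem_dyadicCube_self j z)
  have h1 : ∫ z in U, g z = 0 :=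
    setIntegral_eq_zero_of_forall_cube hsat (hg.mono_set hUB) fun z _ => h0 z
  have h2 : ∫ z in Metric.ball x R, g z = ∫ z in Metric.ball x R \ U, g z := by
    rw [← integral_inter_add_sdiff hsat.measurableSet hg, Set.inter_eq_right.2 hUB, h1, zero_add]
  rw [h2, ← setLIntegral_preimage_sub x _ fun z => ‖g z‖ₑ]
  refine (enorm_integral_le_lintegral_enorm _).trans (lintegral_mono_set ?_)
  rintro z ⟨hz, hzU⟩
  rw [hU, Set.mem_ofPred_eq, Set.not_subset] at hzU
  obtain ⟨w, hw, hwR⟩ := hzU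
  have hzw := norm_sub_le_of_mem_dyadicCube hw
  rw [Metric.mem_ball, dist_eq_norm] at hz hwR
  refine ⟨by simpa using hz, ?_⟩
  rw [Metric.mem_ball, dist_zero_right]
  have : ‖w - x‖ ≤ ‖w - z‖ + ‖z - x‖ := norm_sub_le_norm_sub_add_norm_sub w z x
  linarith

/-- The integral form of `enorm_setIntegral_ball_le_of_mean_zero`: averages over balls of radius
`2 ^ k` of functions with mean zero at the scale `2 ^ j` gain the factor `2 ^ (j - k)`. -/
lemma lintegral_ballAverage_rpow_le_of_mean_zero (hd : 1 ≤ d) {s : ℝ} (hs : 1 ≤ s) (j k : ℤ)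
    {g : 𝓔 → B} (hgm : StronglyMeasurable g) (hg : Integrable g)
    (h0 : ∀ z, ∫ y in dyadicCube j z, g y = 0) :
    ∫⁻ x, ‖ballAverage (2 ^ k) g x‖ₑ ^ s
      ≤ ENNReal.ofReal (d * d * 2 ^ (j - k)) ^ s * ∫⁻ x, ‖g x‖ₑ ^ s := by
  have hR : (0 : ℝ) < 2 ^ k := zpow_two_pos k
  have hj : (0 : ℝ) < 2 ^ j := zpow_two_pos j
  have hv0 := volume_ball_zero_pos (d := d) hR
  have hv1 := volume_ball_zero_ne_top (d := d) (2 ^ k)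
  set v := volume (Metric.ball (0 : 𝓔) (2 ^ k)) with hv
  set S := shell d (2 ^ k) (d * 2 ^ j) with hS
  have hSv : v⁻¹ * volume S ≤ ENNReal.ofReal (d * d * 2 ^ (j - k)) := by
    have h := volume_shell_le hd hR (h := d * 2 ^ j) (by positivity)
    calc v⁻¹ * volume S ≤ v⁻¹ * (ENNReal.ofReal (d * (d * 2 ^ j / 2 ^ k)) * v) := by gcongr
      _ = ENNReal.ofReal (d * (d * 2 ^ j / 2 ^ k)) * (v⁻¹ * v) := by ring
      _ = _ := by
        rw [ENNReal.inv_mul_cancel hv0 hv1, mul_one, zpow_sub₀ two_ne_zero]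
        congr 1; ring
  have hs0 : 0 ≤ s := by linarith
  have hpt : ∀ x, ‖ballAverage (2 ^ k) g x‖ₑ ^ s
      ≤ v⁻¹ ^ s * volume S ^ (s - 1) * ∫⁻ y in S, ‖g (x + y)‖ₑ ^ s := by
    intro x
    rw [enorm_ballAverage hR, ENNReal.mul_rpow_of_nonneg _ _ hs0, mul_assoc]
    gcongr
    refine (ENNReal.rpow_le_rpow (enorm_setIntegral_ball_le_of_mean_zero hg.integrableOn h0)
      hs0).trans ?_
    have := lintegral_rpow_le (volume.restrict S) hs (f := fun y => ‖g (x + y)‖ₑ)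
      (hgm.enorm.comp (measurable_const_add x)).aemeasurable
    rwa [Measure.restrict_apply_univ] at this
  have hSS : volume S ^ (s - 1) * volume S = volume S ^ s := by
    nth_rewrite 2 [← ENNReal.rpow_one (volume S)]
    rw [← ENNReal.rpow_add_of_nonneg _ _ (by linarith) zero_le_one, sub_add_cancel]
  calc ∫⁻ x, ‖ballAverage (2 ^ k) g x‖ₑ ^ s
      ≤ ∫⁻ x, v⁻¹ ^ s * volume S ^ (s - 1) * ∫⁻ y in S, ‖g (x + y)‖ₑ ^ s := lintegral_mono hpt
    _ = v⁻¹ ^ s * volume S ^ (s - 1) * ∫⁻ x, ∫⁻ y in S, ‖g (x + y)‖ₑ ^ s := by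
        refine lintegral_const_mul _ ?_
        exact Measurable.lintegral_prod_right'
          (f := fun p : 𝓔 × 𝓔 => ‖g (p.1 + p.2)‖ₑ ^ s)
          ((hgm.enorm.comp (measurable_fst.add measurable_snd)).pow_const s)
    _ = v⁻¹ ^ s * volume S ^ s * ∫⁻ x, ‖g x‖ₑ ^ s := by
        rw [lintegral_lintegral_translate (hgm.enorm.pow_const s), ← hSS]
        ring
    _ = (v⁻¹ * volume S) ^ s * ∫⁻ x, ‖g x‖ₑ ^ s := by
        rw [ENNReal.mul_rpow_of_nonneg _ _ hs0]
    _ ≤ _ := by gcongr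

/-- The points that change their cube of level `i` under the translation by `y`. -/
def escapeSet (i : ℤ) (y : 𝓔) : Set 𝓔 := {x | x + y ∉ dyadicCube i x}

lemma measurableSet_escapeSet (i : ℤ) (y : 𝓔) : MeasurableSet (escapeSet i y) := by
  have : escapeSet i y = {x | gridIndex i (x + y) = gridIndex i x}ᶜ := by
    ext x; simp [escapeSet, mem_dyadicCube_iff]
  rw [this]
  exact (measurableSet_eq_fun ((measurable_gridIndex i).comp (measurable_add_const y))
    (measurable_gridIndex i)).compl

lemma setLIntegral_escapeSet_le {k i : ℤ} {y : 𝓔} (hy : ‖y‖ < 2 ^ k) {h : 𝓔 → ℝ≥0∞}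
    (hconst : ∀ x, ∀ z ∈ dyadicCube i x, h z = h x) :
    ∫⁻ x in escapeSet i y, h x ≤ ENNReal.ofReal (d * 2 ^ (k - i)) * ∫⁻ x, h x := by
  rw [← lintegral_const_mul' _ _ ENNReal.ofReal_ne_top]
  refine lintegral_le_of_forall_cube i fun x => ?_
  have hm := measurableSet_dyadicCube i x
  rw [Measure.restrict_restrict hm,
    setLIntegral_congr_fun (g := fun _ => h x) (hm.inter (measurableSet_escapeSet i y))
      (fun z hz => hconst x z hz.1),
    setLIntegral_congr_fun (g := fun _ => ENNReal.ofReal (d * 2 ^ (k - i)) * h x) hm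
      (fun z hz => by simp only [hconst x z hz]),
    setLIntegral_const, setLIntegral_const, mul_comm _ (h x), mul_assoc]
  gcongr
  refine le_trans (measure_mono ?_) (volume_dyadicCube_escape x y hy)
  rintro z ⟨hz, hzy⟩
  refine ⟨hz, ?_⟩
  rw [escapeSet, Set.mem_ofPred_eq, dyadicCube_eq_of_mem hz] at hzy
  exact hzy

/-- If `g` is constant on the cubes of level `i`, then averaging over balls of the smaller radius
`2 ^ k` changes `g` only near the boundaries of these cubes. -/
lemma lintegral_ballAverage_sub_rpow_le_of_const [CompleteSpace B] {s : ℝ} (hs : 1 ≤ s) (i k : ℤ)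
    {g : 𝓔 → B} (hgm : StronglyMeasurable g) (hg : Integrable g)
    (hconst : ∀ x, ∀ z ∈ dyadicCube i x, g z = g x) :
    ∫⁻ x, ‖ballAverage (2 ^ k) g x - g x‖ₑ ^ s
      ≤ 2 ^ s * ENNReal.ofReal (d * 2 ^ (k - i)) * ∫⁻ x, ‖g x‖ₑ ^ s := by
  have hR : (0 : ℝ) < 2 ^ k := zpow_two_pos k
  have hv0 := volume_ball_zero_pos (d := d) hR
  have hv1 := volume_ball_zero_ne_top (d := d) (2 ^ k)
  have hs0 : 0 ≤ s := by linarith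
  set S := Metric.ball (0 : 𝓔) (2 ^ k) with hS
  set v := volume S with hv
  have hpt : ∀ x, ‖ballAverage (2 ^ k) g x - g x‖ₑ ^ s
      ≤ v⁻¹ * ∫⁻ y in S, ‖g (x + y) - g x‖ₑ ^ s := by
    intro x
    have hint : IntegrableOn (fun y => g (x + y)) S := (hg.comp_add_left x).integrableOn
    -- The error is the mean of `g (x + y) - g x`, which vanishes unless `x` and `x + y` lie in
    -- different cubes.
    have e : ballAverage (2 ^ k) g x - g x = v.toReal⁻¹ • ∫ y in S, (g (x + y) - g x) := by
      rw [integral_sub hint (integrableOn_const hv1), setIntegral_const, smul_sub, smul_smul,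
        measureReal_def, inv_mul_cancel₀ (ENNReal.toReal_pos hv0 hv1).ne', one_smul, ballAverage_eq,
        setIntegral_ball_eq_translate]
    rw [e, enorm_toReal_inv_smul hv0 hv1, ENNReal.mul_rpow_of_nonneg _ _ hs0]
    have hJ := lintegral_rpow_le (volume.restrict S) hs (f := fun y => ‖g (x + y) - g x‖ₑ)
      ((hgm.comp_measurable (measurable_const_add x)).sub stronglyMeasurable_const).enorm.aemeasurable
    rw [Measure.restrict_apply_univ] at hJ
    calc v⁻¹ ^ s * ‖∫ y in S, (g (x + y) - g x)‖ₑ ^ s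
        ≤ v⁻¹ ^ s * (v ^ (s - 1) * ∫⁻ y in S, ‖g (x + y) - g x‖ₑ ^ s) := by
          gcongr
          exact (ENNReal.rpow_le_rpow (enorm_integral_le_lintegral_enorm _) hs0).trans hJ
      _ = _ := by
        rw [← mul_assoc]
        congr 1
        rw [ENNReal.inv_rpow, ← ENNReal.rpow_neg, ← ENNReal.rpow_add _ _ hv0 hv1]
        rw [show -s + (s - 1) = -1 by ring, ENNReal.rpow_neg_one]
  have hmeas : Measurable fun p : 𝓔 × 𝓔 => ‖g (p.1 + p.2) - g p.1‖ₑ ^ s :=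
    ((hgm.comp_measurable (measurable_fst.add measurable_snd)).sub
      (hgm.comp_measurable measurable_fst)).enorm.pow_const s
  have hshift : ∀ y ∈ S, ∫⁻ x, ‖g (x + y) - g x‖ₑ ^ s
      ≤ 2 ^ s * ENNReal.ofReal (d * 2 ^ (k - i)) * ∫⁻ x, ‖g x‖ₑ ^ s := by
    intro y hy
    have hy' : ‖y‖ < 2 ^ k := by simpa [hS] using hy
    have hc : ∀ x, ∀ z ∈ dyadicCube i x, ‖g z‖ₑ ^ s = ‖g x‖ₑ ^ s := fun x z hz => by
      rw [hconst x z hz]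
    have h1 := setLIntegral_escapeSet_le hy' hc
    have h2 := setLIntegral_escapeSet_le (y := -y) (by simpa using hy') hc
    have h3 : ∫⁻ x in escapeSet i y, ‖g (x + y)‖ₑ ^ s
        = ∫⁻ x in escapeSet i (-y), ‖g x‖ₑ ^ s := by
      rw [← (measurePreserving_add_right volume y).setLIntegral_comp_preimage_emb
        (MeasurableEquiv.addRight y).measurableEmbedding (fun x => ‖g x‖ₑ ^ s)]
      congr 2
      ext x
      simp only [escapeSet, Set.mem_preimage, Set.mem_ofPred_eq, add_neg_cancel_right]
      rw [mem_dyadicCube_comm]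
    have hm1 : Measurable fun x => ‖g (x + y)‖ₑ ^ s :=
      (hgm.enorm.comp (measurable_add_const y)).pow_const s
    calc ∫⁻ x, ‖g (x + y) - g x‖ₑ ^ s
        ≤ ∫⁻ x in escapeSet i y, 2 ^ (s - 1) * (‖g (x + y)‖ₑ ^ s + ‖g x‖ₑ ^ s) := by
          rw [← lintegral_indicator (measurableSet_escapeSet i y)]
          refine lintegral_mono fun x => ?_
          by_cases hx : x ∈ escapeSet i y
          · rw [Set.indicator_of_mem hx]
            refine (ENNReal.rpow_le_rpow enorm_sub_le hs0).trans ?_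
            exact ENNReal.rpow_add_le_mul_rpow_add_rpow _ _ hs
          · rw [Set.indicator_of_notMem hx, hconst x (x + y) (not_not.1 hx)]
            simp [show 0 < s by linarith]
      _ = 2 ^ (s - 1) * ((∫⁻ x in escapeSet i (-y), ‖g x‖ₑ ^ s)
            + ∫⁻ x in escapeSet i y, ‖g x‖ₑ ^ s) := by
          rw [← h3, ← lintegral_add_left hm1]
          exact lintegral_const_mul _ (hm1.add (hgm.enorm.pow_const s))
      _ ≤ 2 ^ (s - 1) * ((ENNReal.ofReal (d * 2 ^ (k - i)) * ∫⁻ x, ‖g x‖ₑ ^ s)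
            + ENNReal.ofReal (d * 2 ^ (k - i)) * ∫⁻ x, ‖g x‖ₑ ^ s) := by gcongr
      _ = (2 ^ (s - 1) * 2) * ENNReal.ofReal (d * 2 ^ (k - i)) * ∫⁻ x, ‖g x‖ₑ ^ s := by ring
      _ = _ := by
          congr 2
          nth_rewrite 2 [← ENNReal.rpow_one 2]
          rw [← ENNReal.rpow_add _ _ (by norm_num) (by norm_num), sub_add_cancel]
  calc ∫⁻ x, ‖ballAverage (2 ^ k) g x - g x‖ₑ ^ s
      ≤ ∫⁻ x, v⁻¹ * ∫⁻ y in S, ‖g (x + y) - g x‖ₑ ^ s := lintegral_mono hpt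
    _ = v⁻¹ * ∫⁻ y in S, ∫⁻ x, ‖g (x + y) - g x‖ₑ ^ s := by
        rw [lintegral_const_mul' _ _ (by simpa using hv0),
          lintegral_lintegral_swap (f := fun x y => ‖g (x + y) - g x‖ₑ ^ s) hmeas.aemeasurable]
    _ ≤ v⁻¹ * ∫⁻ _y in S, 2 ^ s * ENNReal.ofReal (d * 2 ^ (k - i)) * ∫⁻ x, ‖g x‖ₑ ^ s := by
        refine mul_le_mul_right ?_ _
        exact setLIntegral_mono' measurableSet_ball hshift
    _ = (v⁻¹ * v) * (2 ^ s * ENNReal.ofReal (d * 2 ^ (k - i)) * ∫⁻ x, ‖g x‖ₑ ^ s) := by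
        rw [setLIntegral_const]; ring
    _ = _ := by rw [ENNReal.inv_mul_cancel hv0 hv1, one_mul]

/-- Dyadic means converge to the function at almost every point. -/
lemma ae_tendsto_dyadicCondExp [CompleteSpace B] (hd : 1 ≤ d) {f : 𝓔 → B}
    (hf : LocallyIntegrable f) :
    ∀ᵐ z, Filter.Tendsto (fun N : ℕ => dyadicCondExp (-(N : ℤ)) f z) Filter.atTop
      (nhds (f z)) := by
  filter_upwards [(IsUnifLocDoublingMeasure.vitaliFamily (volume : Measure 𝓔)
    1).ae_tendsto_average_norm_sub hf] with z hz
  have hd0 : (0 : ℝ) < d := by exact_mod_cast hd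
  set δ : ℕ → ℝ := fun N => d * 2 ^ (-(N : ℤ)) with hδ
  have hδpos : ∀ N, 0 < δ N := fun N => mul_pos hd0 (zpow_two_pos _)
  have hδlim : Filter.Tendsto δ Filter.atTop (nhdsWithin 0 (Set.Ioi 0)) := by
    refine tendsto_nhdsWithin_iff.2 ⟨?_, Filter.Eventually.of_forall hδpos⟩
    have h1 : Filter.Tendsto (fun N : ℕ => (d : ℝ) * (1 / 2) ^ N) Filter.atTop (nhds (d * 0)) :=
      (tendsto_pow_atTop_nhds_zero_of_lt_one (by norm_num) (by norm_num)).const_mul _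
    simpa [hδ, zpow_neg] using h1
  have hball := hz.comp (IsUnifLocDoublingMeasure.tendsto_closedBall_filterAt volume (K := 1)
    (fun _ => z) δ hδlim (Filter.Eventually.of_forall fun N => by
      simpa using (hδpos N).le))
  set ω := (volume (Metric.ball (0 : 𝓔) 1)).toReal with hω
  rw [tendsto_iff_norm_sub_tendsto_zero]
  have hlim := hball.const_mul ((d : ℝ) ^ d * ω)
  rw [mul_zero] at hlim
  refine squeeze_zero (fun N => norm_nonneg _) (fun N => ?_) hlim
  set k : ℤ := -(N : ℤ) with hk
  have hk0 : (0 : ℝ) < 2 ^ k := zpow_two_pos k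
  have hsub : dyadicCube k z ⊆ Metric.closedBall z (δ N) := fun y hy => by
    rw [mem_closedBall_iff_norm]; exact norm_sub_le_of_mem_dyadicCube hy
  have hintB : IntegrableOn f (Metric.closedBall z (δ N)) :=
    hf.integrableOn_isCompact (isCompact_closedBall z _)
  have hintB' : IntegrableOn (fun y => f y - f z) (Metric.closedBall z (δ N)) :=
    hintB.sub (integrableOn_const measure_closedBall_lt_top.ne)
  have hQ : (volume (dyadicCube k z)).toReal = (2 ^ k) ^ d := by
    rw [volume_dyadicCube, ENNReal.toReal_ofReal (by positivity)]
  have hB : (volume (Metric.closedBall z (δ N))).toReal = (d * 2 ^ k) ^ d * ω := by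
    rw [Measure.addHaar_closedBall _ _ (hδpos N).le, ENNReal.toReal_mul,
      ENNReal.toReal_ofReal (pow_nonneg (hδpos N).le _), finrank_euclideanSpace_fin]
  have hω0 : 0 < ω := ENNReal.toReal_pos (volume_ball_zero_pos one_pos) (volume_ball_zero_ne_top 1)
  have e : dyadicCondExp k f z - f z
      = (volume (dyadicCube k z)).toReal⁻¹ • ∫ y in dyadicCube k z, (f y - f z) := by
    rw [integral_sub (hintB.mono_set hsub) (integrableOn_const (volume_dyadicCube_ne_top k z)),
      setIntegral_const, smul_sub, smul_smul, measureReal_def, inv_mul_cancel₀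
      (ENNReal.toReal_pos (volume_dyadicCube_pos k z) (volume_dyadicCube_ne_top k z)).ne',
      one_smul, dyadicCondExp_eq]
  rw [e, norm_smul, Real.norm_of_nonneg (by positivity)]
  calc (volume (dyadicCube k z)).toReal⁻¹ * ‖∫ y in dyadicCube k z, (f y - f z)‖
      ≤ (volume (dyadicCube k z)).toReal⁻¹ * ∫ y in Metric.closedBall z (δ N), ‖f y - f z‖ := by
        gcongr
        refine (norm_integral_le_integral_norm _).trans ?_
        exact setIntegral_mono_set hintB'.norm (Filter.Eventually.of_forall fun _ => norm_nonneg _)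
          hsub.eventuallyLE
    _ = d ^ d * ω * ⨍ y in Metric.closedBall z (δ N), ‖f y - f z‖ := by
        rw [setAverage_eq, measureReal_def, hQ, hB, smul_eq_mul, mul_pow]
        field_simp

/-! ### Average differences -/

/-- The difference of the central average at scale `2 ^ k` and of the dyadic mean at the same
scale. -/
def avgDiff (k : ℤ) (f : 𝓔 → B) (x : 𝓔) : B := ballAverage ((2 : ℝ) ^ k) f x - dyadicCondExp k f x

lemma longVariation_eq_seqNorm (q : ℝ) (f : 𝓔 → B) (x : 𝓔) :
    longVariation q f x = seqNorm q fun k => ‖avgDiff k f x‖ₑ := rfl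

lemma stronglyMeasurable_avgDiff (k : ℤ) {f : 𝓔 → B} (hf : StronglyMeasurable f) :
    StronglyMeasurable (avgDiff k f) :=
  (stronglyMeasurable_ballAverage _ hf).sub (stronglyMeasurable_dyadicCondExp k f)

lemma measurable_longVariation (q : ℝ) {f : 𝓔 → B} (hf : StronglyMeasurable f) :
    Measurable (longVariation q f) :=
  (Measurable.tsum fun k => (stronglyMeasurable_avgDiff k hf).enorm.pow_const q).pow_const _

lemma integrableOn_dyadicCube {G : Type*} [NormedAddCommGroup G] {f : 𝓔 → G}
    (hf : LocallyIntegrable f) (k : ℤ) (x : 𝓔) :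
    IntegrableOn f (dyadicCube k x) :=
  (hf.integrableOn_isCompact (isCompact_closedBall x (d * 2 ^ k))).mono_set fun y hy => by
    rw [mem_closedBall_iff_norm]; exact norm_sub_le_of_mem_dyadicCube hy

lemma integrableOn_ball {G : Type*} [NormedAddCommGroup G] {f : 𝓔 → G}
    (hf : LocallyIntegrable f) (x : 𝓔) (R : ℝ) :
    IntegrableOn f (Metric.ball x R) :=
  (hf.integrableOn_isCompact (isCompact_closedBall x R)).mono_set Metric.ball_subset_closedBall

lemma ballAverage_add {f g : 𝓔 → B} (hf : LocallyIntegrable f) (hg : LocallyIntegrable g)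
    (t : ℝ) (x : 𝓔) :
    ballAverage t (fun y => f y + g y) x = ballAverage t f x + ballAverage t g x := by
  rw [ballAverage_eq, ballAverage_eq, ballAverage_eq, ← smul_add,
    integral_add (integrableOn_ball hf x t) (integrableOn_ball hg x t)]

lemma dyadicCondExp_add {f g : 𝓔 → B} (hf : LocallyIntegrable f) (hg : LocallyIntegrable g)
    (k : ℤ) (x : 𝓔) :
    dyadicCondExp k (fun y => f y + g y) x = dyadicCondExp k f x + dyadicCondExp k g x := by
  rw [dyadicCondExp_eq, dyadicCondExp_eq, dyadicCondExp_eq, ← smul_add,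
    integral_add (integrableOn_dyadicCube hf k x) (integrableOn_dyadicCube hg k x)]

lemma avgDiff_add {f g : 𝓔 → B} (hf : LocallyIntegrable f) (hg : LocallyIntegrable g)
    (k : ℤ) (x : 𝓔) :
    avgDiff k (fun y => f y + g y) x = avgDiff k f x + avgDiff k g x := by
  rw [avgDiff, ballAverage_add hf hg, dyadicCondExp_add hf hg, avgDiff, avgDiff]
  abel

lemma longVariation_add_le {q : ℝ} (hq : 1 ≤ q) {f g : 𝓔 → B} (hf : LocallyIntegrable f)
    (hg : LocallyIntegrable g) (x : 𝓔) :
    longVariation q (fun y => f y + g y) x ≤ longVariation q f x + longVariation q g x := by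
  simp only [longVariation_eq_seqNorm]
  refine le_trans (seqNorm_mono (by linarith) fun k => ?_) (seqNorm_add_le hq _ _)
  rw [avgDiff_add hf hg]
  exact enorm_add_le _ _

lemma enorm_avgDiff_le (k : ℤ) (f : 𝓔 → B) (x : 𝓔) :
    ‖avgDiff k f x‖ₑ
      ≤ ((volume (Metric.ball (0 : 𝓔) (2 ^ k)))⁻¹ * ∫⁻ z in Metric.ball x (2 ^ k), ‖f z‖ₑ)
        + (volume (dyadicCube k x))⁻¹ * ∫⁻ y in dyadicCube k x, ‖f y‖ₑ :=
  enorm_sub_le.trans (add_le_add (enorm_ballAverage_le (zpow_two_pos k) f x)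
    (enorm_dyadicCondExp_le k f x))

lemma inv_volume_mul_setLIntegral_le {S : Set 𝓔} (h0 : volume S ≠ 0) (h1 : volume S ≠ ∞)
    {h : 𝓔 → ℝ≥0∞} {M : ℝ≥0∞} (hM : ∀ z, h z ≤ M) : (volume S)⁻¹ * ∫⁻ z in S, h z ≤ M := by
  calc (volume S)⁻¹ * ∫⁻ z in S, h z ≤ (volume S)⁻¹ * ∫⁻ _z in S, M := by
        gcongr with z; exact hM z
    _ = M * ((volume S)⁻¹ * volume S) := by rw [setLIntegral_const]; ring
    _ = M := by rw [ENNReal.inv_mul_cancel h0 h1, mul_one]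

lemma volume_ball_eq (x : 𝓔) (R : ℝ) :
    volume (Metric.ball x R) = volume (Metric.ball (0 : 𝓔) R) :=
  Measure.addHaar_ball_center _ _ _

lemma enorm_avgDiff_le_of_bound (k : ℤ) {f : 𝓔 → B} {M : ℝ≥0∞} (hM : ∀ z, ‖f z‖ₑ ≤ M) (x : 𝓔) :
    ‖avgDiff k f x‖ₑ ≤ 2 * M := by
  refine (enorm_avgDiff_le k f x).trans ?_
  rw [two_mul, ← volume_ball_eq x]
  refine add_le_add (inv_volume_mul_setLIntegral_le ?_ ?_ hM)
    (inv_volume_mul_setLIntegral_le (volume_dyadicCube_pos k x) (volume_dyadicCube_ne_top k x) hM)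
  · rw [volume_ball_eq]; exact volume_ball_zero_pos (zpow_two_pos k)
  · rw [volume_ball_eq]; exact volume_ball_zero_ne_top _

lemma enorm_dyadicCondExp_le_of_bound (k : ℤ) {f : 𝓔 → B} {M : ℝ≥0∞} (hM : ∀ z, ‖f z‖ₑ ≤ M)
    (x : 𝓔) : ‖dyadicCondExp k f x‖ₑ ≤ M :=
  (enorm_dyadicCondExp_le k f x).trans (inv_volume_mul_setLIntegral_le
    (volume_dyadicCube_pos k x) (volume_dyadicCube_ne_top k x) hM)

lemma integrable_condExp (k : ℤ) {f : 𝓔 → B} (hfm : StronglyMeasurable f) (hf : Integrable f) :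
    Integrable (dyadicCondExp k f) := by
  rw [← integrableOn_univ] at hf ⊢
  exact integrableOn_condExp hfm (fun x _ => Set.subset_univ (dyadicCube k x)) hf

lemma integrable_martDiff (j : ℤ) {f : 𝓔 → B} (hfm : StronglyMeasurable f) (hf : Integrable f) :
    Integrable (martDiff j f) :=
  (integrable_condExp _ hfm hf).sub (integrable_condExp _ hfm hf)

lemma enorm_dyadicCondExp_le_lintegral (k : ℤ) (f : 𝓔 → B) (x : 𝓔) :
    ‖dyadicCondExp k f x‖ₑ ≤ (ENNReal.ofReal (((2 : ℝ) ^ k) ^ d))⁻¹ * ∫⁻ y, ‖f y‖ₑ := by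
  refine (enorm_dyadicCondExp_le k f x).trans ?_
  rw [volume_dyadicCube]
  gcongr
  exact Measure.restrict_le_self

lemma tendsto_inv_zpow_pow (hd : 1 ≤ d) :
    Filter.Tendsto (fun N : ℕ => (ENNReal.ofReal (((2 : ℝ) ^ (N : ℤ)) ^ d))⁻¹) Filter.atTop
      (nhds 0) := by
  rw [← ENNReal.inv_top]
  refine (tendsto_inv_iff.2 ?_)
  refine ENNReal.tendsto_ofReal_nhds_top.2 ?_
  simp only [zpow_natCast, ← pow_mul, mul_comm _ d]
  simp only [pow_mul]
  refine tendsto_pow_atTop_atTop_of_one_lt ?_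
  exact one_lt_pow₀ one_lt_two (by omega)

/-- The telescoping step: an average difference of `f` is dominated by the sum of those of its
martingale differences. -/
lemma enorm_avgDiff_le_tsum_martDiff [CompleteSpace B] (hd : 1 ≤ d) {f : 𝓔 → B}
    (hfm : StronglyMeasurable f) (hf : Integrable f) {M : ℝ≥0} (hM : ∀ z, ‖f z‖ₑ ≤ M)
    (k : ℤ) (x : 𝓔) :
    ‖avgDiff k f x‖ₑ ≤ ∑' j : ℤ, ‖avgDiff k (martDiff j f) x‖ₑ := by
  have hE : ∀ j, LocallyIntegrable (dyadicCondExp j f) := fun j =>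
    (integrable_condExp j hfm hf).locallyIntegrable
  have hD : ∀ j, LocallyIntegrable (martDiff j f) := fun j =>
    (integrable_martDiff j hfm hf).locallyIntegrable
  -- A finite number of telescoping steps.
  have h1 : ∀ (a : ℤ) (n : ℕ), ‖avgDiff k (dyadicCondExp a f) x‖ₑ
      ≤ ‖avgDiff k (dyadicCondExp (a + n) f) x‖ₑ
        + ∑ i ∈ Finset.range n, ‖avgDiff k (martDiff (a + 1 + i) f) x‖ₑ := by
    intro a n
    induction n with
    | zero => simp
    | succ n ih =>
      have e : dyadicCondExp (a + n) f
          = fun y => dyadicCondExp (a + (n + 1 : ℕ)) f y + martDiff (a + 1 + n) f y := by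
        funext y
        have e1 : a + 1 + (n : ℤ) - 1 = a + n := by ring
        have e2 : a + ((n + 1 : ℕ) : ℤ) = a + 1 + n := by push_cast; ring
        rw [martDiff, e1, e2]
        abel
      rw [e, avgDiff_add (hE _) (hD _)] at ih
      refine ih.trans ?_
      rw [Finset.sum_range_succ, add_comm (∑ i ∈ Finset.range n, _), ← add_assoc]
      gcongr
      exact enorm_add_le _ _
  have h2 : ∀ N : ℕ, ‖avgDiff k f x‖ₑ
      ≤ ‖avgDiff k (fun y => f y - dyadicCondExp (-(N : ℤ)) f y) x‖ₑ
        + 2 * ((ENNReal.ofReal (((2 : ℝ) ^ (N : ℤ)) ^ d))⁻¹ * ∫⁻ y, ‖f y‖ₑ)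
        + ∑' j : ℤ, ‖avgDiff k (martDiff j f) x‖ₑ := by
    intro N
    have e : avgDiff k f x = avgDiff k (fun y => f y - dyadicCondExp (-(N : ℤ)) f y) x
        + avgDiff k (dyadicCondExp (-(N : ℤ)) f) x := by
      rw [← avgDiff_add (f := fun y => f y - dyadicCondExp (-(N : ℤ)) f y)
        (hf.locallyIntegrable.sub (hE _)) (hE _)]
      simp
    rw [e, add_assoc]
    refine (enorm_add_le _ _).trans ?_
    gcongr
    refine (h1 (-(N : ℤ)) (2 * N)).trans (add_le_add ?_ ?_)
    · have e2 : -(N : ℤ) + ((2 * N : ℕ) : ℤ) = N := by push_cast; ring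
      rw [e2]
      exact enorm_avgDiff_le_of_bound k (enorm_dyadicCondExp_le_lintegral _ f) x
    · refine (ENNReal.sum_le_tsum _).trans ?_
      exact ENNReal.tsum_comp_le_tsum_of_injective (f := fun i : ℕ => -(N : ℤ) + 1 + i)
        (fun i j h => by simpa using h) fun j => ‖avgDiff k (martDiff j f) x‖ₑ
  -- The two remainders vanish in the limit, by dominated convergence at the fine end and by the
  -- decay of the dyadic means of an integrable function at the coarse end.
  have h3 : ∀ S : Set 𝓔, volume S ≠ ∞ → Filter.Tendsto (fun N : ℕ =>
      ∫⁻ z in S, ‖f z - dyadicCondExp (-(N : ℤ)) f z‖ₑ) Filter.atTop (nhds 0) := by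
    intro S hS
    have := tendsto_lintegral_of_dominated_convergence (μ := volume.restrict S)
      (F := fun (N : ℕ) z => ‖f z - dyadicCondExp (-(N : ℤ)) f z‖ₑ) (f := fun _ => 0)
      (fun _ => (M : ℝ≥0∞) + M)
      (fun N => (hfm.sub (stronglyMeasurable_dyadicCondExp _ f)).enorm)
      (fun N => Filter.Eventually.of_forall fun z => enorm_sub_le.trans
        (add_le_add (hM z) (enorm_dyadicCondExp_le_of_bound _ hM z)))
      (by rw [setLIntegral_const]; exact ENNReal.mul_ne_top (by simp) hS) ?_
    · simpa using this
    · filter_upwards [ae_restrict_of_ae (ae_tendsto_dyadicCondExp hd hf.locallyIntegrable)] with z hz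
      have h := (tendsto_const_nhds (x := f z)).sub hz
      rw [sub_self] at h
      simpa using h.enorm
  have h4 : Filter.Tendsto (fun N : ℕ =>
      ‖avgDiff k (fun y => f y - dyadicCondExp (-(N : ℤ)) f y) x‖ₑ)
      Filter.atTop (nhds 0) := by
    have hv0 := volume_ball_zero_pos (d := d) (zpow_two_pos k)
    have ha := ENNReal.Tendsto.const_mul (h3 (Metric.ball x (2 ^ k)) measure_ball_lt_top.ne)
      (Or.inr (ENNReal.inv_ne_top.2 hv0))
    have hb := ENNReal.Tendsto.const_mul (h3 (dyadicCube k x) (volume_dyadicCube_ne_top k x))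
      (Or.inr (ENNReal.inv_ne_top.2 (volume_dyadicCube_pos k x)))
    have hab := ha.add hb
    simp only [mul_zero, add_zero] at hab
    exact tendsto_of_tendsto_of_tendsto_of_le_of_le tendsto_const_nhds hab (fun _ => zero_le)
      (fun N => enorm_avgDiff_le k _ x)
  have h5 : Filter.Tendsto (fun N : ℕ =>
      2 * ((ENNReal.ofReal (((2 : ℝ) ^ (N : ℤ)) ^ d))⁻¹ * ∫⁻ y, ‖f y‖ₑ)) Filter.atTop (nhds 0) := by
    have := ENNReal.Tendsto.const_mul (a := 2) (ENNReal.Tendsto.mul_const (tendsto_inv_zpow_pow hd)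
      (Or.inr hf.2.ne)) (Or.inr (by norm_num))
    simpa using this
  have h6 := (h4.add h5).add
    (tendsto_const_nhds (x := ∑' j : ℤ, ‖avgDiff k (martDiff j f) x‖ₑ))
  rw [add_zero, zero_add] at h6
  exact ge_of_tendsto' h6 h2

/-! ### Almost orthogonality and the `L^q` estimate -/

/-- Jensen's inequality for weighted sums. -/
lemma tsum_rpow_le_weighted {q : ℝ} (hq : 1 ≤ q) (a w : ℤ → ℝ≥0∞) (h0 : ∀ n, w n ≠ 0)
    (h1 : ∀ n, w n ≠ ∞) :
    (∑' n, a n) ^ q ≤ (∑' n, w n) ^ (q - 1) * ∑' n, w n ^ (1 - q) * a n ^ q := by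
  have hm : ∀ u : ℤ → ℝ≥0∞, Measurable u := fun u => measurable_of_countable u
  have h := lintegral_rpow_le (Measure.count.withDensity w) hq
    (hm (fun n => a n / w n)).aemeasurable
  rw [lintegral_withDensity_eq_lintegral_mul _ (hm w) (hm _),
    lintegral_withDensity_eq_lintegral_mul _ (hm w) (hm _), lintegral_count, lintegral_count,
    withDensity_apply _ MeasurableSet.univ, Measure.restrict_univ, lintegral_count] at h
  simp only [Pi.mul_apply] at h
  have e1 : ∀ n, w n * (a n / w n) = a n := fun n => ENNReal.mul_div_cancel (h0 n) (h1 n)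
  have e2 : ∀ n, w n * (a n / w n) ^ q = w n ^ (1 - q) * a n ^ q := fun n => by
    rw [ENNReal.div_rpow_of_nonneg _ _ (by linarith), ENNReal.rpow_sub _ _ (h0 n) (h1 n),
      ENNReal.rpow_one, div_eq_mul_inv, div_eq_mul_inv]
    ring
  simpa only [e1, e2] using h

lemma setIntegral_dyadicCube_martDiff [CompleteSpace B] {j k : ℤ} (hjk : j ≤ k) {f : 𝓔 → B}
    (hfm : StronglyMeasurable f) (hf : Integrable f) (x : 𝓔) :
    ∫ y in dyadicCube k x, martDiff j f y = 0 := by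
  have hs := dyadicSaturated_dyadicCube k x
  have h1 := setIntegral_condExp_eq (k := j - 1) hfm (hs.mono (by omega)) hf.integrableOn
  have h2 := setIntegral_condExp_eq (k := j) hfm (hs.mono hjk) hf.integrableOn
  unfold martDiff
  rw [integral_sub (integrable_condExp _ hfm hf).integrableOn
    (integrable_condExp _ hfm hf).integrableOn, h1, h2, sub_self]

lemma martDiff_eq_of_mem {j i : ℤ} (hij : i < j) (f : 𝓔 → B) (x : 𝓔) :
    ∀ z ∈ dyadicCube i x, martDiff j f z = martDiff j f x := fun z hz => by
  rw [martDiff, martDiff, dyadicCondExp_eq_of_mem f (dyadicCube_subset (by omega) x hz),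
    dyadicCondExp_eq_of_mem f (dyadicCube_subset hij.le x hz)]

/-- Almost orthogonality: the average differences at the scale `2 ^ k` and the martingale
differences at the scale `2 ^ j` interact with the strength `2 ^ (-|j - k|)`. -/
lemma exists_lintegral_avgDiff_martDiff_le [CompleteSpace B] (hd : 1 ≤ d) {q : ℝ} (hq : 1 ≤ q) :
    ∃ C : ℝ≥0∞, C ≠ ∞ ∧ ∀ f : 𝓔 → B, StronglyMeasurable f → Integrable f → ∀ j k : ℤ,
      ∫⁻ x, ‖avgDiff k (martDiff j f) x‖ₑ ^ q
        ≤ C * ENNReal.ofReal ((1 / 2) ^ (j - k).natAbs) * ∫⁻ x, ‖martDiff j f x‖ₑ ^ q := by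
  have hq0 : 0 ≤ q := by linarith
  refine ⟨ENNReal.ofReal (d * d) ^ q + 2 ^ q * ENNReal.ofReal (2 * d), ?_, ?_⟩
  · exact ENNReal.add_ne_top.2 ⟨ENNReal.rpow_ne_top_of_nonneg hq0 ENNReal.ofReal_ne_top,
      ENNReal.mul_ne_top (ENNReal.rpow_ne_top_of_nonneg hq0 (by norm_num)) ENNReal.ofReal_ne_top⟩
  intro f hfm hf j k
  have hDm := stronglyMeasurable_martDiff j f
  have hD := integrable_martDiff j hfm hf
  rcases le_or_gt j k with hjk | hjk
  · have e : ∀ x, avgDiff k (martDiff j f) x = ballAverage (2 ^ k) (martDiff j f) x := fun x => by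
      rw [avgDiff, dyadicCondExp_eq, setIntegral_dyadicCube_martDiff hjk hfm hf, smul_zero, sub_zero]
    simp only [e]
    refine (lintegral_ballAverage_rpow_le_of_mean_zero hd hq j k hDm hD
      (setIntegral_dyadicCube_martDiff le_rfl hfm hf)).trans ?_
    gcongr
    obtain ⟨n, hn⟩ := Int.eq_ofNat_of_zero_le (sub_nonneg.2 hjk)
    have e2 : (2 : ℝ) ^ (j - k) = (1 / 2) ^ n := by
      rw [← neg_sub, hn, zpow_neg, zpow_natCast, one_div, inv_pow]
    have e3 : (j - k).natAbs = n := by omega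
    rw [e2, e3, ENNReal.ofReal_mul (by positivity), ENNReal.mul_rpow_of_nonneg _ _ hq0]
    refine mul_le_mul' le_self_add ?_
    have h1 : ENNReal.ofReal ((1 / 2) ^ n) ≤ 1 := by
      rw [ENNReal.ofReal_le_one]
      exact pow_le_one₀ (by norm_num) (by norm_num)
    simpa using ENNReal.rpow_le_rpow_of_exponent_ge h1 hq
  · have e : ∀ x, avgDiff k (martDiff j f) x
        = ballAverage (2 ^ k) (martDiff j f) x - martDiff j f x := fun x => by
      rw [avgDiff, dyadicCondExp_eq, setIntegral_congr_fun (measurableSet_dyadicCube k x)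
        (martDiff_eq_of_mem hjk f x), setIntegral_const, smul_smul, measureReal_def,
        inv_mul_cancel₀, one_smul]
      exact (ENNReal.toReal_pos (volume_dyadicCube_pos k x) (volume_dyadicCube_ne_top k x)).ne'
    simp only [e]
    refine (lintegral_ballAverage_sub_rpow_le_of_const hq (j - 1) k hDm hD
      (martDiff_eq_of_mem (by omega) f)).trans ?_
    refine mul_le_mul_left ?_ _
    obtain ⟨n, hn⟩ := Int.eq_ofNat_of_zero_le (sub_nonneg.2 hjk.le)
    have e2 : (2 : ℝ) ^ (k - (j - 1)) = 2 * (1 / 2) ^ n := by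
      rw [show k - (j - 1) = 1 + -(n : ℤ) by omega, zpow_add₀ two_ne_zero, zpow_neg, zpow_natCast,
        one_div, inv_pow, zpow_one]
    have e3 : (j - k).natAbs = n := by omega
    rw [e2, e3, add_mul, mul_assoc (2 ^ q), ← ENNReal.ofReal_mul (by positivity)]
    refine le_add_left (le_of_eq ?_)
    congr 2
    ring

/-- The `L^q` estimate: the case in which the exponent of integrability is the cotype. -/
lemma exists_lintegral_longVariation_rpow_le [CompleteSpace B] (hd : 1 ≤ d) {q : ℝ} (hq : 1 ≤ q)
    (hB : HasMartingaleCotype B q) :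
    ∃ C : ℝ≥0∞, C ≠ ∞ ∧ ∀ f : 𝓔 → B, StronglyMeasurable f → Integrable f →
      (∃ M : ℝ≥0, ∀ z, ‖f z‖ₑ ≤ M) →
      ∫⁻ x, longVariation q f x ^ q ≤ C * ∫⁻ x, ‖f x‖ₑ ^ q := by
  have hq0 : 0 < q := by linarith
  obtain ⟨C₁, hC₁⟩ := exists_tsum_martDiff_le (d := d) hq hB
  obtain ⟨C₂, hC₂, hC₂'⟩ := exists_lintegral_avgDiff_martDiff_le (d := d) (B := B) hd hq
  -- The weights `w n = 2 ^ (-|n| / q)` satisfy `w ^ (1 - q) * 2 ^ (-|n|) = w`.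
  set θ : ℝ := 2 ^ (-(1 / q)) with hθ
  have hθ0 : 0 < θ := by positivity
  have hθ1 : θ < 1 := Real.rpow_lt_one_of_one_lt_of_neg one_lt_two (by
    have : 0 < 1 / q := by positivity
    linarith)
  have hθq : θ ^ q = 1 / 2 := by
    rw [hθ, ← Real.rpow_mul zero_le_two, neg_mul, one_div_mul_cancel hq0.ne', Real.rpow_neg_one,
      one_div]
  set w : ℤ → ℝ≥0∞ := fun n => ENNReal.ofReal (θ ^ n.natAbs) with hw
  have hw0 : ∀ n, w n ≠ 0 := fun n => by simpa [hw] using pow_pos hθ0 _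
  have hw1 : ∀ n, w n ≠ ∞ := fun n => ENNReal.ofReal_ne_top
  have hwq : ∀ n : ℤ, ENNReal.ofReal ((1 / 2) ^ n.natAbs) = w n ^ q := fun n => by
    rw [hw, ENNReal.ofReal_rpow_of_pos (pow_pos hθ0 _), ← hθq, ← Real.rpow_natCast,
      ← Real.rpow_natCast, ← Real.rpow_mul hθ0.le, ← Real.rpow_mul hθ0.le, mul_comm]
  have hww : ∀ n, w n ^ (1 - q) * w n ^ q = w n := fun n => by
    rw [← ENNReal.rpow_add _ _ (hw0 n) (hw1 n), sub_add_cancel, ENNReal.rpow_one]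
  set W := ∑' n, w n with hW
  have hWtop : W ≠ ∞ := by
    have hg := tsum_rpow_geometric_ne_top hθ0.le hθ1
    refine ne_top_of_le_ne_top (ENNReal.add_ne_top.2 ⟨hg, hg⟩) ((tsum_int_le w).trans ?_)
    refine add_le_add (ENNReal.tsum_le_tsum fun i => ?_) (ENNReal.tsum_le_tsum fun i => ?_)
    · simp [hw]
    · refine ENNReal.ofReal_le_ofReal (pow_le_pow_of_le_one hθ0.le hθ1.le ?_)
      omega
  refine ⟨W ^ (q - 1) * (W * (C₂ * C₁)), ?_, ?_⟩
  · exact ENNReal.mul_ne_top (ENNReal.rpow_ne_top_of_nonneg (by linarith) hWtop)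
      (ENNReal.mul_ne_top hWtop (ENNReal.mul_ne_top hC₂ (by simp)))
  intro f hfm hf hbd
  obtain ⟨M, hM⟩ := hbd
  have hfq : ∫⁻ x, ‖f x‖ₑ ^ q < ∞ := by
    calc ∫⁻ x, ‖f x‖ₑ ^ q ≤ ∫⁻ x, (M : ℝ≥0∞) ^ (q - 1) * ‖f x‖ₑ := by
          refine lintegral_mono fun x => ?_
          have : ‖f x‖ₑ ^ q = ‖f x‖ₑ ^ (q - 1) * ‖f x‖ₑ := by
            conv_lhs => rw [show q = (q - 1) + 1 by ring]
            rw [ENNReal.rpow_add_of_nonneg _ _ (by linarith) zero_le_one, ENNReal.rpow_one]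
          simp only [this]
          gcongr
          exact hM x
      _ = (M : ℝ≥0∞) ^ (q - 1) * ∫⁻ x, ‖f x‖ₑ := lintegral_const_mul _ hfm.enorm
      _ < ∞ := ENNReal.mul_lt_top (ENNReal.rpow_lt_top_of_nonneg (by linarith) (by simp)) hf.2
  have hm : ∀ j k, Measurable fun x => ‖avgDiff k (martDiff j f) x‖ₑ ^ q := fun j k =>
    (stronglyMeasurable_avgDiff k (stronglyMeasurable_martDiff j f)).enorm.pow_const q
  have hpt : ∀ x k, ‖avgDiff k f x‖ₑ ^ q
      ≤ W ^ (q - 1) * ∑' n : ℤ, w n ^ (1 - q) * ‖avgDiff k (martDiff (k + n) f) x‖ₑ ^ q := by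
    intro x k
    refine (ENNReal.rpow_le_rpow (enorm_avgDiff_le_tsum_martDiff hd hfm hf hM k x) hq0.le).trans ?_
    rw [← (Equiv.addLeft k).tsum_eq fun j => ‖avgDiff k (martDiff j f) x‖ₑ]
    exact tsum_rpow_le_weighted hq _ w hw0 hw1
  calc ∫⁻ x, longVariation q f x ^ q
      = ∫⁻ x, ∑' k : ℤ, ‖avgDiff k f x‖ₑ ^ q := by
        simp only [longVariation_eq_seqNorm, seqNorm_rpow hq0]
    _ ≤ ∫⁻ x, ∑' k : ℤ, W ^ (q - 1) *
          ∑' n : ℤ, w n ^ (1 - q) * ‖avgDiff k (martDiff (k + n) f) x‖ₑ ^ q :=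
        lintegral_mono fun x => ENNReal.tsum_le_tsum fun k => hpt x k
    _ = W ^ (q - 1) * ∑' k : ℤ, ∑' n : ℤ, w n ^ (1 - q) *
          ∫⁻ x, ‖avgDiff k (martDiff (k + n) f) x‖ₑ ^ q := by
        simp only [ENNReal.tsum_mul_left]
        rw [lintegral_const_mul _ (Measurable.tsum fun k => Measurable.tsum fun n =>
            (hm _ _).const_mul _),
          lintegral_tsum fun k => (Measurable.tsum fun n => (hm _ _).const_mul _).aemeasurable]
        congr 1
        refine tsum_congr fun k => ?_
        rw [lintegral_tsum fun n => ((hm _ _).const_mul _).aemeasurable]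
        exact tsum_congr fun n => lintegral_const_mul _ (hm _ _)
    _ ≤ W ^ (q - 1) * ∑' k : ℤ, ∑' n : ℤ, w n * (C₂ * ∫⁻ x, ‖martDiff (k + n) f x‖ₑ ^ q) := by
        refine mul_le_mul_right (ENNReal.tsum_le_tsum fun k => ENNReal.tsum_le_tsum fun n => ?_) _
        calc w n ^ (1 - q) * ∫⁻ x, ‖avgDiff k (martDiff (k + n) f) x‖ₑ ^ q
            ≤ w n ^ (1 - q) * (C₂ * w n ^ q * ∫⁻ x, ‖martDiff (k + n) f x‖ₑ ^ q) := by
              gcongr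
              have := hC₂' f hfm hf (k + n) k
              rwa [add_sub_cancel_left, hwq] at this
          _ = (w n ^ (1 - q) * w n ^ q) * (C₂ * ∫⁻ x, ‖martDiff (k + n) f x‖ₑ ^ q) := by ring
          _ = _ := by rw [hww]
    _ = W ^ (q - 1) * (W * (C₂ * ∑' j : ℤ, ∫⁻ x, ‖martDiff j f x‖ₑ ^ q)) := by
        rw [ENNReal.tsum_comm]
        simp only [ENNReal.tsum_mul_left]
        congr 1
        rw [hW, ← ENNReal.tsum_mul_right]
        refine tsum_congr fun n => ?_
        congr 2
        exact (Equiv.addRight n).tsum_eq fun j => ∫⁻ x, ‖martDiff j f x‖ₑ ^ q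
    _ ≤ W ^ (q - 1) * (W * (C₂ * (C₁ * ∫⁻ x, ‖f x‖ₑ ^ q))) := by
        gcongr
        exact hC₁ f hfm hfq
    _ = _ := by ring

/-! ### Calderón–Zygmund cubes and the maximal function -/

lemma le_inv_mul_of_mul_le {a b t : ℝ≥0∞} (ht : t ≠ 0) (ht' : t ≠ ∞) (h : t * a ≤ b) :
    a ≤ t⁻¹ * b := by
  rw [mul_comm, ← div_eq_mul_inv, ENNReal.le_div_iff_mul_le (Or.inl ht) (Or.inl ht'), mul_comm]
  exact h

/-- The mean of a function with values in `[0, ∞]` over the dyadic cube of level `k` around `x`. -/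
def dyadicMean (k : ℤ) (u : 𝓔 → ℝ≥0∞) (x : 𝓔) : ℝ≥0∞ :=
  (volume (dyadicCube k x))⁻¹ * ∫⁻ y in dyadicCube k x, u y

lemma dyadicMean_eq_of_mem {k : ℤ} (u : 𝓔 → ℝ≥0∞) {x y : 𝓔} (h : y ∈ dyadicCube k x) :
    dyadicMean k u y = dyadicMean k u x := by
  rw [dyadicMean, dyadicMean, dyadicCube_eq_of_mem h]

lemma setLIntegral_eq_dyadicMean_mul (k : ℤ) (u : 𝓔 → ℝ≥0∞) (x : 𝓔) :
    ∫⁻ y in dyadicCube k x, u y = dyadicMean k u x * volume (dyadicCube k x) := by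
  rw [dyadicMean, mul_right_comm, ENNReal.inv_mul_cancel (volume_dyadicCube_pos k x)
    (volume_dyadicCube_ne_top k x), one_mul]

lemma setLIntegral_le_of_saturated {k : ℤ} {U : Set 𝓔} (hU : DyadicSaturated k U)
    {g h : 𝓔 → ℝ≥0∞}
    (H : ∀ x ∈ U, ∫⁻ y in dyadicCube k x, g y ≤ ∫⁻ y in dyadicCube k x, h y) :
    ∫⁻ y in U, g y ≤ ∫⁻ y in U, h y := by
  refine lintegral_le_of_forall_cube k fun x => ?_
  rw [Measure.restrict_restrict (measurableSet_dyadicCube k x)]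
  by_cases hx : x ∈ U
  · rw [Set.inter_eq_left.2 (hU x hx)]
    exact H x hx
  · rw [Set.disjoint_iff_inter_eq_empty.1 (Set.disjoint_left.2 (hU.compl x hx))]
    simp

/-- The union of the dyadic cubes of level `k` over which the mean of `u` exceeds `t`. -/
def largeMeanSet (u : 𝓔 → ℝ≥0∞) (t : ℝ≥0∞) (k : ℤ) : Set 𝓔 := {x | t < dyadicMean k u x}

lemma dyadicSaturated_largeMeanSet (u : 𝓔 → ℝ≥0∞) (t : ℝ≥0∞) (k : ℤ) :
    DyadicSaturated k (largeMeanSet u t k) := fun x hx y hy => by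
  rw [largeMeanSet, Set.mem_ofPred_eq, dyadicMean_eq_of_mem u hy]
  exact hx

/-- A sequence that tends to `0` at `+∞` exceeds a positive level at indices bounded above. -/
lemma bddAbove_of_lt_inv_zpow_mul (hd : 1 ≤ d) {a t : ℝ≥0∞} (ha : a ≠ ∞) (ht : t ≠ 0) :
    BddAbove {k : ℤ | t < (ENNReal.ofReal (((2 : ℝ) ^ k) ^ d))⁻¹ * a} := by
  have h := ENNReal.Tendsto.mul_const (tendsto_inv_zpow_pow hd) (Or.inr ha)
  rw [zero_mul] at h
  obtain ⟨N, hN⟩ := (h.eventually_lt_const ht.bot_lt).exists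
  refine ⟨N, fun k hk => ?_⟩
  by_contra hlt
  refine absurd (lt_trans hk (lt_of_le_of_lt ?_ hN)) (lt_irrefl _)
  gcongr
  · exact one_le_two
  · omega

lemma bddAbove_largeMeanSet (hd : 1 ≤ d) {u : 𝓔 → ℝ≥0∞} (hu : ∫⁻ x, u x ≠ ∞) {t : ℝ≥0∞}
    (ht : t ≠ 0) (x : 𝓔) : BddAbove {k | x ∈ largeMeanSet u t k} := by
  refine (bddAbove_of_lt_inv_zpow_mul hd hu ht).mono fun k (hk : t < dyadicMean k u x) => ?_
  refine lt_of_lt_of_le hk ?_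
  rw [dyadicMean, volume_dyadicCube]
  gcongr
  exact Measure.restrict_le_self

/-- The Calderón–Zygmund cubes of `u` at height `t`, collected by level: the union of the maximal
cubes of level `k` among all dyadic cubes over which the mean of `u` exceeds `t`. -/
def czLayer (u : 𝓔 → ℝ≥0∞) (t : ℝ≥0∞) (k : ℤ) : Set 𝓔 := lastLayer (largeMeanSet u t) k

lemma dyadicSaturated_czLayer (u : 𝓔 → ℝ≥0∞) (t : ℝ≥0∞) (k : ℤ) :
    DyadicSaturated k (czLayer u t k) :=
  dyadicSaturated_lastLayer (dyadicSaturated_largeMeanSet u t) k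

lemma exists_mem_czLayer (hd : 1 ≤ d) {u : 𝓔 → ℝ≥0∞} (hu : ∫⁻ x, u x ≠ ∞) {t : ℝ≥0∞}
    (ht : t ≠ 0) {k : ℤ} {x : 𝓔} (hx : t < dyadicMean k u x) : ∃ j ≥ k, x ∈ czLayer u t j := by
  have h : x ∈ ⋃ m, lastLayer (largeMeanSet u t) m := by
    rw [iUnion_lastLayer (bddAbove_largeMeanSet hd hu ht)]
    exact Set.mem_iUnion.2 ⟨k, hx⟩
  obtain ⟨j, hj⟩ := Set.mem_iUnion.1 h
  refine ⟨j, ?_, hj⟩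
  by_contra hlt
  exact hj.2 (Set.mem_biUnion (show k > j by omega) hx)

lemma mul_volume_czLayer_le (u : 𝓔 → ℝ≥0∞) (t : ℝ≥0∞) (k : ℤ) :
    t * volume (czLayer u t k) ≤ ∫⁻ x in czLayer u t k, u x := by
  rw [← setLIntegral_const]
  refine setLIntegral_le_of_saturated (dyadicSaturated_czLayer u t k) fun x hx => ?_
  rw [setLIntegral_const, setLIntegral_eq_dyadicMean_mul]
  gcongr
  exact le_of_lt hx.1

lemma tsum_setLIntegral_czLayer_le (u : 𝓔 → ℝ≥0∞) (t : ℝ≥0∞) :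
    ∑' k, ∫⁻ x in czLayer u t k, u x ≤ ∫⁻ x, u x := by
  rw [← lintegral_iUnion (fun k => (dyadicSaturated_czLayer u t k).measurableSet)
    (pairwise_disjoint_lastLayer _)]
  exact setLIntegral_le_lintegral _ _

/-- The neighbourhood of width `c * 2 ^ k` of a set. -/
def enlarge (c : ℝ) (k : ℤ) (U : Set 𝓔) : Set 𝓔 := {x | ∃ z ∈ U, ‖x - z‖ < c * 2 ^ k}

lemma isOpen_enlarge (c : ℝ) (k : ℤ) (U : Set 𝓔) : IsOpen (enlarge c k U) := by
  have : enlarge c k U = ⋃ z ∈ U, Metric.ball z (c * 2 ^ k) := by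
    ext x; simp [enlarge, dist_eq_norm]
  rw [this]
  exact isOpen_biUnion fun _ _ => Metric.isOpen_ball

lemma subset_enlarge {c : ℝ} (hc : 0 < c) (k : ℤ) (U : Set 𝓔) : U ⊆ enlarge c k U :=
  fun x hx => ⟨x, hx, by simpa using mul_pos hc (zpow_two_pos k)⟩

/-- The ratio of the volumes of a ball of radius `c` and of the unit cube. -/
def ballConst (d : ℕ) (c : ℝ) : ℝ≥0∞ :=
  ENNReal.ofReal (c ^ d) * volume (Metric.ball (0 : EuclideanSpace ℝ (Fin d)) 1)

lemma ballConst_ne_top (c : ℝ) : ballConst d c ≠ ∞ :=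
  ENNReal.mul_ne_top ENNReal.ofReal_ne_top (volume_ball_zero_ne_top 1)

lemma ballConst_ne_zero {c : ℝ} (hc : 0 < c) : ballConst d c ≠ 0 :=
  mul_ne_zero (by simpa using pow_pos hc d) (volume_ball_zero_pos one_pos)

lemma volume_ball_zpow {c : ℝ} (hc : 0 < c) (k : ℤ) (x : 𝓔) :
    volume (Metric.ball x (c * 2 ^ k)) = ballConst d c * ENNReal.ofReal (((2 : ℝ) ^ k) ^ d) := by
  have hk := zpow_two_pos k
  have h := volume_ball_mul (d := d) (R := 1) (mul_pos hc hk)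
  rw [mul_one] at h
  rw [volume_ball_eq, h, mul_pow, ENNReal.ofReal_mul (by positivity), ballConst]
  ring

/-- A saturated set and its enlargement have comparable volumes: the ball of radius `(c + d) * 2 ^ k`
around each point of the enlargement contains a whole cube of the set. -/
lemma volume_enlarge_le {c : ℝ} (hc : 0 < c) {k : ℤ} {U : Set 𝓔} (hU : DyadicSaturated k U) :
    volume (enlarge c k U) ≤ ballConst d (c + d) * volume U := by
  have hk := zpow_two_pos k
  set R := (c + d) * 2 ^ k with hR
  set v := ENNReal.ofReal (((2 : ℝ) ^ k) ^ d) with hv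
  have hv0 : v ≠ 0 := by simpa [hv] using pow_pos hk d
  have hpt : ∀ x, (enlarge c k U).indicator (fun _ => v) x
      ≤ ∫⁻ y in Metric.ball (0 : 𝓔) R, U.indicator 1 (x + y) := by
    intro x
    by_cases hx : x ∈ enlarge c k U
    · obtain ⟨z, hz, hxz⟩ := hx
      rw [Set.indicator_of_mem (show x ∈ enlarge c k U from ⟨z, hz, hxz⟩),
        ← setLIntegral_ball_eq_translate x R]
      calc v = volume (dyadicCube k z) := (volume_dyadicCube k z).symm
        _ ≤ volume (U ∩ Metric.ball x R) := by
            refine measure_mono fun w hw => ⟨hU z hz hw, ?_⟩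
            rw [mem_ball_iff_norm]
            have h1 := norm_sub_le_of_mem_dyadicCube hw
            have h2 : ‖w - x‖ ≤ ‖w - z‖ + ‖z - x‖ := norm_sub_le_norm_sub_add_norm_sub w z x
            rw [norm_sub_rev] at hxz
            rw [hR]
            linarith
        _ = _ := by
            rw [lintegral_indicator_one hU.measurableSet, Measure.restrict_apply hU.measurableSet]
    · rw [Set.indicator_of_notMem hx]
      exact zero_le
  have h := lintegral_mono (μ := volume) hpt
  rw [lintegral_indicator_const (isOpen_enlarge c k U).measurableSet,
    lintegral_lintegral_translate (measurable_one.indicator hU.measurableSet),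
    lintegral_indicator_one hU.measurableSet, hR, volume_ball_zpow (by positivity)] at h
  rw [← ENNReal.mul_le_mul_iff_right hv0 ENNReal.ofReal_ne_top]
  refine h.trans (le_of_eq ?_)
  ring

/-- The union of the enlarged Calderón–Zygmund cubes. -/
def czEnlarged (u : 𝓔 → ℝ≥0∞) (t : ℝ≥0∞) : Set 𝓔 := ⋃ k, enlarge (d + 1) k (czLayer u t k)

lemma measurableSet_czEnlarged (u : 𝓔 → ℝ≥0∞) (t : ℝ≥0∞) : MeasurableSet (czEnlarged u t) :=
  (isOpen_iUnion fun _ => isOpen_enlarge _ _ _).measurableSet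

lemma volume_czEnlarged_le (u : 𝓔 → ℝ≥0∞) {t : ℝ≥0∞} (ht : t ≠ 0) (ht' : t ≠ ∞) :
    volume (czEnlarged u t) ≤ ballConst d (d + 1 + d) * (t⁻¹ * ∫⁻ x, u x) := by
  calc volume (czEnlarged u t)
      ≤ ∑' k, volume (enlarge (d + 1) k (czLayer u t k)) := measure_iUnion_le _
    _ ≤ ∑' k, ballConst d (d + 1 + d) * (t⁻¹ * ∫⁻ x in czLayer u t k, u x) := by
        refine ENNReal.tsum_le_tsum fun k => ?_
        refine (volume_enlarge_le (by positivity) (dyadicSaturated_czLayer u t k)).trans ?_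
        gcongr
        exact le_inv_mul_of_mul_le ht ht' (mul_volume_czLayer_le u t k)
    _ ≤ _ := by
        rw [ENNReal.tsum_mul_left, ENNReal.tsum_mul_left]
        gcongr
        exact tsum_setLIntegral_czLayer_le u t

/-- The Hardy–Littlewood maximal function over the balls of radius `(d + 1) * 2 ^ k`, normalized by
the volume of a cube of side length `2 ^ k`. The factor `d + 1` makes the ball around each point of
a dyadic cube contain all that the operators at this scale and at finer scales see from the cube. -/
def maximalFun (u : 𝓔 → ℝ≥0∞) (x : 𝓔) : ℝ≥0∞ :=
  ⨆ k : ℤ, (ENNReal.ofReal (((2 : ℝ) ^ k) ^ d))⁻¹ * ∫⁻ z in Metric.ball x ((d + 1) * 2 ^ k), u z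

lemma measurable_setLIntegral_ball {u : 𝓔 → ℝ≥0∞} (hu : Measurable u) (R : ℝ) :
    Measurable fun x : 𝓔 => ∫⁻ z in Metric.ball x R, u z := by
  simp_rw [fun x => setLIntegral_ball_eq_translate x R u]
  exact Measurable.lintegral_prod_right' (f := fun p : 𝓔 × 𝓔 => u (p.1 + p.2))
    (hu.comp (measurable_fst.add measurable_snd))

lemma measurable_maximalFun {u : 𝓔 → ℝ≥0∞} (hu : Measurable u) : Measurable (maximalFun u) :=
  Measurable.iSup fun _ => (measurable_setLIntegral_ball hu _).const_mul _

lemma setLIntegral_ball_le_maximalFun (u : 𝓔 → ℝ≥0∞) (k : ℤ) (x : 𝓔) :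
    ∫⁻ z in Metric.ball x ((d + 1) * 2 ^ k), u z
      ≤ ENNReal.ofReal (((2 : ℝ) ^ k) ^ d) * maximalFun u x := by
  have h0 : ENNReal.ofReal (((2 : ℝ) ^ k) ^ d) ≠ 0 := by simpa using pow_pos (zpow_two_pos k) d
  rw [← ENNReal.inv_mul_le_iff h0 ENNReal.ofReal_ne_top]
  exact le_iSup (fun k : ℤ => (ENNReal.ofReal (((2 : ℝ) ^ k) ^ d))⁻¹ *
    ∫⁻ z in Metric.ball x ((d + 1) * 2 ^ k), u z) k

lemma maximalFun_le_of_bound {u : 𝓔 → ℝ≥0∞} {M : ℝ≥0∞} (hM : ∀ᵐ z, u z ≤ M) (x : 𝓔) :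
    maximalFun u x ≤ ballConst d (d + 1) * M := by
  refine iSup_le fun k => ?_
  have h0 : ENNReal.ofReal (((2 : ℝ) ^ k) ^ d) ≠ 0 := by simpa using pow_pos (zpow_two_pos k) d
  rw [ENNReal.inv_mul_le_iff h0 ENNReal.ofReal_ne_top]
  refine (lintegral_mono_ae (ae_restrict_of_ae hM)).trans (le_of_eq ?_)
  rw [setLIntegral_const, volume_ball_zpow (by positivity)]
  ring

/-- The weak type `(1, 1)` inequality: outside the enlarged Calderón–Zygmund cubes at height `t`,
each ball in the definition of the maximal function is covered by dyadic cubes of the same scale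
with mean at most `t`. -/
lemma volume_lt_maximalFun_le (hd : 1 ≤ d) (u : 𝓔 → ℝ≥0∞) {t : ℝ≥0∞} (ht : t ≠ 0) (ht' : t ≠ ∞) :
    volume {x | ballConst d (d + 1 + d) * t < maximalFun u x}
      ≤ ballConst d (d + 1 + d) * (t⁻¹ * ∫⁻ x, u x) := by
  by_cases hu : ∫⁻ x, u x = ∞
  · rw [hu, ENNReal.mul_top (by simpa using ht'), ENNReal.mul_top
      (ballConst_ne_zero (by positivity))]
    exact le_top
  refine (measure_mono fun x hx => ?_).trans (volume_czEnlarged_le u ht ht')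
  by_contra hxn
  refine absurd (show _ < maximalFun u x from hx) (not_lt.2 (iSup_le fun k => ?_))
  have h0 : ENNReal.ofReal (((2 : ℝ) ^ k) ^ d) ≠ 0 := by simpa using pow_pos (zpow_two_pos k) d
  rw [ENNReal.inv_mul_le_iff h0 ENNReal.ofReal_ne_top]
  have hk := zpow_two_pos k
  set R : ℝ := (d + 1) * 2 ^ k with hR
  -- The union of the dyadic cubes of level `k` that meet the ball.
  set W : Set 𝓔 := {z | ∃ w ∈ dyadicCube k z, w ∈ Metric.ball x R} with hW
  have hWsat : DyadicSaturated k W := by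
    rintro z ⟨w, hw, hwx⟩ y hy
    exact ⟨w, by rwa [dyadicCube_eq_of_mem hy], hwx⟩
  have hsub : Metric.ball x R ⊆ W := fun z hz => ⟨z, mem_dyadicCube_self k z, hz⟩
  have hsub' : W ⊆ Metric.ball x ((d + 1 + d) * 2 ^ k) := by
    rintro z ⟨w, hw, hwx⟩
    rw [mem_ball_iff_norm] at hwx ⊢
    have h1 := norm_sub_le_of_mem_dyadicCube hw
    rw [norm_sub_rev] at h1
    have h2 : ‖z - x‖ ≤ ‖z - w‖ + ‖w - x‖ := norm_sub_le_norm_sub_add_norm_sub z w x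
    rw [hR] at hwx
    linarith
  have hmean : ∀ z ∈ W, dyadicMean k u z ≤ t := by
    rintro z ⟨w, hw, hwx⟩
    rw [← dyadicMean_eq_of_mem u hw]
    by_contra hlt
    obtain ⟨j, hjk, hj⟩ := exists_mem_czLayer hd hu ht (not_le.1 hlt)
    refine hxn (Set.mem_iUnion.2 ⟨j, w, hj, ?_⟩)
    rw [mem_ball_iff_norm, norm_sub_rev] at hwx
    refine hwx.trans_le ?_
    rw [hR]
    gcongr
    exact one_le_two
  calc ∫⁻ z in Metric.ball x R, u z ≤ ∫⁻ z in W, u z := lintegral_mono_set hsub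
    _ ≤ ∫⁻ _z in W, t := by
        refine setLIntegral_le_of_saturated hWsat fun z hz => ?_
        rw [setLIntegral_const, setLIntegral_eq_dyadicMean_mul]
        gcongr
        exact hmean z hz
    _ = t * volume W := setLIntegral_const _ _
    _ ≤ t * volume (Metric.ball x ((d + 1 + d) * 2 ^ k)) := by gcongr
    _ = _ := by rw [volume_ball_zpow (by positivity)]; ring

lemma maximalFun_add_le {u v : 𝓔 → ℝ≥0∞} (hu : Measurable u) (x : 𝓔) :
    maximalFun (fun z => u z + v z) x ≤ maximalFun u x + maximalFun v x := by
  refine iSup_le fun k => ?_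
  rw [lintegral_add_left hu, mul_add]
  exact add_le_add (le_iSup (fun k : ℤ => (ENNReal.ofReal (((2 : ℝ) ^ k) ^ d))⁻¹ *
    ∫⁻ z in Metric.ball x ((d + 1) * 2 ^ k), u z) k)
    (le_iSup (fun k : ℤ => (ENNReal.ofReal (((2 : ℝ) ^ k) ^ d))⁻¹ *
    ∫⁻ z in Metric.ball x ((d + 1) * 2 ^ k), v z) k)

/-- The Hardy–Littlewood maximal theorem, by splitting `u` at a height proportional to the level. -/
lemma exists_lintegral_maximalFun_rpow_le (hd : 1 ≤ d) {s : ℝ} (hs : 1 < s) :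
    ∃ C : ℝ≥0∞, C ≠ ∞ ∧ ∀ u : 𝓔 → ℝ≥0∞, Measurable u →
      ∫⁻ x, maximalFun u x ^ s ≤ C * ∫⁻ x, u x ^ s := by
  have hs0 : 0 < s := by linarith
  obtain ⟨C, hC, hC'⟩ := exists_tsum_lintegral_le (volume : Measure 𝓔) (a := s - 1) (by linarith)
  set C₀ := ballConst d (d + 1 + d) with hC₀
  set C₁ := ballConst d (d + 1) with hC₁
  have h00 : C₀ ≠ 0 := ballConst_ne_zero (by positivity)
  have h01 : C₀ ≠ ∞ := ballConst_ne_top _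
  have h10 : C₁ ≠ 0 := ballConst_ne_zero (by positivity)
  have h11 : C₁ ≠ ∞ := ballConst_ne_top _
  have h3 : ∀ n : ℤ, (3 : ℝ≥0∞) ^ n ≠ 0 := fun n =>
    (ENNReal.zpow_pos (by norm_num) (by norm_num) n).ne'
  have h3' : ∀ n : ℤ, (3 : ℝ≥0∞) ^ n ≠ ∞ := fun n =>
    (ENNReal.zpow_lt_top (by norm_num) (by norm_num) n).ne
  have h20 : 2 * C₁ ≠ 0 := mul_ne_zero (by norm_num) h10
  have h21 : 2 * C₁ ≠ ∞ := ENNReal.mul_ne_top (by norm_num) h11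
  refine ⟨3 ^ s * (2 * C₀ * C₀) * (C * (2 * C₁) ^ (s - 1)), ?_, fun u hu => ?_⟩
  · exact ENNReal.mul_ne_top (ENNReal.mul_ne_top (ENNReal.rpow_ne_top_of_nonneg hs0.le (by norm_num))
      (ENNReal.mul_ne_top (ENNReal.mul_ne_top (by norm_num) h01) h01))
      (ENNReal.mul_ne_top hC (ENNReal.rpow_ne_top_of_nonneg (by linarith) h21))
  have hlevel : ∀ n : ℤ, volume {x | (3 : ℝ≥0∞) ^ n < maximalFun u x}
      ≤ 2 * C₀ * C₀ * (((3 : ℝ≥0∞) ^ n)⁻¹ * ∫⁻ x in {x | (3 : ℝ≥0∞) ^ n < 2 * C₁ * u x}, u x) := by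
    intro n
    set S := {x | (3 : ℝ≥0∞) ^ n < 2 * C₁ * u x} with hS
    have hSm : MeasurableSet S := measurableSet_lt measurable_const (hu.const_mul _)
    set t := (2 * C₀)⁻¹ * (3 : ℝ≥0∞) ^ n with ht
    have h2C : 2 * C₀ ≠ 0 := mul_ne_zero (by norm_num) h00
    have h2C' : 2 * C₀ ≠ ∞ := ENNReal.mul_ne_top (by norm_num) h01
    have hCt : C₀ * t = (3 : ℝ≥0∞) ^ n / 2 := by
      rw [ht, ENNReal.mul_inv (Or.inl (by norm_num)) (Or.inl (by norm_num)), ← mul_assoc,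
        mul_left_comm, ENNReal.mul_inv_cancel h00 h01, mul_one, mul_comm, div_eq_mul_inv]
    -- Where `u ≤ 3 ^ n / (2 * C₁)` it contributes at most `3 ^ n / 2` to the maximal function.
    have hsub : {x | (3 : ℝ≥0∞) ^ n < maximalFun u x}
        ⊆ {x | C₀ * t < maximalFun (S.indicator u) x} := by
      intro x (hx : (3 : ℝ≥0∞) ^ n < maximalFun u x)
      by_contra hlt
      refine absurd hx (not_lt.2 ?_)
      have e : u = fun z => S.indicator u z + Sᶜ.indicator u z := by
        funext z; exact (Set.indicator_self_add_compl_apply S u z).symm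
      have hb : ∀ᵐ z, Sᶜ.indicator u z ≤ (2 * C₁)⁻¹ * (3 : ℝ≥0∞) ^ n := by
        refine Filter.Eventually.of_forall fun z => ?_
        by_cases hz : z ∈ S
        · rw [Set.indicator_of_notMem (by simpa using hz)]; exact zero_le
        · rw [Set.indicator_of_mem (by simpa using hz)]
          exact le_inv_mul_of_mul_le h20 h21 (not_lt.1 hz)
      calc maximalFun u x ≤ maximalFun (S.indicator u) x + maximalFun (Sᶜ.indicator u) x := by
            conv_lhs => rw [e]
            exact maximalFun_add_le (hu.indicator hSm) x
        _ ≤ C₀ * t + C₁ * ((2 * C₁)⁻¹ * (3 : ℝ≥0∞) ^ n) :=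
            add_le_add (not_lt.1 hlt) (maximalFun_le_of_bound hb x)
        _ = (3 : ℝ≥0∞) ^ n / 2 + (3 : ℝ≥0∞) ^ n / 2 := by
            rw [hCt, ENNReal.mul_inv (Or.inl (by norm_num)) (Or.inl (by norm_num)), ← mul_assoc,
              mul_left_comm, ENNReal.mul_inv_cancel h10 h11, mul_one, mul_comm 2⁻¹,
              div_eq_mul_inv]
        _ = (3 : ℝ≥0∞) ^ n := ENNReal.add_halves _
    refine (measure_mono hsub).trans ((volume_lt_maximalFun_le hd _
      (mul_ne_zero (by simpa using h2C') (h3 n))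
      (ENNReal.mul_ne_top (by simpa using h2C) (h3' n))).trans (le_of_eq ?_))
    rw [lintegral_indicator hSm, ENNReal.mul_inv (Or.inl (by simpa using h2C'))
      (Or.inl (by simpa using h2C)), inv_inv]
    ring
  calc ∫⁻ x, maximalFun u x ^ s
      ≤ ∑' n : ℤ, ((3 : ℝ≥0∞) ^ (n + 1)) ^ s * volume {x | (3 : ℝ≥0∞) ^ n < maximalFun u x} :=
        lintegral_rpow_le_tsum_measure _ hs0 (measurable_maximalFun hu)
    _ ≤ ∑' n : ℤ, 3 ^ s * (2 * C₀ * C₀) * (((3 : ℝ≥0∞) ^ n) ^ (s - 1) *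
          ∫⁻ x in {x | (3 : ℝ≥0∞) ^ n < 2 * C₁ * u x}, u x) := by
        refine ENNReal.tsum_le_tsum fun n => (mul_le_mul_right (hlevel n) _).trans (le_of_eq ?_)
        rw [ENNReal.zpow_add (by norm_num) (by norm_num), zpow_one,
          ENNReal.mul_rpow_of_nonneg _ _ hs0.le, ENNReal.rpow_sub _ _ (h3 n) (h3' n),
          ENNReal.rpow_one, div_eq_mul_inv]
        ring
    _ ≤ 3 ^ s * (2 * C₀ * C₀) * (C * ∫⁻ x, (2 * C₁ * u x) ^ (s - 1) * u x) := by
        rw [ENNReal.tsum_mul_left]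
        gcongr
        exact hC' (fun x => 2 * C₁ * u x) u (hu.const_mul _) hu
    _ = _ := by
        have e : ∀ x, (2 * C₁ * u x) ^ (s - 1) * u x = (2 * C₁) ^ (s - 1) * u x ^ s := by
          intro x
          rw [ENNReal.mul_rpow_of_nonneg _ _ (by linarith), mul_assoc]
          congr 1
          conv_rhs => rw [show s = (s - 1) + 1 by ring]
          rw [ENNReal.rpow_add_of_nonneg _ _ (by linarith) zero_le_one, ENNReal.rpow_one]
        simp only [e]
        rw [lintegral_const_mul _ (hu.pow_const s)]
        ring

/-! ### The weak type `(1, 1)` inequality -/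

lemma ballAverage_congr_ae {f g : 𝓔 → B} (h : f =ᵐ[volume] g) (t : ℝ) (x : 𝓔) :
    ballAverage t f x = ballAverage t g x := by
  rw [ballAverage_eq, ballAverage_eq, setIntegral_congr_ae measurableSet_ball
    (h.mono fun _ hx _ => hx)]

lemma dyadicCondExp_congr_ae {f g : 𝓔 → B} (h : f =ᵐ[volume] g) (k : ℤ) (x : 𝓔) :
    dyadicCondExp k f x = dyadicCondExp k g x := by
  rw [dyadicCondExp_eq, dyadicCondExp_eq, setIntegral_congr_ae (measurableSet_dyadicCube k x)
    (h.mono fun _ hx _ => hx)]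

lemma longVariation_congr_ae {q : ℝ} {f g : 𝓔 → B} (h : f =ᵐ[volume] g) :
    longVariation q f = longVariation q g := by
  funext x
  simp only [longVariation_eq_seqNorm, avgDiff, ballAverage_congr_ae h, dyadicCondExp_congr_ae h]

/-- The `L^q` estimate for essentially bounded functions. -/
lemma exists_lintegral_longVariation_rpow_le_of_ae_bound [CompleteSpace B] (hd : 1 ≤ d) {q : ℝ}
    (hq : 1 ≤ q) (hB : HasMartingaleCotype B q) :
    ∃ C : ℝ≥0∞, C ≠ ∞ ∧ ∀ f : 𝓔 → B, StronglyMeasurable f → Integrable f →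
      (∃ M : ℝ≥0, ∀ᵐ z, ‖f z‖ₑ ≤ M) →
      ∫⁻ x, longVariation q f x ^ q ≤ C * ∫⁻ x, ‖f x‖ₑ ^ q := by
  obtain ⟨C, hC, h⟩ := exists_lintegral_longVariation_rpow_le (d := d) hd hq hB
  refine ⟨C, hC, fun f hfm hf ⟨M, hM⟩ => ?_⟩
  have hS : MeasurableSet {z | ‖f z‖ₑ ≤ M} := measurableSet_le hfm.enorm measurable_const
  have hfg : f =ᵐ[volume] {z | ‖f z‖ₑ ≤ M}.indicator f := by
    filter_upwards [hM] with z hz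
    rw [Set.indicator_of_mem (show z ∈ {z | ‖f z‖ₑ ≤ M} from hz)]
  have := h _ (hfm.indicator hS) (hf.congr hfg) ⟨M, fun z => by
    by_cases hz : ‖f z‖ₑ ≤ M
    · rwa [Set.indicator_of_mem (show z ∈ {z | ‖f z‖ₑ ≤ M} from hz)]
    · rw [Set.indicator_of_notMem (show z ∉ {z | ‖f z‖ₑ ≤ M} from hz)]; simp⟩
  rw [← longVariation_congr_ae hfg] at this
  refine this.trans (le_of_eq ?_)
  congr 1
  refine lintegral_congr_ae ?_
  filter_upwards [hfg] with z hz
  rw [← hz]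

/-- The part of the bad function of the Calderón–Zygmund decomposition of `f` at height `t` that
lives on the maximal cubes of level `m`. -/
def czBadPart (t : ℝ≥0∞) (f : 𝓔 → B) (m : ℤ) : 𝓔 → B :=
  (czLayer (fun z => ‖f z‖ₑ) t m).indicator fun z => f z - dyadicCondExp m f z

/-- The bad function of the Calderón–Zygmund decomposition of `f` at height `t`. At each point at
most one term of the sum is not zero. -/
def czBad (t : ℝ≥0∞) (f : 𝓔 → B) (x : 𝓔) : B := ∑' m : ℤ, czBadPart t f m x

lemma stronglyMeasurable_czBadPart (t : ℝ≥0∞) {f : 𝓔 → B} (hf : StronglyMeasurable f) (m : ℤ) :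
    StronglyMeasurable (czBadPart t f m) :=
  (hf.sub (stronglyMeasurable_dyadicCondExp m f)).indicator
    (dyadicSaturated_czLayer _ t m).measurableSet

lemma hasSum_czBadPart (t : ℝ≥0∞) (f : 𝓔 → B) {m : ℤ} {x : 𝓔}
    (hx : x ∈ czLayer (fun z => ‖f z‖ₑ) t m) :
    HasSum (fun j => czBadPart t f j x) (f x - dyadicCondExp m f x) := by
  have e : czBadPart t f m x = f x - dyadicCondExp m f x := Set.indicator_of_mem hx _
  rw [← e]
  refine hasSum_single m fun j hj => Set.indicator_of_notMem (fun hxj => ?_) _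
  exact Set.disjoint_left.1 (pairwise_disjoint_lastLayer _ hj) hxj hx

lemma czBad_eq (t : ℝ≥0∞) (f : 𝓔 → B) {m : ℤ} {x : 𝓔}
    (hx : x ∈ czLayer (fun z => ‖f z‖ₑ) t m) : czBad t f x = f x - dyadicCondExp m f x :=
  (hasSum_czBadPart t f hx).tsum_eq

lemma czBad_eq_zero (t : ℝ≥0∞) (f : 𝓔 → B) {x : 𝓔}
    (hx : ∀ m, x ∉ czLayer (fun z => ‖f z‖ₑ) t m) : czBad t f x = 0 := by
  rw [czBad]
  exact (tsum_congr fun m => Set.indicator_of_notMem (hx m) _).trans tsum_zero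

lemma stronglyMeasurable_czBad (t : ℝ≥0∞) {f : 𝓔 → B} (hf : StronglyMeasurable f) :
    StronglyMeasurable (czBad t f) := by
  refine stronglyMeasurable_of_tendsto (u := Filter.atTop)
    (f := fun (S : Finset ℤ) x => ∑ m ∈ S, czBadPart t f m x)
    (fun S => Finset.stronglyMeasurable_fun_sum S fun m _ => stronglyMeasurable_czBadPart t hf m) ?_
  refine tendsto_pi_nhds.2 fun x => ?_
  have hs : Summable fun m => czBadPart t f m x := by
    by_cases hx : ∃ m, x ∈ czLayer (fun z => ‖f z‖ₑ) t m
    · exact (hasSum_czBadPart t f hx.choose_spec).summable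
    · have : (fun m => czBadPart t f m x) = 0 := by
        funext m; exact Set.indicator_of_notMem (fun h => hx ⟨m, h⟩) _
      rw [this]; exact summable_zero
  exact hs.hasSum

lemma lintegral_czBadPart_le (t : ℝ≥0∞) {f : 𝓔 → B} (hf : StronglyMeasurable f) (m : ℤ) :
    ∫⁻ x, ‖czBadPart t f m x‖ₑ ≤ 2 * ∫⁻ x in czLayer (fun z => ‖f z‖ₑ) t m, ‖f x‖ₑ := by
  have hsat := dyadicSaturated_czLayer (fun z => ‖f z‖ₑ) t m
  have e : ∀ x, ‖czBadPart t f m x‖ₑ = (czLayer (fun z => ‖f z‖ₑ) t m).indicator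
      (fun z => ‖f z - dyadicCondExp m f z‖ₑ) x := fun x => by
    by_cases hx : x ∈ czLayer (fun z => ‖f z‖ₑ) t m <;> simp [czBadPart, hx]
  simp only [e]
  rw [lintegral_indicator hsat.measurableSet]
  calc ∫⁻ x in czLayer (fun z => ‖f z‖ₑ) t m, ‖f x - dyadicCondExp m f x‖ₑ
      ≤ ∫⁻ x in czLayer (fun z => ‖f z‖ₑ) t m, (‖f x‖ₑ + ‖dyadicCondExp m f x‖ₑ) :=
        lintegral_mono fun x => enorm_sub_le
    _ ≤ _ := by
        rw [lintegral_add_left hf.enorm, two_mul]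
        exact add_le_add le_rfl (setLIntegral_condExp_le hf hsat)

lemma tsum_lintegral_czBadPart_le (t : ℝ≥0∞) {f : 𝓔 → B} (hf : StronglyMeasurable f) :
    ∑' m, ∫⁻ x, ‖czBadPart t f m x‖ₑ ≤ 2 * ∫⁻ x, ‖f x‖ₑ := by
  calc _ ≤ ∑' m, 2 * ∫⁻ x in czLayer (fun z => ‖f z‖ₑ) t m, ‖f x‖ₑ :=
        ENNReal.tsum_le_tsum fun m => lintegral_czBadPart_le t hf m
    _ ≤ _ := by
        rw [ENNReal.tsum_mul_left]
        gcongr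
        exact tsum_setLIntegral_czLayer_le _ t

lemma enorm_czBad_le (t : ℝ≥0∞) (f : 𝓔 → B) (x : 𝓔) :
    ‖czBad t f x‖ₑ ≤ ∑' m, ‖czBadPart t f m x‖ₑ := enorm_tsum_le_tsum_enorm

lemma lintegral_czBad_le (t : ℝ≥0∞) {f : 𝓔 → B} (hf : StronglyMeasurable f) :
    ∫⁻ x, ‖czBad t f x‖ₑ ≤ 2 * ∫⁻ x, ‖f x‖ₑ := by
  calc ∫⁻ x, ‖czBad t f x‖ₑ ≤ ∫⁻ x, ∑' m, ‖czBadPart t f m x‖ₑ :=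
        lintegral_mono fun x => enorm_czBad_le t f x
    _ = ∑' m, ∫⁻ x, ‖czBadPart t f m x‖ₑ :=
        lintegral_tsum fun m => (stronglyMeasurable_czBadPart t hf m).enorm.aemeasurable
    _ ≤ _ := tsum_lintegral_czBadPart_le t hf

lemma integrable_czBad (t : ℝ≥0∞) {f : 𝓔 → B} (hfm : StronglyMeasurable f) (hf : Integrable f) :
    Integrable (czBad t f) :=
  ⟨(stronglyMeasurable_czBad t hfm).aestronglyMeasurable,
    (lintegral_czBad_le t hfm).trans_lt (ENNReal.mul_lt_top (by norm_num) hf.2)⟩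

lemma integrable_czBadPart (t : ℝ≥0∞) {f : 𝓔 → B} (hfm : StronglyMeasurable f)
    (hf : Integrable f) (m : ℤ) : Integrable (czBadPart t f m) :=
  (hf.sub (integrable_condExp m hfm hf)).indicator (dyadicSaturated_czLayer _ t m).measurableSet

lemma enorm_setIntegral_czBad_le (t : ℝ≥0∞) {f : 𝓔 → B} (hfm : StronglyMeasurable f)
    (hf : Integrable f) (S : Set 𝓔) :
    ‖∫ x in S, czBad t f x‖ₑ ≤ ∑' m, ‖∫ x in S, czBadPart t f m x‖ₑ := by
  have h : ∫ x in S, czBad t f x = ∑' m, ∫ x in S, czBadPart t f m x := by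
    refine integral_tsum (fun m => (stronglyMeasurable_czBadPart t hfm m).aestronglyMeasurable) ?_
    refine ne_top_of_le_ne_top (ENNReal.mul_ne_top (by norm_num) hf.2.ne)
      ((ENNReal.tsum_le_tsum fun m => ?_).trans (tsum_lintegral_czBadPart_le t hfm))
    exact setLIntegral_le_lintegral _ _
  rw [h]
  exact enorm_tsum_le_tsum_enorm

/-- The bad function at level `m` has mean zero over every dyadic cube that is not strictly inside
a maximal cube. -/
lemma setIntegral_czBadPart_eq_zero [CompleteSpace B] (t : ℝ≥0∞) {f : 𝓔 → B}
    (hfm : StronglyMeasurable f) (hf : Integrable f) {m k : ℤ} {x : 𝓔}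
    (h : m ≤ k ∨ x ∉ czLayer (fun z => ‖f z‖ₑ) t m) :
    ∫ y in dyadicCube k x, czBadPart t f m y = 0 := by
  have hsat := dyadicSaturated_czLayer (fun z => ‖f z‖ₑ) t m
  unfold czBadPart
  rw [setIntegral_indicator hsat.measurableSet]
  by_cases hmk : m ≤ k
  · exact setIntegral_sub_condExp hfm (((dyadicSaturated_dyadicCube k x).mono hmk).inter hsat)
      hf.integrableOn
  · have hd : dyadicCube k x ∩ czLayer (fun z => ‖f z‖ₑ) t m = ∅ :=
      Set.disjoint_iff_inter_eq_empty.1 (Set.disjoint_left.2 fun y hy =>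
        hsat.compl x (h.resolve_left hmk) (dyadicCube_subset (by omega) x hy))
    rw [hd, Measure.restrict_empty, integral_zero_measure]

lemma subset_czEnlarged (u : 𝓔 → ℝ≥0∞) (t : ℝ≥0∞) (m : ℤ) : czLayer u t m ⊆ czEnlarged u t :=
  (subset_enlarge (by positivity) m _).trans
    (Set.subset_iUnion (fun k => enlarge (d + 1) k (czLayer u t k)) m)

/-- Outside the enlarged cubes, the dyadic means of the bad function vanish and its averages over
balls of radius `2 ^ k` only see the maximal cubes of level at most `k`. -/
lemma enorm_avgDiff_czBad_le [CompleteSpace B] (t : ℝ≥0∞) {f : 𝓔 → B}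
    (hfm : StronglyMeasurable f) (hf : Integrable f) {x : 𝓔}
    (hx : x ∉ czEnlarged (fun z => ‖f z‖ₑ) t) (k : ℤ) :
    ‖avgDiff k (czBad t f) x‖ₑ
      ≤ ∑' n : ℕ, ‖ballAverage (2 ^ k) (czBadPart t f (k - n)) x‖ₑ := by
  have hE : dyadicCondExp k (czBad t f) x = 0 := by
    have h0 : ‖∫ y in dyadicCube k x, czBad t f y‖ₑ ≤ 0 := by
      refine (enorm_setIntegral_czBad_le t hfm hf _).trans (le_of_eq ?_)
      simp only [ENNReal.tsum_eq_zero, enorm_eq_zero]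
      exact fun m => setIntegral_czBadPart_eq_zero t hfm hf
        (Or.inr fun hm => hx (subset_czEnlarged _ t m hm))
    rw [dyadicCondExp_eq, enorm_eq_zero.1 (le_antisymm h0 zero_le), smul_zero]
  have hR := zpow_two_pos k
  have hfar : ∀ m, k < m → ∫ y in Metric.ball x (2 ^ k), czBadPart t f m y = 0 := by
    intro m hkm
    refine (setIntegral_congr_fun measurableSet_ball fun y hy => ?_).trans
      (integral_zero _ _)
    refine Set.indicator_of_notMem (fun hym => hx ?_) _
    refine Set.mem_iUnion.2 ⟨m, y, hym, ?_⟩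
    rw [mem_ball_iff_norm, norm_sub_rev] at hy
    have h1 : (2 : ℝ) ^ k ≤ 2 ^ m := zpow_le_zpow_right₀ one_le_two hkm.le
    have h2 : 0 ≤ (d : ℝ) * 2 ^ m := by positivity
    linarith
  rw [avgDiff, hE, sub_zero, enorm_ballAverage hR]
  calc (volume (Metric.ball (0 : 𝓔) (2 ^ k)))⁻¹ * ‖∫ z in Metric.ball x (2 ^ k), czBad t f z‖ₑ
      ≤ (volume (Metric.ball (0 : 𝓔) (2 ^ k)))⁻¹ *
          ∑' m, ‖∫ z in Metric.ball x (2 ^ k), czBadPart t f m z‖ₑ := by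
        gcongr
        exact enorm_setIntegral_czBad_le t hfm hf _
    _ = ∑' m, (Set.Iic k).indicator (fun m => ‖ballAverage (2 ^ k) (czBadPart t f m) x‖ₑ) m := by
        rw [← ENNReal.tsum_mul_left]
        refine tsum_congr fun m => ?_
        by_cases hm : m ≤ k
        · rw [Set.indicator_of_mem (show m ∈ Set.Iic k from hm), enorm_ballAverage hR]
        · rw [Set.indicator_of_notMem (show m ∉ Set.Iic k from hm), hfar m (not_le.1 hm),
            enorm_zero, mul_zero]
    _ = _ := tsum_indicator_Iic k _

/-- Off the enlarged cubes the bad function is treated in `L^1`, with the `ℓ^q` norm over the scales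
replaced by the `ℓ^1` norm. -/
lemma setLIntegral_longVariation_czBad_le [CompleteSpace B] (hd : 1 ≤ d) {q : ℝ} (hq : 1 ≤ q)
    (t : ℝ≥0∞) {f : 𝓔 → B} (hfm : StronglyMeasurable f) (hf : Integrable f) :
    ∫⁻ x in (czEnlarged (fun z => ‖f z‖ₑ) t)ᶜ, longVariation q (czBad t f) x
      ≤ ENNReal.ofReal (4 * d * d) * ∫⁻ x, ‖f x‖ₑ := by
  have hm : ∀ (k : ℤ) (n : ℕ), Measurable fun x => ‖ballAverage (2 ^ k) (czBadPart t f (k - n)) x‖ₑ :=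
    fun k n => (stronglyMeasurable_ballAverage _ (stronglyMeasurable_czBadPart t hfm _)).enorm
  have hgeom : ∑' n : ℕ, ENNReal.ofReal (d * d * (1 / 2) ^ n) = ENNReal.ofReal (2 * d * d) := by
    rw [← ENNReal.ofReal_tsum_of_nonneg (fun n => by positivity)
      (summable_geometric_two.mul_left _), tsum_mul_left, tsum_geometric_two]
    congr 1; ring
  calc ∫⁻ x in (czEnlarged (fun z => ‖f z‖ₑ) t)ᶜ, longVariation q (czBad t f) x
      ≤ ∫⁻ x in (czEnlarged (fun z => ‖f z‖ₑ) t)ᶜ,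
          ∑' k : ℤ, ∑' n : ℕ, ‖ballAverage (2 ^ k) (czBadPart t f (k - n)) x‖ₑ := by
        refine setLIntegral_mono' (measurableSet_czEnlarged _ t).compl fun x hx => ?_
        rw [longVariation_eq_seqNorm]
        exact (seqNorm_le_tsum hq _).trans
          (ENNReal.tsum_le_tsum fun k => enorm_avgDiff_czBad_le t hfm hf hx k)
    _ ≤ ∫⁻ x, ∑' k : ℤ, ∑' n : ℕ, ‖ballAverage (2 ^ k) (czBadPart t f (k - n)) x‖ₑ :=
        setLIntegral_le_lintegral _ _
    _ = ∑' k : ℤ, ∑' n : ℕ, ∫⁻ x, ‖ballAverage (2 ^ k) (czBadPart t f (k - n)) x‖ₑ := by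
        rw [lintegral_tsum fun k => (Measurable.tsum fun n => hm k n).aemeasurable]
        exact tsum_congr fun k => lintegral_tsum fun n => (hm k n).aemeasurable
    _ ≤ ∑' k : ℤ, ∑' n : ℕ, ENNReal.ofReal (d * d * (1 / 2) ^ n)
          * ∫⁻ x, ‖czBadPart t f (k - n) x‖ₑ := by
        refine ENNReal.tsum_le_tsum fun k => ENNReal.tsum_le_tsum fun n => ?_
        have h := lintegral_ballAverage_rpow_le_of_mean_zero hd le_rfl (k - n) k
          (stronglyMeasurable_czBadPart t hfm (k - n)) (integrable_czBadPart t hfm hf _)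
          (fun z => setIntegral_czBadPart_eq_zero t hfm hf (Or.inl le_rfl))
        have e : (2 : ℝ) ^ (k - (n : ℤ) - k) = (1 / 2) ^ n := by
          rw [show k - (n : ℤ) - k = -n by ring, zpow_neg, zpow_natCast, one_div, inv_pow]
        simpa only [ENNReal.rpow_one, e] using h
    _ = ENNReal.ofReal (2 * d * d) * ∑' m : ℤ, ∫⁻ x, ‖czBadPart t f m x‖ₑ := by
        rw [ENNReal.tsum_comm, ← hgeom, ← ENNReal.tsum_mul_right]
        refine tsum_congr fun n => ?_
        rw [ENNReal.tsum_mul_left]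
        congr 1
        exact (Equiv.subRight (n : ℤ)).tsum_eq fun m => ∫⁻ x, ‖czBadPart t f m x‖ₑ
    _ ≤ ENNReal.ofReal (2 * d * d) * (2 * ∫⁻ x, ‖f x‖ₑ) := by
        gcongr
        exact tsum_lintegral_czBadPart_le t hfm
    _ = _ := by
        have e : ENNReal.ofReal (4 * d * d) = ENNReal.ofReal (2 * d * d) * 2 := by
          rw [show (4 * d * d : ℝ) = 2 * d * d * 2 by ring, ENNReal.ofReal_mul (by positivity),
            ENNReal.ofReal_ofNat]
        rw [e, mul_assoc (ENNReal.ofReal (2 * d * d))]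

/-- The good function of the Calderón–Zygmund decomposition at height `t` is bounded by `2 ^ d * t`:
off the maximal cubes by Lebesgue differentiation, on them because the parent cubes have means at
most `t`. -/
lemma ae_enorm_sub_czBad_le [CompleteSpace B] (hd : 1 ≤ d) {t : ℝ≥0∞} (ht : t ≠ 0) {f : 𝓔 → B}
    (hf : Integrable f) : ∀ᵐ x, ‖f x - czBad t f x‖ₑ ≤ 2 ^ d * t := by
  filter_upwards [ae_tendsto_dyadicCondExp hd hf.locallyIntegrable] with x hx
  by_cases hm : ∃ m, x ∈ czLayer (fun z => ‖f z‖ₑ) t m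
  · obtain ⟨m, hm⟩ := hm
    rw [czBad_eq t f hm, sub_sub_cancel]
    have h1 : dyadicMean (m + 1) (fun z => ‖f z‖ₑ) x ≤ t := by
      by_contra hlt
      exact hm.2 (Set.mem_biUnion (show m + 1 > m by omega) (not_le.1 hlt))
    refine (enorm_dyadicCondExp_le m f x).trans ?_
    have hv : volume (dyadicCube (m + 1) x) = 2 ^ d * volume (dyadicCube m x) := by
      rw [volume_dyadicCube, volume_dyadicCube, zpow_add_one₀ two_ne_zero, mul_pow,
        ENNReal.ofReal_mul (by positivity), mul_comm, ENNReal.ofReal_pow two_pos.le]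
      norm_num
    calc (volume (dyadicCube m x))⁻¹ * ∫⁻ y in dyadicCube m x, ‖f y‖ₑ
        ≤ (volume (dyadicCube m x))⁻¹ * ∫⁻ y in dyadicCube (m + 1) x, ‖f y‖ₑ := by
          gcongr
          exact dyadicCube_subset (by omega) x
      _ = (volume (dyadicCube m x))⁻¹ * (dyadicMean (m + 1) (fun z => ‖f z‖ₑ) x
            * (2 ^ d * volume (dyadicCube m x))) := by
          rw [setLIntegral_eq_dyadicMean_mul, hv]
      _ = 2 ^ d * dyadicMean (m + 1) (fun z => ‖f z‖ₑ) x
            * ((volume (dyadicCube m x))⁻¹ * volume (dyadicCube m x)) := by ring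
      _ ≤ 2 ^ d * t := by
          rw [ENNReal.inv_mul_cancel (volume_dyadicCube_pos m x) (volume_dyadicCube_ne_top m x),
            mul_one]
          gcongr
  · push Not at hm
    rw [czBad_eq_zero t f hm, sub_zero]
    have h1 : ‖f x‖ₑ ≤ t := by
      refine le_of_tendsto' hx.enorm fun N => (enorm_dyadicCondExp_le _ f x).trans ?_
      by_contra hlt
      obtain ⟨j, -, hj⟩ := exists_mem_czLayer hd hf.2.ne ht (not_le.1 hlt)
      exact hm j hj
    refine h1.trans (le_mul_of_one_le_left zero_le ?_)
    exact one_le_pow₀ (by norm_num)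

/-- The weak type `(1, 1)` inequality. -/
lemma exists_volume_lt_longVariation_le [CompleteSpace B] (hd : 1 ≤ d) {q : ℝ} (hq : 1 ≤ q)
    (hB : HasMartingaleCotype B q) :
    ∃ C : ℝ≥0∞, C ≠ ∞ ∧ ∀ f : 𝓔 → B, StronglyMeasurable f → Integrable f →
      ∀ t : ℝ≥0∞, t ≠ 0 → t ≠ ∞ →
        volume {x | t < longVariation q f x} ≤ C * (t⁻¹ * ∫⁻ x, ‖f x‖ₑ) := by
  have hq0 : 0 < q := by linarith
  obtain ⟨C, hC, hCq⟩ := exists_lintegral_longVariation_rpow_le_of_ae_bound (d := d) hd hq hB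
  refine ⟨C * (2 ^ q * (2 ^ d) ^ (q - 1) * 3)
    + (ballConst d (d + 1 + d) + 2 * ENNReal.ofReal (4 * d * d)), ?_, fun f hfm hf t ht ht' => ?_⟩
  · have h1 : ((2 : ℝ≥0∞) ^ d) ^ (q - 1) ≠ ∞ :=
      ENNReal.rpow_ne_top_of_nonneg (by linarith) (by simp)
    have h2 : (2 : ℝ≥0∞) ^ q ≠ ∞ := ENNReal.rpow_ne_top_of_nonneg hq0.le (by norm_num)
    exact ENNReal.add_ne_top.2 ⟨ENNReal.mul_ne_top hC (ENNReal.mul_ne_top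
      (ENNReal.mul_ne_top h2 h1) (by norm_num)), ENNReal.add_ne_top.2 ⟨ballConst_ne_top _,
      ENNReal.mul_ne_top (by norm_num) ENNReal.ofReal_ne_top⟩⟩
  set b := czBad t f with hb
  set g : 𝓔 → B := fun x => f x - b x with hg
  have hbm : StronglyMeasurable b := stronglyMeasurable_czBad t hfm
  have hbi : Integrable b := integrable_czBad t hfm hf
  have hgm : StronglyMeasurable g := hfm.sub hbm
  have hgi : Integrable g := hf.sub hbi
  have hgbd : ∀ᵐ x, ‖g x‖ₑ ≤ 2 ^ d * t := ae_enorm_sub_czBad_le hd ht hf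
  have h2t : 2 ^ d * t ≠ ∞ := ENNReal.mul_ne_top (by simp) ht'
  have hg1 : ∫⁻ x, ‖g x‖ₑ ≤ 3 * ∫⁻ x, ‖f x‖ₑ := by
    calc ∫⁻ x, ‖g x‖ₑ ≤ ∫⁻ x, (‖f x‖ₑ + ‖b x‖ₑ) := lintegral_mono fun x => enorm_sub_le
      _ = (∫⁻ x, ‖f x‖ₑ) + ∫⁻ x, ‖b x‖ₑ := lintegral_add_left hfm.enorm _
      _ ≤ (∫⁻ x, ‖f x‖ₑ) + 2 * ∫⁻ x, ‖f x‖ₑ := by gcongr; exact lintegral_czBad_le t hfm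
      _ = _ := by ring
  set Ω := czEnlarged (fun z => ‖f z‖ₑ) t with hΩ
  have hΩm : MeasurableSet Ω := measurableSet_czEnlarged _ t
  -- Chebyshev's inequality in `L^q` for the good function, and in `L^1` off `Ω` for the bad one.
  have hsub : {x | t < longVariation q f x} ⊆ {x | t / 2 ≤ longVariation q g x}
      ∪ (Ω ∪ {x ∈ Ωᶜ | t / 2 ≤ longVariation q b x}) := by
    intro x (hx : t < longVariation q f x)
    by_contra hn
    simp only [Set.mem_union, Set.mem_ofPred_eq, not_or, not_le, not_and, Set.mem_compl_iff] at hn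
    obtain ⟨h1, h2, h3⟩ := hn
    refine absurd hx (not_lt.2 ?_)
    have e : f = fun y => g y + b y := by funext y; simp [hg]
    calc longVariation q f x ≤ longVariation q g x + longVariation q b x := by
          conv_lhs => rw [e]
          exact longVariation_add_le hq hgi.locallyIntegrable hbi.locallyIntegrable x
      _ ≤ t / 2 + t / 2 := add_le_add h1.le (h3 h2).le
      _ = t := ENNReal.add_halves t
  have ht2 : t / 2 ≠ 0 := by simpa using ht
  have ht2' : t / 2 ≠ ∞ := ENNReal.div_ne_top ht' (by norm_num)
  have hgood : volume {x | t / 2 ≤ longVariation q g x}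
      ≤ C * (2 ^ q * (2 ^ d) ^ (q - 1) * 3) * (t⁻¹ * ∫⁻ x, ‖f x‖ₑ) := by
    have h1 : ∫⁻ x, ‖g x‖ₑ ^ q ≤ (2 ^ d * t) ^ (q - 1) * (3 * ∫⁻ x, ‖f x‖ₑ) := by
      calc ∫⁻ x, ‖g x‖ₑ ^ q ≤ ∫⁻ x, (2 ^ d * t) ^ (q - 1) * ‖g x‖ₑ := by
            refine lintegral_mono_ae ?_
            filter_upwards [hgbd] with x hx
            conv_lhs => rw [show q = (q - 1) + 1 by ring]
            rw [ENNReal.rpow_add_of_nonneg _ _ (by linarith) zero_le_one, ENNReal.rpow_one]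
            gcongr
        _ = (2 ^ d * t) ^ (q - 1) * ∫⁻ x, ‖g x‖ₑ := lintegral_const_mul _ hgm.enorm
        _ ≤ _ := by gcongr
    have h2 := mul_meas_ge_le_lintegral₀ (μ := volume)
      ((measurable_longVariation q hgm).pow_const q).aemeasurable ((t / 2) ^ q)
    have h3 : {x | (t / 2) ^ q ≤ longVariation q g x ^ q} = {x | t / 2 ≤ longVariation q g x} := by
      ext x; exact ENNReal.rpow_le_rpow_iff hq0
    rw [h3] at h2
    have h4 := hCq g hgm hgi ⟨(2 ^ d * t).toNNReal, by rwa [ENNReal.coe_toNNReal h2t]⟩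
    have h5 := h2.trans (h4.trans (mul_le_mul_right h1 C))
    have h6 := le_inv_mul_of_mul_le (by simp [ht2, ht2', hq0.not_gt])
      (ENNReal.rpow_ne_top_of_nonneg hq0.le ht2') h5
    refine h6.trans (le_of_eq ?_)
    have h7 : ((t / 2) ^ q)⁻¹ * t ^ (q - 1) = 2 ^ q * t⁻¹ := by
      rw [ENNReal.div_rpow_of_nonneg _ _ hq0.le, ENNReal.inv_div (Or.inl
        (ENNReal.rpow_ne_top_of_nonneg hq0.le (by norm_num))) (Or.inl (by simp)),
        ENNReal.rpow_sub _ _ ht ht', ENNReal.rpow_one, div_eq_mul_inv, div_eq_mul_inv]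
      have : (t ^ q)⁻¹ * t ^ q = 1 := ENNReal.inv_mul_cancel (by simp [ht, ht'])
        (ENNReal.rpow_ne_top_of_nonneg hq0.le ht')
      calc 2 ^ q * (t ^ q)⁻¹ * (t ^ q * t⁻¹) = ((t ^ q)⁻¹ * t ^ q) * (2 ^ q * t⁻¹) := by ring
        _ = _ := by rw [this, one_mul]
    rw [ENNReal.mul_rpow_of_nonneg _ _ (by linarith)]
    calc _ = (((t / 2) ^ q)⁻¹ * t ^ (q - 1)) * (C * ((2 ^ d) ^ (q - 1) * (3 * ∫⁻ x, ‖f x‖ₑ))) := by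
          ring
      _ = _ := by rw [h7]; ring
  have hbad : volume {x ∈ Ωᶜ | t / 2 ≤ longVariation q b x}
      ≤ 2 * ENNReal.ofReal (4 * d * d) * (t⁻¹ * ∫⁻ x, ‖f x‖ₑ) := by
    have h1 := setLIntegral_longVariation_czBad_le hd hq t hfm hf
    have h2 := mul_meas_ge_le_lintegral₀ (μ := volume.restrict Ωᶜ)
      (measurable_longVariation q hbm).aemeasurable (t / 2)
    rw [Measure.restrict_apply' hΩm.compl, Set.inter_comm] at h2
    refine (le_inv_mul_of_mul_le ht2 ht2' (h2.trans h1)).trans (le_of_eq ?_)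
    rw [ENNReal.inv_div (Or.inl (by norm_num)) (Or.inl (by norm_num)), div_eq_mul_inv]
    ring
  calc volume {x | t < longVariation q f x}
      ≤ volume {x | t / 2 ≤ longVariation q g x}
        + (volume Ω + volume {x ∈ Ωᶜ | t / 2 ≤ longVariation q b x}) :=
        (measure_mono hsub).trans ((measure_union_le _ _).trans
          (add_le_add le_rfl (measure_union_le _ _)))
    _ ≤ C * (2 ^ q * (2 ^ d) ^ (q - 1) * 3) * (t⁻¹ * ∫⁻ x, ‖f x‖ₑ)
        + (ballConst d (d + 1 + d) * (t⁻¹ * ∫⁻ x, ‖f x‖ₑ)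
          + 2 * ENNReal.ofReal (4 * d * d) * (t⁻¹ * ∫⁻ x, ‖f x‖ₑ)) :=
        add_le_add hgood (add_le_add (volume_czEnlarged_le _ ht ht') hbad)
    _ = _ := by ring

/-! ### Oscillation of the coarse scales -/

variable {G : Type*} [NormedAddCommGroup G]

/-- The maximal function of `L^r` means, with the normalization of `maximalFun`. -/
def powMaximal (r : ℝ) (f : 𝓔 → G) (x : 𝓔) : ℝ≥0∞ :=
  maximalFun (fun z => ‖f z‖ₑ ^ r) x ^ (1 / r)

lemma measurable_powMaximal (r : ℝ) {f : 𝓔 → G} (hf : StronglyMeasurable f) :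
    Measurable (powMaximal r f) :=
  (measurable_maximalFun (hf.enorm.pow_const r)).pow_const _

lemma powMaximal_le_of_bound {r : ℝ} (hr : 1 ≤ r) {f : 𝓔 → G} {M : ℝ≥0∞}
    (hM : ∀ᵐ z, ‖f z‖ₑ ≤ M) (x : 𝓔) :
    powMaximal r f x ≤ ballConst d (d + 1) ^ (1 / r) * M := by
  have hr0 : 0 < r := by linarith
  have h : maximalFun (fun z => ‖f z‖ₑ ^ r) x ≤ ballConst d (d + 1) * M ^ r :=
    maximalFun_le_of_bound (hM.mono fun z hz => ENNReal.rpow_le_rpow hz hr0.le) x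
  calc powMaximal r f x ≤ (ballConst d (d + 1) * M ^ r) ^ (1 / r) := by
        unfold powMaximal; gcongr
    _ = _ := by
        rw [ENNReal.mul_rpow_of_nonneg _ _ (by positivity), ← ENNReal.rpow_mul,
          mul_one_div_cancel hr0.ne', ENNReal.rpow_one]

lemma exists_lintegral_powMaximal_rpow_le (hd : 1 ≤ d) {r p : ℝ} (hr : 0 < r) (hp : r < p) :
    ∃ C : ℝ≥0∞, C ≠ ∞ ∧ ∀ f : 𝓔 → G, StronglyMeasurable f →
      ∫⁻ x, powMaximal r f x ^ p ≤ C * ∫⁻ x, ‖f x‖ₑ ^ p := by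
  obtain ⟨C, hC, h⟩ := exists_lintegral_maximalFun_rpow_le hd ((one_lt_div hr).2 hp)
  refine ⟨C, hC, fun f hf => ?_⟩
  have := h _ (hf.enorm.pow_const r)
  simp only [powMaximal, ← ENNReal.rpow_mul] at this ⊢
  rwa [mul_div_cancel₀ p hr.ne', ← one_div_mul_eq_div] at this

/-- The mean of `‖f‖` over a part `S` of a ball gains a power of the relative size of `S`. -/
lemma inv_mul_setLIntegral_le_powMaximal {r : ℝ} (hr : 1 ≤ r) {f : 𝓔 → G}
    (hf : StronglyMeasurable f) {k : ℤ} {x : 𝓔} {S : Set 𝓔} {ε : ℝ≥0∞}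
    (hS : S ⊆ Metric.ball x ((d + 1) * 2 ^ k))
    (hε : volume S ≤ ε * ENNReal.ofReal (((2 : ℝ) ^ k) ^ d)) :
    (ENNReal.ofReal (((2 : ℝ) ^ k) ^ d))⁻¹ * ∫⁻ z in S, ‖f z‖ₑ
      ≤ ε ^ ((r - 1) / r) * powMaximal r f x := by
  have hr0 : 0 < r := by linarith
  set V := ENNReal.ofReal (((2 : ℝ) ^ k) ^ d) with hV
  have hV0 : V ≠ 0 := by simpa [hV] using pow_pos (zpow_two_pos k) d
  have hV1 : V ≠ ∞ := ENNReal.ofReal_ne_top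
  have hJ := lintegral_rpow_le (volume.restrict S) hr (f := fun z => ‖f z‖ₑ) hf.enorm.aemeasurable
  rw [Measure.restrict_apply_univ] at hJ
  rw [← ENNReal.rpow_le_rpow_iff hr0, ENNReal.mul_rpow_of_nonneg _ _ hr0.le,
    ENNReal.mul_rpow_of_nonneg _ _ hr0.le, powMaximal, ← ENNReal.rpow_mul, ← ENNReal.rpow_mul,
    div_mul_cancel₀ _ hr0.ne', one_div_mul_cancel hr0.ne', ENNReal.rpow_one]
  calc V⁻¹ ^ r * (∫⁻ z in S, ‖f z‖ₑ) ^ r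
      ≤ V⁻¹ ^ r * ((ε * V) ^ (r - 1) * (V * maximalFun (fun z => ‖f z‖ₑ ^ r) x)) := by
        refine mul_le_mul_right (hJ.trans (mul_le_mul' ?_ ?_)) _
        · exact ENNReal.rpow_le_rpow hε (by linarith)
        · exact (lintegral_mono_set hS).trans (setLIntegral_ball_le_maximalFun _ k x)
    _ = (V⁻¹ ^ r * V ^ (r - 1) * V) * (ε ^ (r - 1) * maximalFun (fun z => ‖f z‖ₑ ^ r) x) := by
        rw [ENNReal.mul_rpow_of_nonneg _ _ (by linarith)]
        ring
    _ = _ := by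
        have e : V⁻¹ ^ r * V ^ (r - 1) * V = 1 := by
          rw [mul_assoc]
          nth_rewrite 3 [← ENNReal.rpow_one V]
          rw [← ENNReal.rpow_add _ _ hV0 hV1, sub_add_cancel, ENNReal.inv_rpow,
            ENNReal.inv_mul_cancel]
          · simp [hV0, hV1]
          · exact ENNReal.rpow_ne_top_of_nonneg (by linarith) hV1
        rw [e, one_mul]

lemma exists_enorm_avgDiff_le_powMaximal {r : ℝ} (hr : 1 ≤ r) :
    ∃ C : ℝ≥0∞, C ≠ ∞ ∧ ∀ f : 𝓔 → B, StronglyMeasurable f → ∀ (k : ℤ) (x : 𝓔),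
      ‖avgDiff k f x‖ₑ ≤ C * powMaximal r f x := by
  set ω := ballConst d 1 with hω
  have hω0 : ω ≠ 0 := ballConst_ne_zero one_pos
  have hω1 : ω ≠ ∞ := ballConst_ne_top 1
  have he : 0 ≤ (r - 1) / r := div_nonneg (by linarith) (by linarith)
  refine ⟨ω⁻¹ * ω ^ ((r - 1) / r) + 1, ENNReal.add_ne_top.2 ⟨ENNReal.mul_ne_top
    (ENNReal.inv_ne_top.2 hω0) (ENNReal.rpow_ne_top_of_nonneg he hω1), ENNReal.one_ne_top⟩,
    fun f hf k x => (enorm_avgDiff_le k f x).trans ?_⟩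
  have hk := zpow_two_pos k
  have hv := volume_ball_zpow (d := d) one_pos k 0
  have hvx := volume_ball_zpow (d := d) one_pos k x
  rw [one_mul] at hv hvx
  have h1 := inv_mul_setLIntegral_le_powMaximal hr hf (k := k) (x := x) (S := Metric.ball x (2 ^ k))
    (ε := ω) (Metric.ball_subset_ball (by
      have : 0 ≤ (d : ℝ) * 2 ^ k := by positivity
      linarith)) hvx.le
  have h2 := inv_mul_setLIntegral_le_powMaximal hr hf (k := k) (x := x) (S := dyadicCube k x)
    (ε := 1) (fun y hy => by
      rw [mem_ball_iff_norm]
      have := norm_sub_le_of_mem_dyadicCube hy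
      linarith) (by rw [volume_dyadicCube, one_mul])
  rw [ENNReal.one_rpow] at h2
  rw [hv, ENNReal.mul_inv (Or.inl hω0) (Or.inl hω1), volume_dyadicCube, add_mul, mul_assoc,
    mul_assoc ω⁻¹]
  gcongr

/-- Two balls of the same radius with close centres differ by a subset of a shell. -/
lemma volume_ball_sdiff_ball_le (hd : 1 ≤ d) {m k : ℤ} {x y : 𝓔} (h : ‖x - y‖ ≤ d * 2 ^ m) :
    volume (Metric.ball x (2 ^ k) \ Metric.ball y (2 ^ k))
      ≤ ENNReal.ofReal (d * d * 2 ^ (m - k)) * ballConst d 1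
        * ENNReal.ofReal (((2 : ℝ) ^ k) ^ d) := by
  have hk := zpow_two_pos k
  have hm := zpow_two_pos m
  have hsub : Metric.ball x (2 ^ k) \ Metric.ball y (2 ^ k)
      ⊆ (fun z => z - x) ⁻¹' shell d (2 ^ k) (d * 2 ^ m) := by
    rintro z ⟨hz, hzy⟩
    rw [mem_ball_iff_norm] at hz hzy
    refine ⟨by simpa using hz, ?_⟩
    rw [Metric.mem_ball, dist_zero_right]
    have : ‖z - y‖ ≤ ‖z - x‖ + ‖x - y‖ := norm_sub_le_norm_sub_add_norm_sub z x y
    linarith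
  have hv := volume_ball_zpow (d := d) one_pos k 0
  rw [one_mul] at hv
  calc _ ≤ volume ((fun z => z - x) ⁻¹' shell d (2 ^ k) (d * 2 ^ m)) := measure_mono hsub
    _ = volume (shell d (2 ^ k) (d * 2 ^ m)) := by
        have := setLIntegral_preimage_sub x (shell d (2 ^ k) (d * 2 ^ m)) fun _ => 1
        simpa using this
    _ ≤ ENNReal.ofReal (d * (d * 2 ^ m / 2 ^ k)) * volume (Metric.ball (0 : 𝓔) (2 ^ k)) :=
        volume_shell_le hd hk (by positivity)
    _ = _ := by
        rw [hv, mul_assoc, zpow_sub₀ two_ne_zero]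
        congr 2
        ring

/-- Inside a dyadic cube of level `m`, the average differences at the coarser scales `2 ^ k` vary
by a quantity that decays geometrically in `k - m`. -/
lemma exists_enorm_avgDiff_sub_le (hd : 1 ≤ d) {r : ℝ} (hr : 1 < r) :
    ∃ C : ℝ≥0∞, C ≠ ∞ ∧ ∃ θ : ℝ, 0 ≤ θ ∧ θ < 1 ∧ ∀ f : 𝓔 → B, StronglyMeasurable f →
      LocallyIntegrable f → ∀ (m : ℤ) (i : ℕ) (x y : 𝓔), y ∈ dyadicCube m x →
      ‖avgDiff (m + 1 + i) f y - avgDiff (m + 1 + i) f x‖ₑ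
        ≤ C * ENNReal.ofReal (θ ^ i) * powMaximal r f x := by
  set ω := ballConst d 1 with hω
  have hω0 : ω ≠ 0 := ballConst_ne_zero one_pos
  have hω1 : ω ≠ ∞ := ballConst_ne_top 1
  set e := (r - 1) / r with he
  have he0 : 0 < e := div_pos (by linarith) (by linarith)
  set θ : ℝ := (1 / 2) ^ e with hθ
  have hθ0 : 0 ≤ θ := by positivity
  refine ⟨2 * (ω⁻¹ * (ENNReal.ofReal (d * d) * ω) ^ e), ?_, θ, hθ0,
    Real.rpow_lt_one (by norm_num) (by norm_num) he0, fun f hfm hf m i x y hy => ?_⟩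
  · exact ENNReal.mul_ne_top (by norm_num) (ENNReal.mul_ne_top (ENNReal.inv_ne_top.2 hω0)
      (ENNReal.rpow_ne_top_of_nonneg he0.le (ENNReal.mul_ne_top ENNReal.ofReal_ne_top hω1)))
  set k := m + 1 + (i : ℤ) with hk
  have hmk : m ≤ k := by omega
  have hkpos := zpow_two_pos k
  set V := ENNReal.ofReal (((2 : ℝ) ^ k) ^ d) with hV
  have hv := volume_ball_zpow (d := d) one_pos k 0
  rw [one_mul] at hv
  have hyx := norm_sub_le_of_mem_dyadicCube hy
  set X := Metric.ball x ((2 : ℝ) ^ k) with hX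
  set Y := Metric.ball y ((2 : ℝ) ^ k) with hY
  -- The dyadic means at the two points agree, and the common part of the two balls cancels.
  have e1 : avgDiff k f y - avgDiff k f x
      = (volume (Metric.ball (0 : 𝓔) (2 ^ k))).toReal⁻¹ •
          ((∫ z in Y \ X, f z) - ∫ z in X \ Y, f z) := by
    have h1 := integral_inter_add_sdiff (μ := volume) (s := Y) (t := X) measurableSet_ball
      (integrableOn_ball hf y _)
    have h2 := integral_inter_add_sdiff (μ := volume) (s := X) (t := Y) measurableSet_ball
      (integrableOn_ball hf x _)
    rw [avgDiff, avgDiff, dyadicCondExp_eq_of_mem f (dyadicCube_subset hmk x hy),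
      sub_sub_sub_cancel_right, ballAverage_eq, ballAverage_eq, ← smul_sub, ← h1, ← h2,
      Set.inter_comm X Y, add_sub_add_left_eq_sub]
  set ε := ENNReal.ofReal (d * d * 2 ^ (m - k)) * ω with hε
  have hεle : ε ^ e ≤ (ENNReal.ofReal (d * d) * ω) ^ e * ENNReal.ofReal (θ ^ i) := by
    have h1 : (2 : ℝ) ^ (m - k) ≤ (1 / 2) ^ i := by
      rw [show m - k = -((i + 1 : ℕ) : ℤ) by rw [hk]; push_cast; ring, zpow_neg, zpow_natCast,
        ← inv_pow, ← one_div]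
      exact pow_le_pow_of_le_one (by norm_num) (by norm_num) (by omega)
    have h2 : ENNReal.ofReal (θ ^ i) = ENNReal.ofReal ((1 / 2) ^ i) ^ e := by
      rw [ENNReal.ofReal_rpow_of_pos (by positivity), hθ, ← Real.rpow_natCast, ← Real.rpow_natCast,
        ← Real.rpow_mul (by norm_num), ← Real.rpow_mul (by norm_num), mul_comm]
    rw [h2, ← ENNReal.mul_rpow_of_nonneg _ _ he0.le, hε, ENNReal.ofReal_mul (by positivity)]
    refine ENNReal.rpow_le_rpow ?_ he0.le
    rw [mul_right_comm]
    gcongr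
  have hXsub : X ⊆ Metric.ball x ((d + 1) * 2 ^ k) := Metric.ball_subset_ball (by
      have : 0 ≤ (d : ℝ) * 2 ^ k := by positivity
      linarith)
  have hYsub : Y ⊆ Metric.ball x ((d + 1) * 2 ^ k) := fun z hz => by
    rw [hY, mem_ball_iff_norm] at hz
    rw [mem_ball_iff_norm]
    have h1 : ‖z - x‖ ≤ ‖z - y‖ + ‖y - x‖ := norm_sub_le_norm_sub_add_norm_sub z y x
    have h2 : (d : ℝ) * 2 ^ m ≤ d * 2 ^ k := by
      gcongr
      exact one_le_two
    linarith
  have hXY := inv_mul_setLIntegral_le_powMaximal hr.le hfm (S := X \ Y) (ε := ε)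
    (Set.sdiff_subset.trans hXsub) (volume_ball_sdiff_ball_le hd (by rwa [norm_sub_rev]))
  have hYX := inv_mul_setLIntegral_le_powMaximal hr.le hfm (S := Y \ X) (ε := ε)
    (Set.sdiff_subset.trans hYsub) (volume_ball_sdiff_ball_le hd hyx)
  rw [e1, enorm_toReal_inv_smul (volume_ball_zero_pos hkpos) (volume_ball_zero_ne_top _), hv,
    ENNReal.mul_inv (Or.inl hω0) (Or.inl hω1)]
  calc ω⁻¹ * V⁻¹ * ‖(∫ z in Y \ X, f z) - ∫ z in X \ Y, f z‖ₑ
      ≤ ω⁻¹ * V⁻¹ * ((∫⁻ z in Y \ X, ‖f z‖ₑ) + ∫⁻ z in X \ Y, ‖f z‖ₑ) := by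
        gcongr
        exact enorm_sub_le.trans (add_le_add (enorm_integral_le_lintegral_enorm _)
          (enorm_integral_le_lintegral_enorm _))
    _ = ω⁻¹ * (V⁻¹ * (∫⁻ z in Y \ X, ‖f z‖ₑ) + V⁻¹ * ∫⁻ z in X \ Y, ‖f z‖ₑ) := by ring
    _ ≤ ω⁻¹ * (ε ^ e * powMaximal r f x + ε ^ e * powMaximal r f x) :=
        mul_le_mul_right (add_le_add hYX hXY) _
    _ = 2 * ω⁻¹ * ε ^ e * powMaximal r f x := by ring
    _ ≤ 2 * ω⁻¹ * ((ENNReal.ofReal (d * d) * ω) ^ e * ENNReal.ofReal (θ ^ i))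
          * powMaximal r f x := by gcongr
    _ = _ := by ring

/-- The part of the long variation at the scales `2 ^ k`, `k ∈ I`. -/
def partialVariation (q : ℝ) (I : Set ℤ) (f : 𝓔 → B) (x : 𝓔) : ℝ≥0∞ :=
  seqNorm q (I.indicator fun k => ‖avgDiff k f x‖ₑ)

lemma partialVariation_le_longVariation {q : ℝ} (hq : 0 < q) (I : Set ℤ) (f : 𝓔 → B) (x : 𝓔) :
    partialVariation q I f x ≤ longVariation q f x :=
  seqNorm_mono hq fun k => Set.indicator_le_self _ _ k

lemma partialVariation_le_add {q : ℝ} (hq : 1 ≤ q) {I J K : Set ℤ} (h : I ⊆ J ∪ K) (f : 𝓔 → B)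
    (x : 𝓔) : partialVariation q I f x ≤ partialVariation q J f x + partialVariation q K f x := by
  refine le_trans (seqNorm_mono (by linarith) fun k => ?_) (seqNorm_add_le hq _ _)
  by_cases hI : k ∈ I
  · rw [Set.indicator_of_mem hI]
    rcases h hI with hk | hk
    · rw [Set.indicator_of_mem hk]; exact le_self_add
    · rw [Set.indicator_of_mem hk]; exact le_add_self
  · rw [Set.indicator_of_notMem hI]; exact zero_le

lemma longVariation_le_add {q : ℝ} (hq : 1 ≤ q) (m : ℤ) (f : 𝓔 → B) (x : 𝓔) :
    longVariation q f x
      ≤ partialVariation q (Set.Ioi m) f x + partialVariation q (Set.Iic m) f x := by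
  have h := partialVariation_le_add hq (I := Set.univ) (J := Set.Ioi m) (K := Set.Iic m)
    (fun k _ => lt_or_ge m k) f x
  rwa [partialVariation, Set.indicator_univ] at h

/-- Inside a dyadic cube of level `m`, the part of the long variation at the coarser scales is
constant up to the maximal function of `L^r` means at an arbitrary one of the two points. -/
lemma exists_partialVariation_Ioi_le (hd : 1 ≤ d) {q : ℝ} (hq : 1 ≤ q) {r : ℝ} (hr : 1 < r) :
    ∃ C : ℝ≥0∞, C ≠ ∞ ∧ ∀ f : 𝓔 → B, StronglyMeasurable f → LocallyIntegrable f →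
      ∀ (m : ℤ) (x y : 𝓔), y ∈ dyadicCube m x →
      partialVariation q (Set.Ioi m) f y
          ≤ partialVariation q (Set.Ioi m) f x + C * powMaximal r f x ∧
        partialVariation q (Set.Ioi m) f x
          ≤ partialVariation q (Set.Ioi m) f y + C * powMaximal r f x := by
  obtain ⟨C, hC, θ, hθ0, hθ1, h⟩ := exists_enorm_avgDiff_sub_le (d := d) (B := B) hd hr
  refine ⟨C * ∑' i : ℕ, ENNReal.ofReal (θ ^ i),
    ENNReal.mul_ne_top hC (tsum_rpow_geometric_ne_top hθ0 hθ1), fun f hfm hf m x y hy => ?_⟩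
  have hsum : seqNorm q ((Set.Ioi m).indicator fun k => ‖avgDiff k f y - avgDiff k f x‖ₑ)
      ≤ (C * ∑' i : ℕ, ENNReal.ofReal (θ ^ i)) * powMaximal r f x := by
    refine (seqNorm_le_tsum hq _).trans ?_
    rw [tsum_indicator_Ioi, ← ENNReal.tsum_mul_left, ← ENNReal.tsum_mul_right]
    exact ENNReal.tsum_le_tsum fun i => h f hfm hf m i x y hy
  have key : ∀ a b : 𝓔, (∀ k, ‖avgDiff k f a‖ₑ
      ≤ ‖avgDiff k f b‖ₑ + ‖avgDiff k f y - avgDiff k f x‖ₑ) →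
      partialVariation q (Set.Ioi m) f a ≤ partialVariation q (Set.Ioi m) f b
        + (C * ∑' i : ℕ, ENNReal.ofReal (θ ^ i)) * powMaximal r f x := by
    intro a b hab
    refine le_trans ?_ (add_le_add le_rfl hsum)
    refine le_trans (seqNorm_mono (by linarith) fun k => ?_) (seqNorm_add_le hq _ _)
    by_cases hk : k ∈ Set.Ioi m
    · simp only [Set.indicator_of_mem hk]; exact hab k
    · simp only [Set.indicator_of_notMem hk]; exact zero_le
  refine ⟨key y x fun k => ?_, key x y fun k => ?_⟩
  · calc ‖avgDiff k f y‖ₑ = ‖avgDiff k f x + (avgDiff k f y - avgDiff k f x)‖ₑ := by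
          rw [add_sub_cancel]
      _ ≤ _ := enorm_add_le _ _
  · calc ‖avgDiff k f x‖ₑ = ‖avgDiff k f y - (avgDiff k f y - avgDiff k f x)‖ₑ := by
          rw [sub_sub_cancel]
      _ ≤ _ := enorm_sub_le

lemma avgDiff_indicator_eq {k : ℤ} {f : 𝓔 → B} {x : 𝓔} {S : Set 𝓔}
    (h1 : Metric.ball x (2 ^ k) ⊆ S) (h2 : dyadicCube k x ⊆ S) :
    avgDiff k (S.indicator f) x = avgDiff k f x := by
  rw [avgDiff, avgDiff, ballAverage_eq, ballAverage_eq, dyadicCondExp_eq, dyadicCondExp_eq,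
    setIntegral_congr_fun measurableSet_ball fun z hz => Set.indicator_of_mem (h1 hz) f,
    setIntegral_congr_fun (measurableSet_dyadicCube k x) fun z hz => Set.indicator_of_mem (h2 hz) f]

/-- Inside a dyadic cube of level `m`, the part of the long variation at the finer scales only sees
the function near the cube. -/
lemma partialVariation_Iic_le {q : ℝ} (hq : 0 < q) (f : 𝓔 → B) {m : ℤ} {x y : 𝓔}
    (hx : x ∈ dyadicCube m y) :
    partialVariation q (Set.Iic m) f x
      ≤ longVariation q ((Metric.ball y ((d + 1) * 2 ^ m)).indicator f) x := by
  refine seqNorm_mono hq fun k => ?_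
  by_cases hk : k ∈ Set.Iic m
  · rw [Set.indicator_of_mem hk]
    have hxy := norm_sub_le_of_mem_dyadicCube hx
    have hm := zpow_two_pos m
    have hkm : (2 : ℝ) ^ k ≤ 2 ^ m := zpow_le_zpow_right₀ one_le_two hk
    refine le_of_eq (congrArg _ (avgDiff_indicator_eq (fun z hz => ?_) fun z hz => ?_).symm)
    · rw [mem_ball_iff_norm] at hz ⊢
      have := norm_sub_le_norm_sub_add_norm_sub z x y
      linarith
    · rw [mem_ball_iff_norm]
      have hz' := dyadicCube_subset hk x hz
      rw [dyadicCube_eq_of_mem hx] at hz'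
      have := norm_sub_le_of_mem_dyadicCube hz'
      linarith
  · rw [Set.indicator_of_notMem hk]; exact zero_le

/-! ### The good-`λ` inequality -/

/-- Summation of a contracting recursion over `ℤ`, started from a bound at `-∞`. -/
lemma tsum_le_two_mul_of_recursion {a b : ℤ → ℝ≥0∞} {K : ℝ≥0∞} (hK : K ≠ ∞)
    (hrec : ∀ n, a (n + 1) ≤ a n / 2 + b n) (hbd : ∀ n ≤ 0, a n ≤ K) :
    ∑' n, a n ≤ 2 * ∑' n, b n := by
  rcases eq_or_ne (∑' n, b n) ∞ with hb | hb
  · rw [hb]; simp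
  set S := ∑' n, b n with hS
  have hpart : ∀ (M : ℕ) (j : ℕ), ∑ i ∈ Finset.range j, a (-(M : ℤ) + i) ≤ 2 * K + 2 * S := by
    intro M j
    induction j with
    | zero => simp
    | succ j ih =>
      rw [Finset.sum_range_succ']
      have h1 : ∑ i ∈ Finset.range j, a (-(M : ℤ) + ((i + 1 : ℕ) : ℤ))
          ≤ (∑ i ∈ Finset.range j, a (-(M : ℤ) + i)) / 2 + S := by
        calc _ ≤ ∑ i ∈ Finset.range j, (a (-(M : ℤ) + i) / 2 + b (-(M : ℤ) + i)) := by
              refine Finset.sum_le_sum fun i _ => ?_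
              have := hrec (-(M : ℤ) + i)
              rwa [add_assoc] at this
          _ = (∑ i ∈ Finset.range j, a (-(M : ℤ) + i)) / 2
                + ∑ i ∈ Finset.range j, b (-(M : ℤ) + i) := by
              rw [Finset.sum_add_distrib, ENNReal.div_eq_inv_mul, Finset.mul_sum]
              simp only [ENNReal.div_eq_inv_mul]
          _ ≤ _ := by
              gcongr
              refine (ENNReal.sum_le_tsum _).trans ?_
              exact ENNReal.tsum_comp_le_tsum_of_injective (f := fun i : ℕ => -(M : ℤ) + i)
                (fun i j h => by simpa using h) b
      calc _ ≤ (2 * K + 2 * S) / 2 + S + K := by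
            refine add_le_add (h1.trans ?_) (hbd _ (by simp))
            gcongr
        _ = _ := by
            rw [← mul_add, mul_div_assoc, mul_comm 2, ENNReal.div_mul_cancel two_ne_zero
              (by norm_num)]
            ring
  -- The half of the sum can be absorbed only once the sum is known to be finite.
  have hfin : ∑' n, a n ≤ 2 * K + 2 * S := by
    rw [ENNReal.tsum_eq_iSup_sum]
    refine iSup_le fun T => ?_
    obtain ⟨N, hN⟩ : ∃ N : ℕ, ∀ n ∈ T, -(N : ℤ) ≤ n ∧ n < N := by
      refine ⟨T.sup fun n => n.natAbs + 1, fun n hn => ?_⟩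
      have := Finset.le_sup (f := fun n : ℤ => n.natAbs + 1) hn
      omega
    refine le_trans ?_ (hpart N (2 * N))
    have hinj : Function.Injective fun i : ℕ => -(N : ℤ) + i := fun i j h => by simpa using h
    rw [← Finset.sum_image (f := a) (g := fun i : ℕ => -(N : ℤ) + i) fun i _ j _ h => hinj h]
    refine Finset.sum_le_sum_of_subset fun n hn => ?_
    obtain ⟨h1, h2⟩ := hN n hn
    exact Finset.mem_image.2 ⟨(n + N).toNat, Finset.mem_range.2 (by omega), by omega⟩
  have hfin' : ∑' n, a n ≠ ∞ := ne_top_of_le_ne_top (ENNReal.add_ne_top.2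
    ⟨ENNReal.mul_ne_top (by norm_num) hK, ENNReal.mul_ne_top (by norm_num) hb⟩) hfin
  have habs : ∑' n, a n ≤ (∑' n, a n) / 2 + S := by
    calc ∑' n, a n = ∑' n, a (n + 1) := ((Equiv.addRight (1 : ℤ)).tsum_eq a).symm
      _ ≤ ∑' n, (a n / 2 + b n) := ENNReal.tsum_le_tsum hrec
      _ = _ := by
        rw [ENNReal.tsum_add]
        simp only [div_eq_mul_inv, ENNReal.tsum_mul_right]
        rfl
  have h2 : (∑' n, a n) / 2 ≠ ∞ := ENNReal.div_ne_top hfin' (by norm_num)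
  have h3 : (∑' n, a n) / 2 ≤ S := by
    rw [← ENNReal.add_le_add_iff_left h2, ENNReal.add_halves]
    exact habs
  calc ∑' n, a n = 2 * ((∑' n, a n) / 2) := by
        rw [ENNReal.mul_div_cancel two_ne_zero (by norm_num)]
    _ ≤ 2 * S := by gcongr

/-- The dyadic cubes of level `m` on which the long variation over the scales coarser than `2 ^ m`
exceeds `t` somewhere. -/
def coarseSet (q : ℝ) (f : 𝓔 → B) (t : ℝ≥0∞) (m : ℤ) : Set 𝓔 :=
  {x | ∃ y ∈ dyadicCube m x, t < partialVariation q (Set.Ioi m) f y}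

/-- A dyadic enlargement of the level set `{x | t < longVariation q f x}`: the union of the dyadic
cubes on which the scales coarser than the cube alone push the variation above `t` somewhere. -/
def levelSet (q : ℝ) (f : 𝓔 → B) (t : ℝ≥0∞) : Set 𝓔 := ⋃ m, coarseSet q f t m

lemma dyadicSaturated_coarseSet (q : ℝ) (f : 𝓔 → B) (t : ℝ≥0∞) (m : ℤ) :
    DyadicSaturated m (coarseSet q f t m) := by
  rintro x ⟨y, hy, hty⟩ z hz
  exact ⟨y, by rwa [dyadicCube_eq_of_mem hz], hty⟩

lemma coarseSet_anti (q : ℝ) (f : 𝓔 → B) {s t : ℝ≥0∞} (h : s ≤ t) (m : ℤ) :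
    coarseSet q f t m ⊆ coarseSet q f s m :=
  fun _ ⟨y, hy, hty⟩ => ⟨y, hy, h.trans_lt hty⟩

lemma subset_levelSet {q : ℝ} (hq : 0 < q) (f : 𝓔 → B) (t : ℝ≥0∞) :
    {x | t < longVariation q f x} ⊆ levelSet q f t := by
  intro x (hx : t < longVariation q f x)
  rw [longVariation_eq_seqNorm, ← ENNReal.rpow_lt_rpow_iff hq, seqNorm_rpow hq,
    ENNReal.tsum_eq_iSup_sum, lt_iSup_iff] at hx
  obtain ⟨S, hS⟩ := hx
  obtain ⟨m, hm⟩ := S.bddBelow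
  refine Set.mem_iUnion.2 ⟨m - 1, x, mem_dyadicCube_self _ x, ?_⟩
  rw [← ENNReal.rpow_lt_rpow_iff hq, partialVariation, seqNorm_rpow hq]
  refine hS.trans_le (le_trans (le_of_eq (Finset.sum_congr rfl fun k hk => ?_))
    (ENNReal.sum_le_tsum S))
  rw [Set.indicator_of_mem]
  have := hm hk
  simp only [Set.mem_Ioi]
  omega

/-- For integrable `f` the coarse part of the long variation tends to `0` uniformly. -/
lemma bddAbove_coarseSet (hd : 1 ≤ d) {q : ℝ} (hq : 1 ≤ q) {f : 𝓔 → B} (hf : Integrable f)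
    {t : ℝ≥0∞} (ht : t ≠ 0) (x : 𝓔) : BddAbove {m | x ∈ coarseSet q f t m} := by
  set ω := ballConst d 1 with hω
  have hω0 : ω ≠ 0 := ballConst_ne_zero one_pos
  have hω1 : ω ≠ ∞ := ballConst_ne_top 1
  set F := ∫⁻ z, ‖f z‖ₑ with hF
  set W := ∑' i : ℕ, ENNReal.ofReal ((1 / 2) ^ i) with hW
  have hWtop : W ≠ ∞ := tsum_rpow_geometric_ne_top (by norm_num) (by norm_num)
  have ha : (ω⁻¹ + 1) * F * W ≠ ∞ := ENNReal.mul_ne_top (ENNReal.mul_ne_top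
    (ENNReal.add_ne_top.2 ⟨ENNReal.inv_ne_top.2 hω0, ENNReal.one_ne_top⟩) hf.2.ne) hWtop
  refine (bddAbove_of_lt_inv_zpow_mul hd ha ht).mono ?_
  rintro m ⟨y, -, hy⟩
  refine hy.trans_le ((seqNorm_le_tsum hq _).trans ?_)
  rw [tsum_indicator_Ioi, ← mul_assoc, ← ENNReal.tsum_mul_left]
  refine ENNReal.tsum_le_tsum fun i => ?_
  have hm := zpow_two_pos m
  have hv := volume_ball_zpow (d := d) one_pos (m + 1 + i) 0
  rw [one_mul] at hv
  have hV : (ENNReal.ofReal (((2 : ℝ) ^ (m + 1 + (i : ℤ))) ^ d))⁻¹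
      ≤ (ENNReal.ofReal (((2 : ℝ) ^ m) ^ d))⁻¹ * ENNReal.ofReal ((1 / 2) ^ i) := by
    rw [← ENNReal.ofReal_inv_of_pos (by positivity), ← ENNReal.ofReal_inv_of_pos (by positivity),
      ← ENNReal.ofReal_mul (by positivity)]
    refine ENNReal.ofReal_le_ofReal ?_
    rw [add_assoc, zpow_add₀ two_ne_zero, mul_pow, mul_inv]
    gcongr
    have e : (2 : ℝ) ^ (1 + (i : ℤ)) = 2 ^ (1 + i) := by
      rw [← zpow_natCast]; push_cast; rfl
    rw [e, one_div, inv_pow]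
    refine inv_anti₀ (by positivity) ?_
    calc (2 : ℝ) ^ i ≤ 2 ^ (1 + i) := pow_le_pow_right₀ one_le_two (by omega)
      _ ≤ (2 ^ (1 + i)) ^ d := le_self_pow₀ (one_le_pow₀ one_le_two) (by omega)
  refine (enorm_avgDiff_le _ f y).trans ?_
  rw [hv, volume_dyadicCube, ENNReal.mul_inv (Or.inl hω0) (Or.inl hω1)]
  calc _ ≤ ω⁻¹ * (ENNReal.ofReal (((2 : ℝ) ^ (m + 1 + (i : ℤ))) ^ d))⁻¹ * F
        + (ENNReal.ofReal (((2 : ℝ) ^ (m + 1 + (i : ℤ))) ^ d))⁻¹ * F :=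
        add_le_add (mul_le_mul_right (setLIntegral_le_lintegral _ _) _)
          (mul_le_mul_right (setLIntegral_le_lintegral _ _) _)
    _ = (ω⁻¹ + 1) * F * (ENNReal.ofReal (((2 : ℝ) ^ (m + 1 + (i : ℤ))) ^ d))⁻¹ := by ring
    _ ≤ (ω⁻¹ + 1) * F * ((ENNReal.ofReal (((2 : ℝ) ^ m) ^ d))⁻¹ * ENNReal.ofReal ((1 / 2) ^ i)) := by
        gcongr
    _ = _ := by ring

/-- The good-`λ` inequality between the long variation and the maximal function of `L^r` means.
On the maximal cubes of the level set at height `t`, the coarse part of the variation is at most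
`t` up to the maximal function, so that the variation can exceed `3 * t` only through its fine part,
which is controlled by the weak type `(1, 1)` inequality. -/
lemma exists_good_lambda [CompleteSpace B] (hd : 1 ≤ d) {q : ℝ} (hq : 1 ≤ q)
    (hB : HasMartingaleCotype B q) {r : ℝ} (hr : 1 < r) :
    ∃ C A : ℝ≥0∞, C ≠ ∞ ∧ A ≠ ∞ ∧ ∀ f : 𝓔 → B, StronglyMeasurable f → Integrable f →
      (∀ t : ℝ≥0∞, levelSet q f t ⊆ {x | t < longVariation q f x + A * powMaximal r f x}) ∧
      ∀ γ t : ℝ≥0∞, A * γ ≤ 2⁻¹ → t ≠ 0 → t ≠ ∞ →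
        volume (levelSet q f (3 * t) ∩ {x | powMaximal r f x ≤ γ * t})
          ≤ C * γ * volume (levelSet q f t) := by
  have hq0 : 0 < q := by linarith
  obtain ⟨Cw, hCw, hweak⟩ := exists_volume_lt_longVariation_le (d := d) hd hq hB
  obtain ⟨A₁, hA₁, hosc⟩ := exists_partialVariation_Ioi_le (d := d) (B := B) hd hq hr
  obtain ⟨A₂, hA₂, hterm⟩ := exists_enorm_avgDiff_le_powMaximal (d := d) (B := B) hr.le
  set c := ballConst d (d + 1) ^ ((r - 1) / r) with hc
  have hcr : 0 ≤ (r - 1) / r := div_nonneg (by linarith) (by linarith)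
  refine ⟨Cw * c, A₁ + A₂, ENNReal.mul_ne_top hCw (ENNReal.rpow_ne_top_of_nonneg hcr
    (ballConst_ne_top _)), ENNReal.add_ne_top.2 ⟨hA₁, hA₂⟩, fun f hfm hf => ⟨?_, ?_⟩⟩
  · intro t x hx
    obtain ⟨m, y, hy, hty⟩ := Set.mem_iUnion.1 hx
    refine hty.trans_le ((hosc f hfm hf.locallyIntegrable m x y hy).1.trans ?_)
    exact add_le_add (partialVariation_le_longVariation hq0 _ f x)
      (mul_le_mul_left le_self_add _)
  intro γ t hγ ht ht'
  set N := powMaximal r f with hN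
  set U : ℤ → Set 𝓔 := lastLayer (coarseSet q f t) with hU
  have hUsat : ∀ m, DyadicSaturated m (U m) :=
    dyadicSaturated_lastLayer (dyadicSaturated_coarseSet q f t)
  have hUunion : ⋃ m, U m = levelSet q f t :=
    iUnion_lastLayer (bddAbove_coarseSet hd hq hf ht)
  set S := levelSet q f (3 * t) ∩ {x | N x ≤ γ * t} with hS
  have hSsub : S ⊆ levelSet q f t := by
    refine Set.inter_subset_left.trans (Set.iUnion_mono fun m => coarseSet_anti q f ?_ m)
    exact le_mul_of_one_le_left zero_le (by norm_num)
  -- On a maximal cube of level `m` the fine part of the variation exceeds `t`.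
  have hfine : ∀ m, ∀ x ∈ U m ∩ S, t < partialVariation q (Set.Iic m) f x := by
    rintro m x ⟨hxU, hx3, hxN⟩
    have hxN' : (A₁ + A₂) * N x ≤ t / 2 := by
      calc (A₁ + A₂) * N x ≤ (A₁ + A₂) * (γ * t) := by gcongr; exact hxN
        _ = (A₁ + A₂) * γ * t := by ring
        _ ≤ 2⁻¹ * t := by gcongr
        _ = t / 2 := by rw [ENNReal.div_eq_inv_mul]
    have hA1N : A₁ * N x ≤ t / 2 := (mul_le_mul_left le_self_add _).trans hxN'
    have hA2N : A₂ * N x ≤ t / 2 := (mul_le_mul_left le_add_self _).trans hxN'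
    obtain ⟨m', y, hy, hty⟩ := Set.mem_iUnion.1 hx3
    have h1 := (hosc f hfm hf.locallyIntegrable m' x y hy).1
    have h2 : partialVariation q (Set.Ioi m') f x
        ≤ partialVariation q (Set.Ioi m) f x + partialVariation q (Set.Iic m) f x :=
      partialVariation_le_add hq (fun k _ => lt_or_ge m k) f x
    have h3 : partialVariation q (Set.Ioi m) f x
        ≤ partialVariation q (Set.Ioi (m + 1)) f x + partialVariation q {m + 1} f x :=
      partialVariation_le_add hq (fun k (hk : m < k) => by
        rcases eq_or_ne k (m + 1) with h | h
        · exact Or.inr h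
        · exact Or.inl (show m + 1 < k by omega)) f x
    -- By maximality of `m` the scales coarser than `2 ^ (m + 1)` contribute at most `t`, and the
    -- single scale `2 ^ (m + 1)` that is left is bounded by the maximal function.
    have h4 : partialVariation q (Set.Ioi (m + 1)) f x ≤ t := by
      by_contra hlt
      exact hxU.2 (Set.mem_biUnion (show m + 1 > m by omega)
        ⟨x, mem_dyadicCube_self _ x, not_le.1 hlt⟩)
    have h5 : partialVariation q {m + 1} f x ≤ A₂ * N x := by
      refine (seqNorm_le_tsum hq _).trans ?_
      rw [tsum_eq_single (m + 1) fun k hk => Set.indicator_of_notMem (by simpa using hk) _,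
        Set.indicator_of_mem (Set.mem_singleton _)]
      exact hterm f hfm (m + 1) x
    by_contra hlt
    rw [not_lt] at hlt
    refine absurd hty (not_lt.2 ?_)
    calc partialVariation q (Set.Ioi m') f y
        ≤ (t + t / 2) + t + t / 2 := by
          refine h1.trans (add_le_add (h2.trans (add_le_add (h3.trans ?_) hlt)) hA1N)
          exact add_le_add h4 (h5.trans hA2N)
      _ = t + t + (t / 2 + t / 2) := by ring
      _ = 3 * t := by rw [ENNReal.add_halves]; ring
  have hcube : ∀ m, ∀ x ∈ U m,
      volume (S ∩ dyadicCube m x) ≤ Cw * c * γ * volume (dyadicCube m x) := by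
    intro m x hx
    rcases Set.eq_empty_or_nonempty (S ∩ dyadicCube m x) with h0 | ⟨y, hyS, hyx⟩
    · rw [h0, measure_empty]; exact zero_le
    -- The fine part only sees `f` near the cube, where the mean of `‖f‖` is at most a multiple of
    -- `γ * t` because the ball is centred at a point `y` of `S`.
    set D := Metric.ball y (((d : ℝ) + 1) * 2 ^ m) with hD
    have hfD : Integrable (D.indicator f) := hf.indicator measurableSet_ball
    have hsub : S ∩ dyadicCube m x ⊆ {z | t < longVariation q (D.indicator f) z} := by
      rintro z ⟨hzS, hzx⟩
      refine (hfine m z ⟨hUsat m x hx hzx, hzS⟩).trans_le (partialVariation_Iic_le hq0 f ?_)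
      rwa [dyadicCube_eq_of_mem hyx]
    have hint : ∫⁻ z, ‖D.indicator f z‖ₑ = ∫⁻ z in D, ‖f z‖ₑ := by
      have hDm : MeasurableSet D := measurableSet_ball
      rw [← lintegral_indicator hDm]
      refine lintegral_congr fun z => ?_
      by_cases hz : z ∈ D <;> simp [hz]
    have hmean := inv_mul_setLIntegral_le_powMaximal hr.le hfm (k := m) (S := D)
      (ε := ballConst d (d + 1)) le_rfl (volume_ball_zpow (by positivity) m y).le
    rw [← hc, ENNReal.inv_mul_le_iff (by simpa using pow_pos (zpow_two_pos m) d)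
      ENNReal.ofReal_ne_top] at hmean
    calc volume (S ∩ dyadicCube m x) ≤ Cw * (t⁻¹ * ∫⁻ z in D, ‖f z‖ₑ) := by
          rw [← hint]
          exact (measure_mono hsub).trans
            (hweak _ (hfm.indicator measurableSet_ball) hfD t ht ht')
      _ ≤ Cw * (t⁻¹ * (ENNReal.ofReal (((2 : ℝ) ^ m) ^ d) * (c * (γ * t)))) := by
          gcongr
          refine hmean.trans ?_
          gcongr
          exact hyS.2
      _ = (t⁻¹ * t) * (Cw * c * γ * ENNReal.ofReal (((2 : ℝ) ^ m) ^ d)) := by ring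
      _ = _ := by rw [ENNReal.inv_mul_cancel ht ht', one_mul, volume_dyadicCube]
  calc volume S = volume (⋃ m, S ∩ U m) := by
        rw [← Set.inter_iUnion, hUunion, Set.inter_eq_left.2 hSsub]
    _ ≤ ∑' m, volume (S ∩ U m) := measure_iUnion_le _
    _ ≤ ∑' m, Cw * c * γ * volume (U m) :=
        ENNReal.tsum_le_tsum fun m => measure_inter_le_of_forall_cube (hUsat m) (hcube m)
    _ = _ := by
        rw [ENNReal.tsum_mul_left, ← hUunion, measure_iUnion (pairwise_disjoint_lastLayer _)
          fun m => (hUsat m).measurableSet]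

/-- The strong type `(p, p)` inequality for integrable functions. -/
lemma exists_lintegral_longVariation_rpow_le_of_integrable [CompleteSpace B] (hd : 1 ≤ d) {q : ℝ}
    (hq : 1 ≤ q) (hB : HasMartingaleCotype B q) {p : ℝ} (hp : 1 < p) :
    ∃ C : ℝ≥0∞, C ≠ ∞ ∧ ∀ f : 𝓔 → B, StronglyMeasurable f → Integrable f →
      ∫⁻ x, ‖f x‖ₑ ^ p ≠ ∞ → ∫⁻ x, longVariation q f x ^ p ≤ C * ∫⁻ x, ‖f x‖ₑ ^ p := by
  have hq0 : 0 < q := by linarith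
  have hp0 : 0 < p := by linarith
  obtain ⟨Cw, hCw, hweak⟩ := exists_volume_lt_longVariation_le (d := d) hd hq hB
  obtain ⟨C, A, hC, hA, hgl⟩ := exists_good_lambda (d := d) hd hq hB (r := (1 + p) / 2)
    (by linarith)
  obtain ⟨Cm, hCm, hmax⟩ := exists_lintegral_powMaximal_rpow_le (d := d) (G := B) hd
    (r := (1 + p) / 2) (p := p) (by linarith) (by linarith)
  obtain ⟨Cl, hCl, hlayer⟩ := exists_tsum_lintegral_le (volume : Measure 𝓔) hp0
  have h3p : (3 : ℝ≥0∞) ^ p ≠ ∞ := ENNReal.rpow_ne_top_of_nonneg hp0.le (by norm_num)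
  have h3 : ∀ n : ℤ, (3 : ℝ≥0∞) ^ n ≠ 0 := fun n =>
    (ENNReal.zpow_pos (by norm_num) (by norm_num) n).ne'
  have h3' : ∀ n : ℤ, (3 : ℝ≥0∞) ^ n ≠ ∞ := fun n =>
    (ENNReal.zpow_lt_top (by norm_num) (by norm_num) n).ne
  -- The small parameter makes the good-`λ` inequality contracting at the exponent `p`.
  set D := A + 3 ^ p * C + 1 with hD
  have hD0 : D ≠ 0 := by simp [hD]
  have hD1 : D ≠ ∞ := ENNReal.add_ne_top.2 ⟨ENNReal.add_ne_top.2
    ⟨hA, ENNReal.mul_ne_top h3p hC⟩, ENNReal.one_ne_top⟩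
  set γ := 2⁻¹ * D⁻¹ with hγ
  have hDγ : D * γ = 2⁻¹ := by
    rw [hγ, mul_left_comm, ENNReal.mul_inv_cancel hD0 hD1, mul_one]
  have hγ0 : γ ≠ 0 := mul_ne_zero (by simp) (by simpa using hD1)
  have hγ1 : γ ≠ ∞ := ENNReal.mul_ne_top (by simp) (by simpa using hD0)
  have hAγ : A * γ ≤ 2⁻¹ := by
    rw [← hDγ]
    gcongr
    exact le_self_add.trans le_self_add
  have hCγ : 3 ^ p * C * γ ≤ 2⁻¹ := by
    rw [← hDγ]
    gcongr
    exact le_add_self.trans le_self_add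
  refine ⟨3 ^ p * (2 * (3 ^ p * (Cl * ((γ⁻¹) ^ p * Cm)))), ?_, fun f hfm hf hfp => ?_⟩
  · exact ENNReal.mul_ne_top h3p (ENNReal.mul_ne_top (by norm_num) (ENNReal.mul_ne_top h3p
      (ENNReal.mul_ne_top hCl (ENNReal.mul_ne_top
      (ENNReal.rpow_ne_top_of_nonneg hp0.le (by simpa using hγ0)) hCm))))
  obtain ⟨hsub, hgood⟩ := hgl f hfm hf
  set N := powMaximal ((1 + p) / 2) f with hN
  have hNm : Measurable N := measurable_powMaximal _ hfm
  have hNp : ∫⁻ x, N x ^ p ≤ Cm * ∫⁻ x, ‖f x‖ₑ ^ p := hmax f hfm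
  have hNp' : ∫⁻ x, N x ^ p ≠ ∞ := ne_top_of_le_ne_top (ENNReal.mul_ne_top hCm hfp) hNp
  set a : ℤ → ℝ≥0∞ := fun n => ((3 : ℝ≥0∞) ^ n) ^ p * volume (levelSet q f ((3 : ℝ≥0∞) ^ n))
    with ha
  set b : ℤ → ℝ≥0∞ := fun n => 3 ^ p * (((3 : ℝ≥0∞) ^ n) ^ p *
    volume {x | (3 : ℝ≥0∞) ^ n < γ⁻¹ * N x}) with hb
  have hsucc : ∀ n : ℤ, (3 : ℝ≥0∞) ^ (n + 1) = 3 * (3 : ℝ≥0∞) ^ n := fun n => by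
    rw [ENNReal.zpow_add (by norm_num) (by norm_num), zpow_one, mul_comm]
  have hrec : ∀ n, a (n + 1) ≤ a n / 2 + b n := by
    intro n
    have h1 := hgood γ ((3 : ℝ≥0∞) ^ n) hAγ (h3 n) (h3' n)
    have h2 : levelSet q f (3 * (3 : ℝ≥0∞) ^ n)
        ⊆ (levelSet q f (3 * (3 : ℝ≥0∞) ^ n) ∩ {x | N x ≤ γ * (3 : ℝ≥0∞) ^ n})
          ∪ {x | (3 : ℝ≥0∞) ^ n < γ⁻¹ * N x} := by
      intro x hx
      by_cases hxN : N x ≤ γ * (3 : ℝ≥0∞) ^ n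
      · exact Or.inl ⟨hx, hxN⟩
      · refine Or.inr ?_
        by_contra hlt
        refine hxN ?_
        rw [← ENNReal.inv_mul_le_iff hγ0 hγ1]
        exact not_lt.1 hlt
    have h4 := (measure_mono h2).trans ((measure_union_le _ _).trans (add_le_add h1 le_rfl))
    simp only [ha, hb]
    rw [hsucc, ENNReal.mul_rpow_of_nonneg _ _ hp0.le]
    calc 3 ^ p * ((3 : ℝ≥0∞) ^ n) ^ p * volume (levelSet q f (3 * (3 : ℝ≥0∞) ^ n))
        ≤ 3 ^ p * ((3 : ℝ≥0∞) ^ n) ^ p * (C * γ * volume (levelSet q f ((3 : ℝ≥0∞) ^ n))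
          + volume {x | (3 : ℝ≥0∞) ^ n < γ⁻¹ * N x}) := by gcongr
      _ = (3 ^ p * C * γ) * (((3 : ℝ≥0∞) ^ n) ^ p * volume (levelSet q f ((3 : ℝ≥0∞) ^ n)))
          + 3 ^ p * (((3 : ℝ≥0∞) ^ n) ^ p * volume {x | (3 : ℝ≥0∞) ^ n < γ⁻¹ * N x}) := by ring
      _ ≤ _ := by
        rw [ENNReal.div_eq_inv_mul]
        gcongr
  -- At small heights the weak type inequality suffices, since `t ^ p ≤ t` for `t ≤ 1`.
  have hbd : ∀ n ≤ 0, a n ≤ 2 * Cw * (∫⁻ x, ‖f x‖ₑ) + (2 * A) ^ p * ∫⁻ x, N x ^ p := by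
    intro n hn
    set t := (3 : ℝ≥0∞) ^ n with ht
    have ht0 : t ≠ 0 := h3 n
    have ht1 : t ≠ ∞ := h3' n
    have htle : t ≤ 1 := by
      have := ENNReal.zpow_le_of_le (x := 3) (by norm_num) hn
      simpa using this
    have h1 : levelSet q f t ⊆ {x | t / 2 < longVariation q f x} ∪ {x | t ≤ 2 * A * N x} := by
      intro x hx
      have h := hsub t hx
      by_contra hn
      simp only [Set.mem_union, Set.mem_ofPred_eq, not_or, not_lt, not_le] at hn
      refine absurd (show t < longVariation q f x + A * N x from h) (not_lt.2 ?_)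
      rw [← ENNReal.add_halves t]
      refine add_le_add hn.1 ?_
      rw [ENNReal.le_div_iff_mul_le (Or.inl two_ne_zero) (Or.inl (by norm_num))]
      calc A * N x * 2 = 2 * A * N x := by ring
        _ ≤ t := hn.2.le
    have h2 : volume {x | t / 2 < longVariation q f x} ≤ 2 * Cw * (t⁻¹ * ∫⁻ x, ‖f x‖ₑ) := by
      refine (hweak f hfm hf (t / 2) (by simpa using ht0) (ENNReal.div_ne_top ht1
        (by norm_num))).trans (le_of_eq ?_)
      rw [ENNReal.inv_div (Or.inl (by norm_num)) (Or.inl (by norm_num)), div_eq_mul_inv]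
      ring
    have h4 : t ^ p * volume {x | t ≤ 2 * A * N x} ≤ (2 * A) ^ p * ∫⁻ x, N x ^ p := by
      have h5 := mul_meas_ge_le_lintegral₀ (μ := volume)
        ((hNm.const_mul (2 * A)).pow_const p).aemeasurable (t ^ p)
      have h6 : {x | t ^ p ≤ (2 * A * N x) ^ p} = {x | t ≤ 2 * A * N x} := by
        ext x; exact ENNReal.rpow_le_rpow_iff hp0
      rw [h6] at h5
      refine h5.trans (le_of_eq ?_)
      simp only [ENNReal.mul_rpow_of_nonneg (2 * A) _ hp0.le]
      exact lintegral_const_mul _ (hNm.pow_const p)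
    calc a n ≤ t ^ p * (2 * Cw * (t⁻¹ * ∫⁻ x, ‖f x‖ₑ) + volume {x | t ≤ 2 * A * N x}) := by
          simp only [ha]
          gcongr
          exact (measure_mono h1).trans ((measure_union_le _ _).trans (add_le_add h2 le_rfl))
      _ = (t ^ p * t⁻¹) * (2 * Cw * ∫⁻ x, ‖f x‖ₑ) + t ^ p * volume {x | t ≤ 2 * A * N x} := by
          ring
      _ ≤ 1 * (2 * Cw * ∫⁻ x, ‖f x‖ₑ) + (2 * A) ^ p * ∫⁻ x, N x ^ p := by
          gcongr
          rw [← ENNReal.rpow_neg_one, ← ENNReal.rpow_add _ _ ht0 ht1]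
          exact ENNReal.rpow_le_one htle (by linarith)
      _ = _ := by rw [one_mul]
  have hK : 2 * Cw * (∫⁻ x, ‖f x‖ₑ) + (2 * A) ^ p * ∫⁻ x, N x ^ p ≠ ∞ :=
    ENNReal.add_ne_top.2 ⟨ENNReal.mul_ne_top (ENNReal.mul_ne_top (by norm_num) hCw) hf.2.ne,
      ENNReal.mul_ne_top (ENNReal.rpow_ne_top_of_nonneg hp0.le
        (ENNReal.mul_ne_top (by norm_num) hA)) hNp'⟩
  have hsum := tsum_le_two_mul_of_recursion hK hrec hbd
  have hbsum : ∑' n, b n ≤ 3 ^ p * (Cl * ((γ⁻¹) ^ p * Cm * ∫⁻ x, ‖f x‖ₑ ^ p)) := by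
    simp only [hb]
    rw [ENNReal.tsum_mul_left]
    gcongr
    have := hlayer (fun x => γ⁻¹ * N x) (fun _ => 1) (hNm.const_mul _) measurable_const
    simp only [setLIntegral_one, mul_one] at this
    refine this.trans ?_
    gcongr
    calc ∫⁻ x, (γ⁻¹ * N x) ^ p = (γ⁻¹) ^ p * ∫⁻ x, N x ^ p := by
          simp only [ENNReal.mul_rpow_of_nonneg _ _ hp0.le]
          exact lintegral_const_mul _ (hNm.pow_const p)
      _ ≤ _ := by
          rw [mul_assoc]
          gcongr
  calc ∫⁻ x, longVariation q f x ^ p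
      ≤ ∑' n : ℤ, ((3 : ℝ≥0∞) ^ (n + 1)) ^ p * volume {x | (3 : ℝ≥0∞) ^ n < longVariation q f x} :=
        lintegral_rpow_le_tsum_measure _ hp0 (measurable_longVariation q hfm)
    _ ≤ ∑' n : ℤ, 3 ^ p * a n := by
        refine ENNReal.tsum_le_tsum fun n => ?_
        rw [hsucc, ENNReal.mul_rpow_of_nonneg _ _ hp0.le, mul_assoc]
        simp only [ha]
        gcongr
        exact subset_levelSet hq0 f _
    _ ≤ 3 ^ p * (2 * (3 ^ p * (Cl * ((γ⁻¹) ^ p * Cm * ∫⁻ x, ‖f x‖ₑ ^ p)))) := by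
        rw [ENNReal.tsum_mul_left]
        gcongr
        exact hsum.trans (mul_le_mul_right hbsum 2)
    _ = _ := by ring

/-! ### Strong type `(p, p)` and dyadic `BMO` -/

/-- The long variation is lower semicontinuous along truncations to growing balls. -/
lemma longVariation_rpow_le_liminf {q : ℝ} (hq : 0 < q) {p : ℝ} (hp : 0 < p) (f : 𝓔 → B) (x : 𝓔) :
    longVariation q f x ^ p ≤ Filter.liminf
      (fun n : ℕ => longVariation q ((Metric.ball 0 n).indicator f) x ^ p) Filter.atTop := by
  set L := Filter.liminf
    (fun n : ℕ => longVariation q ((Metric.ball 0 n).indicator f) x ^ p) Filter.atTop with hL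
  suffices h : ∑' k, ‖avgDiff k f x‖ₑ ^ q ≤ (L ^ (1 / p)) ^ q by
    have h1 : longVariation q f x ≤ L ^ (1 / p) := by
      rw [longVariation_eq_seqNorm, seqNorm, ← ENNReal.le_rpow_inv_iff (by positivity)]
      simpa using h
    calc longVariation q f x ^ p ≤ (L ^ (1 / p)) ^ p := by gcongr
      _ = L := by rw [← ENNReal.rpow_mul, one_div_mul_cancel hp.ne', ENNReal.rpow_one]
  rw [ENNReal.tsum_eq_iSup_sum]
  refine iSup_le fun T => ?_
  have hev : ∀ k : ℤ, ∀ᶠ n : ℕ in Filter.atTop,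
      avgDiff k ((Metric.ball 0 n).indicator f) x = avgDiff k f x := by
    intro k
    obtain ⟨n₀, hn₀⟩ := exists_nat_gt (‖x‖ + (d + 1) * 2 ^ k)
    filter_upwards [Filter.eventually_ge_atTop n₀] with n hn
    have hk := zpow_two_pos k
    have hn' : (n₀ : ℝ) ≤ n := by exact_mod_cast hn
    have hd0 : (0 : ℝ) ≤ d * 2 ^ k := by positivity
    refine avgDiff_indicator_eq (fun y hy => ?_) fun y hy => ?_
    · rw [mem_ball_iff_norm] at hy
      rw [mem_ball_zero_iff]
      have := norm_le_norm_add_norm_sub' y x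
      linarith
    · have hy := norm_sub_le_of_mem_dyadicCube hy
      rw [mem_ball_zero_iff]
      have := norm_le_norm_add_norm_sub' y x
      linarith
  have hle : (∑ k ∈ T, ‖avgDiff k f x‖ₑ ^ q) ^ (p / q) ≤ L := by
    refine Filter.le_liminf_of_le (by isBoundedDefault) ?_
    filter_upwards [(Filter.eventually_all_finset T).2 fun k _ => hev k] with n hn
    rw [longVariation_eq_seqNorm, seqNorm, ← ENNReal.rpow_mul, one_div_mul_eq_div]
    gcongr
    calc ∑ k ∈ T, ‖avgDiff k f x‖ₑ ^ q
        = ∑ k ∈ T, ‖avgDiff k ((Metric.ball 0 n).indicator f) x‖ₑ ^ q :=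
          Finset.sum_congr rfl fun k hk => by rw [hn k hk]
      _ ≤ _ := ENNReal.sum_le_tsum T
  calc ∑ k ∈ T, ‖avgDiff k f x‖ₑ ^ q
      = ((∑ k ∈ T, ‖avgDiff k f x‖ₑ ^ q) ^ (p / q)) ^ (1 / p * q) := by
        rw [← ENNReal.rpow_mul, show p / q * (1 / p * q) = 1 by field_simp, ENNReal.rpow_one]
    _ ≤ L ^ (1 / p * q) := by gcongr
    _ = _ := ENNReal.rpow_mul _ _ _

/-- The strong type `(p, p)` inequality. -/
lemma exists_lintegral_longVariation_rpow_le_of_memLp [CompleteSpace B] (hd : 1 ≤ d) {q : ℝ}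
    (hq : 1 ≤ q) (hB : HasMartingaleCotype B q) {p : ℝ} (hp : 1 < p) :
    ∃ C : ℝ≥0∞, C ≠ ∞ ∧ ∀ f : 𝓔 → B, StronglyMeasurable f → LocallyIntegrable f →
      ∫⁻ x, ‖f x‖ₑ ^ p ≠ ∞ → ∫⁻ x, longVariation q f x ^ p ≤ C * ∫⁻ x, ‖f x‖ₑ ^ p := by
  obtain ⟨C, hC, h⟩ :=
    exists_lintegral_longVariation_rpow_le_of_integrable (d := d) hd hq hB hp
  refine ⟨C, hC, fun f hfm hf hfp => ?_⟩
  have hfn : ∀ n : ℕ, StronglyMeasurable ((Metric.ball (0 : 𝓔) n).indicator f) := fun n =>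
    hfm.indicator measurableSet_ball
  have hle : ∀ n : ℕ, ∫⁻ x, ‖(Metric.ball (0 : 𝓔) n).indicator f x‖ₑ ^ p ≤ ∫⁻ x, ‖f x‖ₑ ^ p :=
    fun n => lintegral_mono fun x => by
      gcongr
      exact enorm_indicator_le_enorm_self _ _
  calc ∫⁻ x, longVariation q f x ^ p
      ≤ ∫⁻ x, Filter.liminf
        (fun n : ℕ => longVariation q ((Metric.ball 0 n).indicator f) x ^ p) Filter.atTop :=
        lintegral_mono fun x => longVariation_rpow_le_liminf (by linarith) (by linarith) f x
    _ ≤ Filter.liminf (fun n : ℕ =>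
        ∫⁻ x, longVariation q ((Metric.ball 0 n).indicator f) x ^ p) Filter.atTop :=
        lintegral_liminf_le fun n => (measurable_longVariation q (hfn n)).pow_const p
    _ ≤ C * ∫⁻ x, ‖f x‖ₑ ^ p := by
        refine Filter.liminf_le_of_le (by isBoundedDefault) fun b hb => ?_
        obtain ⟨n, hn⟩ := hb.exists
        refine hn.trans ((h _ (hfn n) ?_ (ne_top_of_le_ne_top hfp (hle n))).trans ?_)
        · exact ((hf.integrableOn_isCompact (isCompact_closedBall 0 n)).mono_set
            Metric.ball_subset_closedBall).integrable_indicator measurableSet_ball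
        · exact mul_le_mul_right (hle n) C

lemma enorm_toReal_sub_toReal_le {a b c : ℝ≥0∞} (ha : a ≠ ∞) (hb : b ≠ ∞) (h1 : a ≤ b + c)
    (h2 : b ≤ a + c) : ‖a.toReal - b.toReal‖ₑ ≤ c := by
  rcases eq_or_ne c ∞ with rfl | hc
  · exact le_top
  rw [← ofReal_norm, Real.norm_eq_abs]
  refine ENNReal.ofReal_le_of_le_toReal (abs_sub_le_iff.2 ⟨?_, ?_⟩)
  · have := ENNReal.toReal_mono (ENNReal.add_ne_top.2 ⟨hb, hc⟩) h1
    rw [ENNReal.toReal_add hb hc] at this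
    linarith
  · have := ENNReal.toReal_mono (ENNReal.add_ne_top.2 ⟨ha, hc⟩) h2
    rw [ENNReal.toReal_add ha hc] at this
    linarith

/-- On a dyadic cube, the long variation of a bounded function is close in mean to a constant: the
contribution of the coarse scales is nearly constant, and the fine scales are controlled by the
`L^q` bound for the restriction of the function to a neighbourhood of the cube. -/
lemma exists_lintegral_enorm_longVariation_sub_le [CompleteSpace B] (hd : 1 ≤ d) {q : ℝ}
    (hq : 1 ≤ q) (hB : HasMartingaleCotype B q) :
    ∃ C : ℝ≥0∞, C ≠ ∞ ∧ ∀ f : 𝓔 → B, StronglyMeasurable f → LocallyIntegrable f →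
      ∀ M : ℝ≥0, (∀ᵐ z, ‖f z‖ₑ ≤ M) → (∀ᵐ z, longVariation q f z < ∞) →
      ∀ (m : ℤ) (x : 𝓔), ∃ c : ℝ,
        ∫⁻ y in dyadicCube m x, ‖(longVariation q f y).toReal - c‖ₑ
          ≤ C * M * volume (dyadicCube m x) := by
  have hq0 : 0 < q := by linarith
  obtain ⟨A, hA, hosc⟩ := exists_partialVariation_Ioi_le (d := d) (B := B) hd hq one_lt_two
  obtain ⟨C, hC, hCq⟩ := exists_lintegral_longVariation_rpow_le_of_ae_bound (d := d) hd hq hB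
  set b := ballConst d ((d : ℝ) + 1) with hb
  have hb1 : b ≠ ∞ := ballConst_ne_top _
  refine ⟨A * b ^ ((1 : ℝ) / 2) + (C * b) ^ (1 / q), ENNReal.add_ne_top.2
    ⟨ENNReal.mul_ne_top hA (ENNReal.rpow_ne_top_of_nonneg (by norm_num) hb1),
      ENNReal.rpow_ne_top_of_nonneg (by positivity) (ENNReal.mul_ne_top hC hb1)⟩,
    fun f hfm hf M hM hfin m x => ?_⟩
  set Q := dyadicCube m x with hQ
  have hQm : MeasurableSet Q := measurableSet_dyadicCube m x
  obtain ⟨y, hyQ, hy⟩ : ∃ y ∈ Q, longVariation q f y < ∞ := by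
    have : (volume.restrict Q) ≠ 0 := by
      rw [Ne, Measure.restrict_eq_zero]
      exact volume_dyadicCube_pos m x
    have := ae_neBot.2 this
    exact ((ae_restrict_mem hQm).and (ae_restrict_of_ae hfin)).exists
  set f₁ := (Metric.ball y (((d : ℝ) + 1) * 2 ^ m)).indicator f with hf₁
  have hf₁m : StronglyMeasurable f₁ := hfm.indicator measurableSet_ball
  have hf₁i : Integrable f₁ := ((hf.integrableOn_isCompact (isCompact_closedBall y _)).mono_set
    Metric.ball_subset_closedBall).integrable_indicator measurableSet_ball
  have hcube : dyadicCube m y = Q := dyadicCube_eq_of_mem hyQ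
  -- The constant is the coarse part at a point of the cube at which the variation is finite.
  set c := partialVariation q (Set.Ioi m) f y with hc
  have hcfin : c ≠ ∞ :=
    ((partialVariation_le_longVariation hq0 (Set.Ioi m) f y).trans_lt hy).ne
  refine ⟨c.toReal, ?_⟩
  have hpt : ∀ᵐ z ∂volume.restrict Q, ‖(longVariation q f z).toReal - c.toReal‖ₑ
      ≤ A * b ^ ((1 : ℝ) / 2) * M + longVariation q f₁ z := by
    filter_upwards [ae_restrict_mem hQm, ae_restrict_of_ae hfin] with z hz hzf
    have hzy : z ∈ dyadicCube m y := by rwa [hcube]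
    obtain ⟨h1, h2⟩ := hosc f hfm hf m y z hzy
    have h3 : A * powMaximal 2 f y ≤ A * b ^ ((1 : ℝ) / 2) * M := by
      rw [mul_assoc]
      gcongr
      exact powMaximal_le_of_bound one_le_two hM y
    refine enorm_toReal_sub_toReal_le hzf.ne hcfin ?_ ?_
    · rw [← add_assoc]
      refine (longVariation_le_add hq m f z).trans (add_le_add ?_
        (partialVariation_Iic_le hq0 f hzy))
      exact h1.trans (by gcongr)
    · refine h2.trans ?_
      exact add_le_add (partialVariation_le_longVariation hq0 _ f z) (h3.trans le_self_add)
  have hloc : ∫⁻ z in Q, longVariation q f₁ z ≤ (C * b) ^ (1 / q) * M * volume Q := by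
    have h1 := lintegral_rpow_le (volume.restrict Q) hq
      (measurable_longVariation q hf₁m).aemeasurable
    rw [Measure.restrict_apply_univ] at h1
    have h2 : ∫⁻ z, longVariation q f₁ z ^ q ≤ C * (M ^ q * (b * volume Q)) := by
      refine (hCq f₁ hf₁m hf₁i ⟨M, hM.mono fun z hz =>
        (enorm_indicator_le_enorm_self _ _).trans hz⟩).trans ?_
      gcongr
      calc ∫⁻ z, ‖f₁ z‖ₑ ^ q
          ≤ ∫⁻ z, (Metric.ball y (((d : ℝ) + 1) * 2 ^ m)).indicator
              (fun _ => (M : ℝ≥0∞) ^ q) z := by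
            refine lintegral_mono_ae (hM.mono fun z hz => ?_)
            by_cases hzb : z ∈ Metric.ball y (((d : ℝ) + 1) * 2 ^ m)
            · simp only [hf₁, Set.indicator_of_mem hzb]
              gcongr
            · simp [hf₁, Set.indicator_of_notMem hzb, hq0]
        _ = M ^ q * (b * volume Q) := by
            rw [lintegral_indicator_const measurableSet_ball, volume_ball_zpow (by positivity),
              hQ, volume_dyadicCube]
    have h3 : (∫⁻ z in Q, longVariation q f₁ z) ^ q ≤ C * b * M ^ q * volume Q ^ q := by
      calc (∫⁻ z in Q, longVariation q f₁ z) ^ q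
          ≤ volume Q ^ (q - 1) * (C * (M ^ q * (b * volume Q))) := by
            refine h1.trans ?_
            gcongr
            exact (setLIntegral_le_lintegral _ _).trans h2
        _ = C * b * M ^ q * (volume Q ^ (q - 1) * volume Q ^ (1 : ℝ)) := by
            rw [ENNReal.rpow_one]; ring
        _ = _ := by
            rw [← ENNReal.rpow_add _ _ (volume_dyadicCube_pos m x) (volume_dyadicCube_ne_top m x),
              sub_add_cancel]
    rw [← ENNReal.rpow_le_rpow_iff hq0, ENNReal.mul_rpow_of_nonneg _ _ hq0.le,
      ENNReal.mul_rpow_of_nonneg _ _ hq0.le, ← ENNReal.rpow_mul, one_div_mul_cancel hq0.ne',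
      ENNReal.rpow_one]
    exact h3
  calc ∫⁻ z in Q, ‖(longVariation q f z).toReal - c.toReal‖ₑ
      ≤ ∫⁻ z in Q, (A * b ^ ((1 : ℝ) / 2) * M + longVariation q f₁ z) := lintegral_mono_ae hpt
    _ = A * b ^ ((1 : ℝ) / 2) * M * volume Q + ∫⁻ z in Q, longVariation q f₁ z := by
        rw [lintegral_add_left measurable_const, setLIntegral_const]
    _ ≤ A * b ^ ((1 : ℝ) / 2) * M * volume Q + (C * b) ^ (1 / q) * M * volume Q := by gcongr
    _ = _ := by ring

/-- A function that is integrable on all dyadic cubes of side length one is locally integrable. -/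
lemma locallyIntegrable_of_integrableOn_dyadicCube {g : 𝓔 → ℝ}
    (h : ∀ x : 𝓔, IntegrableOn g (dyadicCube 0 x)) : LocallyIntegrable g := by
  refine fun x => ⟨Metric.ball x 1, Metric.ball_mem_nhds x one_pos, ?_⟩
  obtain ⟨N, hN⟩ := exists_nat_gt (‖x‖ + 1)
  have hsub : Metric.ball x 1 ⊆ ⋃ c ∈ Set.Icc (fun _ : Fin d => -(N : ℤ)) (fun _ => (N : ℤ)),
      gridIndex (d := d) 0 ⁻¹' {c} := by
    intro y hy
    refine Set.mem_biUnion (x := gridIndex 0 y) ?_ rfl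
    rw [mem_ball_iff_norm] at hy
    have hyN : ‖y‖ < N := by
      have := norm_le_norm_add_norm_sub' y x
      linarith
    have hi : ∀ i, |y i| < N := fun i => (PiLp.norm_apply_le y i).trans_lt hyN
    refine ⟨fun i => ?_, fun i => ?_⟩
    · simp only [gridIndex, zpow_zero, div_one]
      rw [Int.le_floor]
      push_cast
      exact (abs_lt.1 (hi i)).1.le
    · simp only [gridIndex, zpow_zero, div_one]
      refine Int.floor_le_iff.2 ?_
      push_cast
      linarith [(abs_lt.1 (hi i)).2]
  refine IntegrableOn.mono_set ?_ hsub
  rw [integrableOn_finite_biUnion (Set.finite_Icc _ _)]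
  intro c _
  rcases Set.eq_empty_or_nonempty (gridIndex (d := d) 0 ⁻¹' {c}) with h0 | ⟨y, hy⟩
  · rw [h0]; exact integrableOn_empty
  · rw [gridIndex_fiber_eq hy]; exact h y

/-- Means of oscillations about arbitrary constants, one for each dyadic cube, control the dyadic
`BMO` norm up to a factor two. -/
lemma locallyIntegrable_and_dyadicBMONorm_le {g : 𝓔 → ℝ} (hg : Measurable g) {K : ℝ≥0∞}
    (hK : K ≠ ∞) (h : ∀ (m : ℤ) (x : 𝓔), ∃ c : ℝ,
      ∫⁻ y in dyadicCube m x, ‖g y - c‖ₑ ≤ K * volume (dyadicCube m x)) :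
    LocallyIntegrable g ∧ dyadicBMONorm g ≤ 2 * K := by
  have hint : ∀ (m : ℤ) (x : 𝓔), IntegrableOn g (dyadicCube m x) := by
    intro m x
    obtain ⟨c, hc⟩ := h m x
    have h1 : IntegrableOn (fun y => g y - c) (dyadicCube m x) :=
      ⟨(hg.sub_const c).aestronglyMeasurable, hc.trans_lt
        (ENNReal.mul_ne_top hK (volume_dyadicCube_ne_top m x)).lt_top⟩
    have h2 : IntegrableOn (fun _ => c) (dyadicCube m x) :=
      integrableOn_const (volume_dyadicCube_ne_top m x)
    exact (h1.add h2).congr (ae_of_all _ fun y => sub_add_cancel (g y) c)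
  refine ⟨locallyIntegrable_of_integrableOn_dyadicCube (hint 0), ?_⟩
  refine iSup_le fun m => iSup_le fun x => ?_
  obtain ⟨c, hc⟩ := h m x
  set Q := dyadicCube m x with hQ
  have hQ0 : volume Q ≠ 0 := volume_dyadicCube_pos m x
  have hQ1 : volume Q ≠ ∞ := volume_dyadicCube_ne_top m x
  have hcavg : ⨍ z in Q, (c - g z) = c - ⨍ z in Q, g z := by
    have h1 : IntegrableOn (fun _ => c) Q := integrableOn_const hQ1
    rw [setAverage_eq, integral_sub h1 (hint m x), smul_sub, ← setAverage_eq,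
      ← setAverage_eq, setAverage_const hQ0 hQ1]
  have hc' : ‖c - ⨍ z in Q, g z‖ₑ ≤ K := by
    rw [← hcavg, setAverage_eq, Measure.real, enorm_toReal_inv_smul hQ0 hQ1,
      ENNReal.inv_mul_le_iff hQ0 hQ1, mul_comm]
    refine (enorm_integral_le_lintegral_enorm _).trans (le_trans (le_of_eq ?_) hc)
    exact lintegral_congr fun y => enorm_sub_rev _ _
  rw [ENNReal.inv_mul_le_iff hQ0 hQ1]
  calc ∫⁻ y in Q, ‖g y - ⨍ z in Q, g z‖ₑ
      ≤ ∫⁻ y in Q, (‖g y - c‖ₑ + K) := by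
        refine lintegral_mono fun y => ?_
        calc ‖g y - ⨍ z in Q, g z‖ₑ = ‖(g y - c) + (c - ⨍ z in Q, g z)‖ₑ := by
              rw [sub_add_sub_cancel]
          _ ≤ _ := (enorm_add_le _ _).trans (by gcongr)
    _ = (∫⁻ y in Q, ‖g y - c‖ₑ) + K * volume Q := by
        rw [lintegral_add_right _ measurable_const, setLIntegral_const]
    _ ≤ K * volume Q + K * volume Q := by gcongr
    _ = _ := by ring

/-- The `L^∞` to dyadic `BMO` inequality. -/
lemma exists_dyadicBMONorm_longVariation_le [CompleteSpace B] (hd : 1 ≤ d) {q : ℝ} (hq : 1 ≤ q)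
    (hB : HasMartingaleCotype B q) :
    ∃ C : ℝ≥0, ∀ f : 𝓔 → B, MemLp f ∞ volume → (∀ᵐ x, longVariation q f x < ∞) →
      LocallyIntegrable (fun x => (longVariation q f x).toReal) volume ∧
        dyadicBMONorm (fun x => (longVariation q f x).toReal) ≤ C * eLpNorm f ∞ volume := by
  obtain ⟨C, hC, h⟩ := exists_lintegral_enorm_longVariation_sub_le (d := d) hd hq hB
  lift C to ℝ≥0 using hC
  refine ⟨2 * C, fun f hf hfin => ?_⟩
  obtain ⟨g, hgm, hfg⟩ := hf.1
  rw [longVariation_congr_ae hfg] at hfin ⊢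
  rw [eLpNorm_congr_ae hfg]
  have hgL : MemLp g ∞ volume := hf.ae_eq hfg
  obtain ⟨M, hM⟩ : ∃ M : ℝ≥0, (M : ℝ≥0∞) = eLpNorm g ∞ volume :=
    ⟨_, ENNReal.coe_toNNReal hgL.2.ne⟩
  have hbd : ∀ᵐ z, ‖g z‖ₑ ≤ M := by
    rw [hM, eLpNorm_exponent_top]
    exact enorm_ae_le_eLpNormEssSup g volume
  obtain ⟨h1, h2⟩ := locallyIntegrable_and_dyadicBMONorm_le
    (g := fun x => (longVariation q g x).toReal) (measurable_longVariation q hgm).ennreal_toReal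
    (K := C * M) (ENNReal.mul_ne_top ENNReal.coe_ne_top ENNReal.coe_ne_top)
    fun m x => h g hgm (hgL.locallyIntegrable le_top) M hbd hfin m x
  refine ⟨h1, h2.trans (le_of_eq ?_)⟩
  rw [← hM]
  push_cast
  ring

lemma ae_longVariation_lt_top [CompleteSpace B] (hd : 1 ≤ d) {q : ℝ} (hq : 1 ≤ q)
    (hB : HasMartingaleCotype B q) {f : 𝓔 → B} (hf : MemLp f ∞ volume) {S : Set 𝓔}
    (hS : IsCompact S) (hfS : ∀ᵐ x, x ∉ S → f x = 0) : ∀ᵐ x, longVariation q f x < ∞ := by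
  have hq0 : 0 < q := by linarith
  obtain ⟨C, hC, hCq⟩ := exists_lintegral_longVariation_rpow_le_of_ae_bound (d := d) hd hq hB
  obtain ⟨f', hf'm, hff'⟩ := hf.1
  set g := S.indicator f' with hg
  have hfg : f =ᵐ[volume] g := by
    filter_upwards [hff', hfS] with x hx hxS
    by_cases h : x ∈ S
    · simp [hg, h, hx]
    · simp [hg, h, hxS h]
  have hgm : StronglyMeasurable g := hf'm.indicator hS.measurableSet
  have hgL : MemLp g ∞ volume := hf.ae_eq hfg
  have hgi : Integrable g := (((hf.ae_eq hff').locallyIntegrable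
    le_top).integrableOn_isCompact hS).integrable_indicator hS.measurableSet
  have hbd : ∀ᵐ z, ‖g z‖ₑ ≤ eLpNorm g ∞ volume := by
    rw [eLpNorm_exponent_top]
    exact enorm_ae_le_eLpNormEssSup g volume
  obtain ⟨M, hM⟩ : ∃ M : ℝ≥0, (M : ℝ≥0∞) = eLpNorm g ∞ volume :=
    ⟨_, ENNReal.coe_toNNReal hgL.2.ne⟩
  rw [← hM] at hbd
  have hfin : ∫⁻ x, ‖g x‖ₑ ^ q ≠ ∞ := by
    have h1 : ∫⁻ x, ‖g x‖ₑ ^ q ≤ ∫⁻ x, S.indicator (fun _ => (M : ℝ≥0∞) ^ q) x := by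
      refine lintegral_mono_ae (hbd.mono fun z hz => ?_)
      by_cases h : z ∈ S
      · rw [Set.indicator_of_mem h]
        gcongr
      · simp [hg, h, hq0]
    refine ne_top_of_le_ne_top ?_ h1
    rw [lintegral_indicator_const hS.measurableSet]
    exact ENNReal.mul_ne_top (ENNReal.rpow_ne_top_of_nonneg hq0.le ENNReal.coe_ne_top)
      hS.measure_lt_top.ne
  have h2 := ne_top_of_le_ne_top (ENNReal.mul_ne_top hC hfin) (hCq g hgm hgi ⟨M, hbd⟩)
  rw [longVariation_congr_ae hfg]
  filter_upwards [ae_lt_top ((measurable_longVariation q hgm).pow_const q) h2] with x hx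
  exact (ENNReal.rpow_lt_top_iff_of_pos hq0).1 hx

lemma exists_eLpNorm_longVariation_le [CompleteSpace B] (hd : 1 ≤ d) {q : ℝ} (hq : 1 ≤ q)
    (hB : HasMartingaleCotype B q) {p : ℝ≥0∞} (hp : 1 < p) (hp' : p < ∞) :
    ∃ C : ℝ≥0, ∀ f : 𝓔 → B, MemLp f p volume →
      eLpNorm (longVariation q f) p volume ≤ C * eLpNorm f p volume := by
  have hp0 : p ≠ 0 := (zero_lt_one.trans hp).ne'
  have hp1 : 1 < p.toReal := by
    rw [← ENNReal.toReal_one]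
    exact (ENNReal.toReal_lt_toReal ENNReal.one_ne_top hp'.ne).2 hp
  have hpp : 0 < p.toReal := by linarith
  obtain ⟨C, hC, h⟩ := exists_lintegral_longVariation_rpow_le_of_memLp (d := d) hd hq hB hp1
  have hC' : C ^ (1 / p.toReal) ≠ ∞ := ENNReal.rpow_ne_top_of_nonneg (by positivity) hC
  refine ⟨(C ^ (1 / p.toReal)).toNNReal, fun f hf => ?_⟩
  rw [ENNReal.coe_toNNReal hC']
  obtain ⟨g, hgm, hfg⟩ := hf.1
  have hgL : MemLp g p volume := hf.ae_eq hfg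
  rw [longVariation_congr_ae hfg, eLpNorm_congr_ae hfg,
    eLpNorm_eq_lintegral_rpow_enorm_toReal hp0 hp'.ne,
    eLpNorm_eq_lintegral_rpow_enorm_toReal hp0 hp'.ne,
    ← ENNReal.mul_rpow_of_nonneg _ _ (by positivity)]
  gcongr
  simp only [enorm_eq_self]
  exact h g hgm (hgL.locallyIntegrable hp.le)
    (lintegral_rpow_enorm_lt_top_of_eLpNorm_lt_top hp0 hp'.ne hgL.2).ne

lemma exists_weak_type_longVariation [CompleteSpace B] (hd : 1 ≤ d) {q : ℝ} (hq : 1 ≤ q)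
    (hB : HasMartingaleCotype B q) :
    ∃ C : ℝ≥0, ∀ f : 𝓔 → B, MemLp f 1 volume → ∀ t : ℝ≥0, 0 < t →
      volume {x | (t : ℝ≥0∞) < longVariation q f x} ≤ C / t * eLpNorm f 1 volume := by
  obtain ⟨C, hC, h⟩ := exists_volume_lt_longVariation_le (d := d) hd hq hB
  lift C to ℝ≥0 using hC
  refine ⟨C, fun f hf t ht => ?_⟩
  obtain ⟨g, hgm, hfg⟩ := hf.1
  rw [longVariation_congr_ae hfg, eLpNorm_congr_ae hfg, eLpNorm_one_eq_lintegral_enorm,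
    div_eq_mul_inv, mul_assoc]
  exact h g hgm (memLp_one_iff_integrable.1 (hf.ae_eq hfg)) t
    (by simpa using ht.ne') ENNReal.coe_ne_top

end LongVariation

end

theorem mainTheorem8 {B : Type*} [NormedAddCommGroup B] [NormedSpace ℝ B] [CompleteSpace B]
    (d : ℕ) (hd : 1 ≤ d) (q₀ : ℝ) (hq₀ : 2 ≤ q₀) (hB : HasMartingaleCotype B q₀) :
    -- strong type `(p, p)`, `1 < p < ∞`
    (∀ p : ℝ≥0∞, 1 < p → p < ∞ → ∃ C : ℝ≥0,
      ∀ f : EuclideanSpace ℝ (Fin d) → B, MemLp f p volume →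
        eLpNorm (longVariation q₀ f) p volume ≤ C * eLpNorm f p volume) ∧
    -- weak type `(1, 1)`
    (∃ C : ℝ≥0, ∀ f : EuclideanSpace ℝ (Fin d) → B, MemLp f 1 volume →
      ∀ lam : ℝ≥0, 0 < lam →
        volume {x | (lam : ℝ≥0∞) < longVariation q₀ f x} ≤ C / lam * eLpNorm f 1 volume) ∧
    -- from `L^∞` to dyadic BMO
    (∃ C : ℝ≥0,
      (∀ f : EuclideanSpace ℝ (Fin d) → B, MemLp f ∞ volume →
        (∃ S : Set (EuclideanSpace ℝ (Fin d)), IsCompact S ∧ ∀ᵐ x, x ∉ S → f x = 0) →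
          (∀ᵐ x, longVariation q₀ f x < ∞) ∧
          LocallyIntegrable (fun x => (longVariation q₀ f x).toReal) volume ∧
          dyadicBMONorm (fun x => (longVariation q₀ f x).toReal) ≤ C * eLpNorm f ∞ volume) ∧
      (∀ f : EuclideanSpace ℝ (Fin d) → B, MemLp f ∞ volume →
        (∀ᵐ x, longVariation q₀ f x < ∞) →
          LocallyIntegrable (fun x => (longVariation q₀ f x).toReal) volume ∧
          dyadicBMONorm (fun x => (longVariation q₀ f x).toReal) ≤ C * eLpNorm f ∞ volume)) := by
  have hq : 1 ≤ q₀ := one_le_two.trans hq₀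
  obtain ⟨C, hC⟩ := LongVariation.exists_dyadicBMONorm_longVariation_le (d := d) hd hq hB
  refine ⟨fun p hp hp' => LongVariation.exists_eLpNorm_longVariation_le hd hq hB hp hp',
    LongVariation.exists_weak_type_longVariation hd hq hB, C, fun f hf ⟨S, hS, hfS⟩ => ?_, hC⟩
  have hfin := LongVariation.ae_longVariation_lt_top hd hq hB hf hS hfS
  exact ⟨hfin, hC f hf hfin⟩
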